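/- **Setting.** Let $\nu_0>0$ and $\nu=r\nu_0$, $1/\nu=s\nu_0$ with positive integers $r,s$ (so $\nu_0=1/\sqrt{rs}$, $\nu=\sqrt{r/s}$), let $N,M\in\mathbb N_0$, and $g=\nu^2$. Let $\mathcal D_b$ be the space of finite linear combinations of the orthonormal states $$\eta^b_{Q,\mathbf m}=\prod_{n\ge1}\frac{c_{-n}^{m_n}}{\sqrt{n^{m_n}m_n!}}\,R^Q|0\rangle\qquad(Q\in\mathbb Z,\ m_n\in\mathbb N_0,\ \text{finitely many } m_n\neq0),$$ where $[c_n,c_m]=n\delta_{n+m,0}$, $[c_n,R]=\delta_{n,0}R$, $c_n^\dagger=c_{-n}$, $R^\dagger=R^{-1}$, $c_n|0\rangle=0$ for $n\ge0$; put $|Q\rangle=R^Q|0\rangle$, $\mathcal Q=\nu_0c_0$, and let $:\cdots:$ denote normal ordering. On $\mathcal D_b$ define $\mathcal H^{\nu,1}=\mathcal Q/\nu$, $\mathcal H^{\nu,2}=\frac12\mathcal Q^2+\sum_{n>0}c_{-n}c_n$, and $$\mathcal H^{\nu,3}=\frac\nu3\sum_{\substack{n,m,\ell\ne0\\ n+m+\ell=0}}:c_nc_mc_\ell:+\sum_{n>0}\bigl[(1-\nu^2)n+2\nu\mathcal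 Q\bigr]c_{-n}c_n+\frac\nu3\mathcal Q^3-\frac{\nu^3}{12}\mathcal Q .$$ For $\kappa\in\nu_0\mathbb Z$ the vertex operators are the quadratic forms on $\mathcal D_b$ $$\phi_\kappa(x)=e^{-\kappa\sum_{n<0}\frac{c_n}{n}e^{inx}}\,e^{-i\kappa\mathcal Qx/2}R^{\kappa/\nu_0}e^{-i\kappa\mathcal Qx/2}\,e^{-\kappa\sum_{n>0}\frac{c_n}{n}e^{inx}} ,$$ and $\Phi_\nu^{N,M}(\mathbf x,\mathbf y)=\phi_\nu(x_1)\cdots\phi_\nu(x_N)\phi_{-1/\nu}(y_1)\cdots\phi_{-1/\nu}(y_M)$ is defined, as a product of quadratic forms (with sums over the intermediate states $\eta^b_{Q',\mathbf m}$), in the region $0>\Im x_1>\dots>\Im x_N>\Im y_1>\dots>\Im y_M$. The adjoint $\Phi_\nu^{N,M}(\mathbf x,\mathbf y)^\dagger$ is continued analytically from real arguments, i.e. it is the adjoint of $\Phi_\nu^{N,M}(\bar{\mathbf x},\bar{\mathbf y})$, and is defined in the complex conjugate region $\Omega$. With $[u]=e^{iu/2}-e^{-iu/2}$ let $$\Psi_0^{N,M}(\mathbf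 x,\mathbf y;g)=\frac{\prod_{j<j'}[x_j-x_{j'}]^g\,\prod_{k<k'}[y_k-y_{k'}]^{1/g}}{\prod_{j,k}[x_j-y_k]},$$ with the branch $[u]^a=e^{iau/2}(1-e^{-iu})^a$ (principal power). It is analytic on the open set $U\supset\Omega$ of all $(\mathbf x,\mathbf y)\in\mathbb C^{N+M}$ with $1-e^{-i(x_j-x_{j'})}\notin(-\infty,0]$ for $j<j'$, $1-e^{-i(y_k-y_{k'})}\notin(-\infty,0]$ for $k<k'$, and $\sin\frac12(x_j-y_k)\neq0$; $U$ contains all real configurations without coincidences modulo $2\pi$. Let $\Lambda_{N,M,g}$ be the algebra of complex polynomials $P(\mathbf z,\mathbf w)$ in $N+M$ variables that are symmetric in $\mathbf z$ and in $\mathbf w$ separately and satisfy $(\partial_{z_j}+g\,\partial_{w_k})P=0$ at $z_j=w_k$ for all $j,k$. Let $D_{N,M}=-i\bigl(\sum_j\partial_{x_j}+\sum_k\partial_{y_k}\bigr)$ and $$H_{N,M}=-\sum_j\partial_{x_j}^2+\sum_{j<j'}\frac{g(g-1)}{2\sin^2\frac12(x_j-x_{j'})}+g\sum_k\partial_{y_k}^2+\sum_{k<k'}\frac{(g-1)/g}{2\sin^2\frac12(y_k-y_{k'})}+\sum_{j,k}\frac{1-g}{2\sin^2\frac12(x_j-y_k)}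 .$$ **Corollary.** Let $\eta\in\mathcal D_b$ be a common eigenstate of $\mathcal H^{\nu,k}$ with eigenvalues $E_k$, $k=1,2,3$. Then $$Q=\nu\nu_0^{-1}E_1-\nu\nu_0^{-1}N+(\nu\nu_0)^{-1}M$$ is an integer. For this $Q$ the sums over intermediate states that define $\Phi_\nu^{N,M}(\mathbf x,\mathbf y)|Q\rangle$ converge absolutely in the region above, and the function $f_\eta(\mathbf x,\mathbf y)=\langle Q|\Phi_\nu^{N,M}(\mathbf x,\mathbf y)^\dagger|\eta\rangle$ on $\Omega$ extends analytically to $U$. There is $P_\eta\in\Lambda_{N,M,g}$ such that on $U$ $$f_\eta(\mathbf x,\mathbf y)=e^{iq_0\left(\sum_jx_j-\frac1g\sum_ky_k\right)}\,\Psi_0^{N,M}(\mathbf x,\mathbf y;g)\,P_\eta(\mathbf z,\mathbf w),\qquad q_0=\tfrac12(N\nu^2-M)+\nu_0\nu Q,$$ where $z_j=e^{ix_j}$, $w_k=e^{iy_k}$. Moreover, on $U$, $$D_{N,M}f_\eta=\Bigl(E_2-\tfrac12(\nu_0Q)^2\Bigr)f_\eta ,$$ $$H_{N,M}f_\eta=\Bigl(E_3-\tfrac1{12}(\nu^2-\nu^{-2})M-\tfrac{\nu(\nu_0Q)^3}{3}+\tfrac{\nu^3\nu_0Q}{12}\Bigr)f_\eta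 .$$ (As usual for such maps, $f_\eta$ may vanish identically; the eigenvalue equations are then trivial.) -/

import Mathlib

open scoped BigOperators ComplexConjugate

noncomputable section

namespace AnyonCFT

/-! ### The boson Fock space -/

/-- Labels `(Q, m)` of the boson states: the charge `Q ∈ ℤ` and the occupation numbers
`m = (m₁, m₂, …)`, only finitely many of them non-zero. -/
abbrev FockIndex : Type := ℤ × (ℕ+ →₀ ℕ)

/-- The pre-Hilbert space `𝒟_b` of finite linear combinations of the orthonormal boson states
`η^b_{Q,m} = (∏ₙ (n^{mₙ} mₙ!)^{-1/2} c₋ₙ^{mₙ}) R^Q |0⟩`. A vector is given by its coefficients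
in this basis. -/
abbrev Db : Type := FockIndex →₀ ℂ

/-- The boson state `η^b_{Q,m}`. -/
def bosonState (i : FockIndex) : Db := Finsupp.single i 1

/-- The charged vacuum `|Q⟩ = R^Q |0⟩`. -/
def chargedVacuum (Q : ℤ) : Db := bosonState (Q, 0)

/-- The inner product of `𝒟_b`, linear in the second argument, for which the boson states are
orthonormal. -/
def braket (η η' : Db) : ℂ := η'.sum fun i b => conj (η i) * b

/-- The linear operator on `𝒟_b` with prescribed values on the boson states. -/
def onBasis (f : FockIndex → Db) : Module.End ℂ Db := Finsupp.linearCombination ℂ f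

/-- `cₙ` for `n > 0`: `cₙ η_{Q,m} = √(n mₙ) η_{Q,m-eₙ}` (zero if `mₙ = 0`). -/
def annihilate (n : ℕ+) : Module.End ℂ Db :=
  onBasis fun i => ((Real.sqrt ((n : ℝ) * (i.2 n : ℝ)) : ℝ) : ℂ) •
    bosonState (i.1, i.2 - Finsupp.single n 1)

/-- `c₋ₙ` for `n > 0`: `c₋ₙ η_{Q,m} = √(n (mₙ+1)) η_{Q,m+eₙ}`. -/
def create (n : ℕ+) : Module.End ℂ Db :=
  onBasis fun i => ((Real.sqrt ((n : ℝ) * ((i.2 n : ℝ) + 1)) : ℝ) : ℂ) •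
    bosonState (i.1, i.2 + Finsupp.single n 1)

/-- `c₀`: `c₀ η_{Q,m} = Q η_{Q,m}`. -/
def chargeNumber : Module.End ℂ Db := onBasis fun i => (i.1 : ℂ) • bosonState i

/-- The operators `cₙ`, `n ∈ ℤ`. -/
def mode : ℤ → Module.End ℂ Db
  | Int.ofNat 0 => chargeNumber
  | Int.ofNat (k + 1) => annihilate k.succPNat
  | Int.negSucc k => create k.succPNat

/-- The charge raising operator `R`: `R η_{Q,m} = η_{Q+1,m}`. It is invertible, and its integer
powers are those of the group of invertible linear maps. -/
def raise : Db ≃ₗ[ℂ] Db :=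
  Finsupp.domLCongr ((Equiv.addRight (1 : ℤ)).prodCongr (Equiv.refl (ℕ+ →₀ ℕ)))

/-- The normally ordered product of the operators `cₙ`, `n` in a list: creation operators (`n < 0`)
to the left, annihilation operators (`n > 0`) to the right, and the central charge operators `c₀`
in between. -/
def normalOrdered (l : List ℤ) : Module.End ℂ Db :=
  ((l.filter (· < 0)).map mode).prod * ((l.filter (· = 0)).map mode).prod *
    ((l.filter (0 < ·)).map mode).prod

/-- The sum `∑ₖ T k` of a family of operators of which only finitely many do not annihilate
a given boson state. All the families below have this property. -/
def sumOp {ι : Type} (T : ι → Module.End ℂ Db) : Module.End ℂ Db :=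
  onBasis fun i => ∑ᶠ k, T k (bosonState i)

/-! ### The operators `ℋ^{ν,1}`, `ℋ^{ν,2}`, `ℋ^{ν,3}` -/

/-- `𝒬 = ν₀ c₀`. -/
def chargeOp (ν₀ : ℝ) : Module.End ℂ Db := (ν₀ : ℂ) • mode 0

/-- The charge operator `ℋ^{ν,1} = 𝒬 / ν`. -/
def H1 (ν₀ ν : ℝ) : Module.End ℂ Db := (1 / ν : ℂ) • chargeOp ν₀

/-- The CFT Hamiltonian `ℋ^{ν,2} = 𝒬² / 2 + ∑_{n>0} c₋ₙ cₙ`. -/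
def H2 (ν₀ : ℝ) : Module.End ℂ Db :=
  (1 / 2 : ℂ) • chargeOp ν₀ ^ 2 + sumOp fun n : ℕ+ => mode (-(n : ℤ)) * mode (n : ℤ)

/-- `∑_{n,m,ℓ≠0} δ_{n+m+ℓ,0} :cₙ c_m c_ℓ:`. -/
def cubicTerm : Module.End ℂ Db :=
  sumOp fun p : ℤ × ℤ × ℤ =>
    if p.1 ≠ 0 ∧ p.2.1 ≠ 0 ∧ p.2.2 ≠ 0 ∧ p.1 + p.2.1 + p.2.2 = 0 then
      normalOrdered [p.1, p.2.1, p.2.2] else 0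

/-- The collective field Hamiltonian
`ℋ^{ν,3} = (ν/3) ∑ :cₙ c_m c_ℓ: + ∑_{n>0} [(1-ν²) n + 2ν𝒬] c₋ₙ cₙ + (ν/3) 𝒬³ - (ν³/12) 𝒬`. -/
def H3 (ν₀ ν : ℝ) : Module.End ℂ Db :=
  (ν / 3 : ℂ) • cubicTerm +
    sumOp (fun n : ℕ+ =>
      (((1 - (ν : ℂ) ^ 2) * (n : ℂ)) • (1 : Module.End ℂ Db) + (2 * ν : ℂ) • chargeOp ν₀) *
        (mode (-(n : ℤ)) * mode (n : ℤ))) +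
    (ν / 3 : ℂ) • chargeOp ν₀ ^ 3 - ((ν : ℂ) ^ 3 / 12) • chargeOp ν₀

/-! ### Vertex operators -/

/-- `κ ∑_{n>0} (cₙ / n) e^{inx}`. -/
def annihilationPart (κ : ℝ) (x : ℂ) : Module.End ℂ Db :=
  sumOp fun n : ℕ+ => ((κ : ℂ) / (n : ℂ) * Complex.exp (Complex.I * (n : ℂ) * x)) • mode (n : ℤ)

/-- `exp (κ ∑_{n>0} (cₙ / n) e^{inx})`; the exponent is locally nilpotent. -/
def expAnnihilationPart (κ : ℝ) (x : ℂ) : Module.End ℂ Db :=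
  sumOp fun k : ℕ => ((k.factorial : ℂ)⁻¹) • annihilationPart κ x ^ k

/-- `e^{-iκ𝒬x/2}`. -/
def expCharge (ν₀ κ : ℝ) (x : ℂ) : Module.End ℂ Db :=
  onBasis fun i => Complex.exp (-Complex.I * κ * (ν₀ * i.1) * x / 2) • bosonState i

/-- The vertex operator `φ_κ(x)` with statistics parameter `κ = a ν₀`, `a ∈ ℤ`, as a quadratic form
on `𝒟_b`: the value `⟨η| φ_κ(x) |η'⟩` for
`φ_κ(x) = exp (-κ ∑_{n<0} (cₙ/n) e^{inx}) e^{-iκ𝒬x/2} R^a e^{-iκ𝒬x/2} exp (-κ ∑_{n>0} (cₙ/n) e^{inx})`.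
The first factor acts on the bra, where its adjoint, obtained from `cₙ† = c₋ₙ`, is
`exp (κ ∑_{n>0} (cₙ/n) e^{in x̄})`. -/
def vertexForm (ν₀ : ℝ) (a : ℤ) (x : ℂ) (η η' : Db) : ℂ :=
  braket (expAnnihilationPart (a * ν₀) (conj x) η)
    (expCharge ν₀ (a * ν₀) x ((raise ^ a) (expCharge ν₀ (a * ν₀) x
      (expAnnihilationPart (-(a * ν₀)) x η'))))

/-- The matrix elements of the product `φ_{κ₁}(x₁) φ_{κ₂}(x₂) ⋯` of the vertex operators in a list of
pairs `(a_j, x_j)`, `κ_j = a_j ν₀`, with respect to the boson states: the product of quadratic forms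
is the matrix product, an infinite sum over intermediate states. -/
def productElem (ν₀ : ℝ) : List (ℤ × ℂ) → FockIndex → FockIndex → ℂ
  | [], i, j => if i = j then 1 else 0
  | p :: L, i, j =>
      ∑' k, vertexForm ν₀ p.1 p.2 (bosonState i) (bosonState k) * productElem ν₀ L k j

/-- Absolute convergence of all the sums over intermediate states that define the matrix elements
`⟨η^b_i| φ_{κ₁}(x₁) φ_{κ₂}(x₂) ⋯ |η^b_j⟩` for a fixed `j` and all `i`. -/
def ProductConverges (ν₀ : ℝ) : List (ℤ × ℂ) → FockIndex → Prop
  | [], _ => True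
  | p :: L, j => ProductConverges ν₀ L j ∧ ∀ i, Summable fun k =>
      vertexForm ν₀ p.1 p.2 (bosonState i) (bosonState k) * productElem ν₀ L k j

/-- The quadratic form on `𝒟_b` with given matrix elements. -/
def formValue (A : FockIndex → FockIndex → ℂ) (η η' : Db) : ℂ :=
  η.sum fun i a => η'.sum fun j b => conj a * A i j * b

/-- The factors of `Φ_ν^{N,M}(x,y) = φ_ν(x₁) ⋯ φ_ν(x_N) φ_{-1/ν}(y₁) ⋯ φ_{-1/ν}(y_M)`, where
`ν = r ν₀` and `1/ν = s ν₀`. -/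
def anyonFactors (r s : ℕ) {N M : ℕ} (x : Fin N → ℂ) (y : Fin M → ℂ) : List (ℤ × ℂ) :=
  (List.ofFn fun j => ((r : ℤ), x j)) ++ List.ofFn fun k => (-(s : ℤ), y k)

/-- The matrix elements of `Φ_ν^{N,M}(x,y)`. -/
def anyonProduct (ν₀ : ℝ) (r s : ℕ) {N M : ℕ} (x : Fin N → ℂ) (y : Fin M → ℂ) :
    FockIndex → FockIndex → ℂ :=
  productElem ν₀ (anyonFactors r s x y)

/-- The region `0 > Im x₁ > ⋯ > Im x_N > Im y₁ > ⋯ > Im y_M` where `Φ_ν^{N,M}(x,y)` is defined as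
a product of quadratic forms. -/
def orderedRegion (N M : ℕ) : Set ((Fin N → ℂ) × (Fin M → ℂ)) :=
  {p | (∀ j, (p.1 j).im < 0) ∧ (∀ k, (p.2 k).im < 0) ∧
    (∀ j j', j < j' → (p.1 j').im < (p.1 j).im) ∧
    (∀ k k', k < k' → (p.2 k').im < (p.2 k).im) ∧
    ∀ j k, (p.2 k).im < (p.1 j).im}

/-- The complex conjugate configuration. -/
def conjConfig {n : ℕ} (x : Fin n → ℂ) : Fin n → ℂ := fun j => conj (x j)

/-- The region `0 < Im x₁ < ⋯ < Im x_N < Im y₁ < ⋯ < Im y_M` where the adjoint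
`Φ_ν^{N,M}(x,y)†` is defined. -/
def adjointRegion (N M : ℕ) : Set ((Fin N → ℂ) × (Fin M → ℂ)) :=
  {p | (conjConfig p.1, conjConfig p.2) ∈ orderedRegion N M}

/-- The matrix elements of the adjoint `Φ_ν^{N,M}(x,y)†`. For complex arguments this is the analytic
continuation of the adjoint at real arguments, that is, the Hilbert space adjoint of
`Φ_ν^{N,M}(x̄,ȳ)`; it depends analytically on `x` and `y`. -/
def anyonProductAdjoint (ν₀ : ℝ) (r s : ℕ) {N M : ℕ} (x : Fin N → ℂ) (y : Fin M → ℂ) :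
    FockIndex → FockIndex → ℂ :=
  fun i j => conj (anyonProduct ν₀ r s (conjConfig x) (conjConfig y) j i)

/-- `f_η(x,y) = ⟨Q| Φ_ν^{N,M}(x,y)† |η⟩`. -/
def anyonCorrelation (ν₀ : ℝ) (r s : ℕ) (Q : ℤ) (η : Db) {N M : ℕ}
    (x : Fin N → ℂ) (y : Fin M → ℂ) : ℂ :=
  formValue (anyonProductAdjoint ν₀ r s x y) (chargedVacuum Q) η

/-! ### The deformed Calogero–Sutherland model -/

/-- The branch `e^{igu/2} (1 - e^{-iu})^g` (principal power) of `(e^{iu/2} - e^{-iu/2})^g`. It is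
analytic where `1 - e^{-iu}` is not in `(-∞, 0]`: off the half lines `Re u ∈ 2πℤ`, `Im u ≥ 0`. -/
def sinePower (g : ℝ) (u : ℂ) : ℂ :=
  Complex.exp (Complex.I * g * u / 2) * (1 - Complex.exp (-Complex.I * u)) ^ (g : ℂ)

/-- The dCS groundstate
`Ψ₀^{N,M}(x,y;g) = ∏_{j<j'} [x_j-x_{j'}]^g ∏_{k<k'} [y_k-y_{k'}]^{1/g} / ∏_{j,k} [x_j-y_k]` with
`[u] = e^{iu/2} - e^{-iu/2}`. -/
def groundState (g : ℝ) {N M : ℕ} (x : Fin N → ℂ) (y : Fin M → ℂ) : ℂ :=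
  (∏ j, ∏ j' ∈ Finset.Ioi j, sinePower g (x j - x j')) *
    (∏ k, ∏ k' ∈ Finset.Ioi k, sinePower (1 / g) (y k - y k')) /
    ∏ j, ∏ k, (Complex.exp (Complex.I * (x j - y k) / 2) -
      Complex.exp (Complex.I * (y k - x j) / 2))

/-- The configurations at which the groundstate above is analytic. This open set contains
all real configurations without coincidences modulo `2π`, and the region `adjointRegion N M`. -/
def regularRegion (N M : ℕ) : Set ((Fin N → ℂ) × (Fin M → ℂ)) :=
  {p | (∀ j j', j < j' →
      1 - Complex.exp (-Complex.I * (p.1 j - p.1 j')) ∈ Complex.slitPlane) ∧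
    (∀ k k', k < k' →
      1 - Complex.exp (-Complex.I * (p.2 k - p.2 k')) ∈ Complex.slitPlane) ∧
    ∀ j k, Complex.sin ((p.1 j - p.2 k) / 2) ≠ 0}

/-- The pair interaction `1 / (2 sin²(u/2))`. -/
def pairPotential (u : ℂ) : ℂ := 1 / (2 * Complex.sin (u / 2) ^ 2)

/-- The deformed CS operator `H_{N,M}(x,y;g)` applied to a function. At real configurations the
complex partial derivatives of an analytic function are the real ones. -/
def dCSHamiltonian (g : ℝ) {N M : ℕ} (F : (Fin N → ℂ) → (Fin M → ℂ) → ℂ)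
    (x : Fin N → ℂ) (y : Fin M → ℂ) : ℂ :=
  -(∑ j, iteratedDeriv 2 (fun t => F (Function.update x j t) y) (x j)) +
    (∑ j, ∑ j' ∈ Finset.Ioi j, (g : ℂ) * (g - 1) * pairPotential (x j - x j')) * F x y +
    (g : ℂ) * (∑ k, iteratedDeriv 2 (fun t => F x (Function.update y k t)) (y k)) +
    (∑ k, ∑ k' ∈ Finset.Ioi k, ((g : ℂ) - 1) / g * pairPotential (y k - y k')) * F x y +
    (∑ j, ∑ k, (1 - (g : ℂ)) * pairPotential (x j - y k)) * F x y

/-- The momentum operator `D_{N,M} = -i (∑_j ∂/∂x_j + ∑_k ∂/∂y_k)` applied to a function. -/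
def dCSMomentum {N M : ℕ} (F : (Fin N → ℂ) → (Fin M → ℂ) → ℂ)
    (x : Fin N → ℂ) (y : Fin M → ℂ) : ℂ :=
  -Complex.I * ((∑ j, deriv (fun t => F (Function.update x j t) y) (x j)) +
    ∑ k, deriv (fun t => F x (Function.update y k t)) (y k))

/-- The algebra `Λ_{N,M,g}` of the polynomials in `(z,w) = (z₁,…,z_N,w₁,…,w_M)` that are symmetric in
`z` and in `w` separately and satisfy `(∂/∂z_j + g ∂/∂w_k) P = 0` at `z_j = w_k`, for all `j`, `k`. -/
def deformedSymmetric (N M : ℕ) (g : ℝ) : Subalgebra ℂ (MvPolynomial (Fin N ⊕ Fin M) ℂ) where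
  carrier := {P |
    (∀ (σ : Equiv.Perm (Fin N)) (τ : Equiv.Perm (Fin M)),
      MvPolynomial.rename (Equiv.sumCongr σ τ) P = P) ∧
    ∀ (j : Fin N) (k : Fin M) (v : Fin N ⊕ Fin M → ℂ), v (Sum.inl j) = v (Sum.inr k) →
      MvPolynomial.eval v (MvPolynomial.pderiv (Sum.inl j) P) +
        (g : ℂ) * MvPolynomial.eval v (MvPolynomial.pderiv (Sum.inr k) P) = 0}
  mul_mem' := by
    rintro P P' ⟨hs, hd⟩ ⟨hs', hd'⟩
    refine ⟨fun σ τ => by rw [map_mul, hs, hs'], fun j k v hv => ?_⟩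
    have h := hd j k v hv
    have h' := hd' j k v hv
    simp only [Derivation.leibniz, smul_eq_mul, map_add, map_mul]
    linear_combination MvPolynomial.eval v P * h' + MvPolynomial.eval v P' * h
  add_mem' := by
    rintro P P' ⟨hs, hd⟩ ⟨hs', hd'⟩
    refine ⟨fun σ τ => by rw [map_add, hs, hs'], fun j k v hv => ?_⟩
    have h := hd j k v hv
    have h' := hd' j k v hv
    simp only [map_add]
    linear_combination h + h'
  algebraMap_mem' := by
    intro c
    refine ⟨fun σ τ => by simp, fun j k v hv => ?_⟩
    simp

/-- The value of a polynomial at `z_j = e^{ix_j}`, `w_k = e^{iy_k}`. -/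
def evalExp {N M : ℕ} (P : MvPolynomial (Fin N ⊕ Fin M) ℂ) (x : Fin N → ℂ) (y : Fin M → ℂ) : ℂ :=
  MvPolynomial.eval (Sum.elim (fun j => Complex.exp (Complex.I * x j))
    (fun k => Complex.exp (Complex.I * y k))) P

/-! ### The sums of operators above are locally finite -/

section LocallyFinite

open Finsupp

theorem onBasis_boson (f : FockIndex → Db) (i : FockIndex) : onBasis f (bosonState i) = f i := by
  simp [onBasis, bosonState]

theorem mode_pos (n : ℕ+) : mode (n : ℤ) = annihilate n := by
  obtain ⟨k, hk⟩ := n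
  obtain ⟨k, rfl⟩ : ∃ l, k = l + 1 := ⟨k - 1, by omega⟩
  rfl

theorem mode_neg (n : ℕ+) : mode (-(n : ℤ)) = create n := by
  obtain ⟨k, hk⟩ := n
  obtain ⟨k, rfl⟩ : ∃ l, k = l + 1 := ⟨k - 1, by omega⟩
  rfl

theorem annihilate_boson_eq_zero {n : ℕ+} {i : FockIndex} (h : i.2 n = 0) :
    annihilate n (bosonState i) = 0 := by
  simp [annihilate, onBasis_boson, h]

/-- The families `(A n cₙ)_{n>0}` are locally finite. -/
theorem finite_mul_annihilate (A : ℕ+ → Module.End ℂ Db) (i : FockIndex) :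
    {n : ℕ+ | (A n * mode (n : ℤ)) (bosonState i) ≠ 0}.Finite := by
  refine i.2.support.finite_toSet.subset fun n hn => ?_
  by_contra h
  refine hn ?_
  rw [Module.End.mul_apply, mode_pos, annihilate_boson_eq_zero (by simpa using h), map_zero]

/-- Span of the boson states with total occupation number less than `d`. -/
def lowStates (d : ℕ) : Submodule ℂ Db :=
  Submodule.span ℂ (bosonState '' {i | (i.2.sum fun _ k => k) < d})

theorem annihilationPart_lowStates (κ : ℝ) (x : ℂ) (d : ℕ) (v : Db) (hv : v ∈ lowStates (d + 1)) :
    annihilationPart κ x v ∈ lowStates d := by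
  induction hv using Submodule.span_induction with
  | zero => simp
  | add u w _ _ hu hw => rw [map_add]; exact add_mem hu hw
  | smul c u _ hu => rw [map_smul]; exact Submodule.smul_mem _ _ hu
  | mem u hu =>
    obtain ⟨i, hi, rfl⟩ := hu
    rw [annihilationPart, sumOp, onBasis_boson]
    refine finsum_induction (· ∈ lowStates d) (zero_mem _) (fun _ _ => add_mem) fun n => ?_
    by_cases hn : i.2 n = 0
    · simp [mode_pos, annihilate_boson_eq_zero hn]
    · rw [LinearMap.smul_apply, mode_pos, annihilate, onBasis_boson]
      refine Submodule.smul_mem _ _ (Submodule.smul_mem _ _ (Submodule.subset_span ⟨_, ?_, rfl⟩))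
      have h1 : single n 1 ≤ i.2 := by
        rw [Finsupp.single_le_iff]; omega
      have h2 : i.2 - single n 1 + single n 1 = i.2 := tsub_add_cancel_of_le h1
      have h3 := congrArg (fun m : ℕ+ →₀ ℕ => m.sum fun _ k => k) h2
      beta_reduce at h3
      rw [Finsupp.sum_add_index' (by simp) (by simp), Finsupp.sum_single_index (by simp)] at h3
      simp only [Set.mem_ofPred_eq] at hi ⊢
      omega

/-- The exponential series of the annihilation part is locally finite. -/
theorem finite_annihilationPart_pow (κ : ℝ) (x : ℂ) (i : FockIndex) :
    {k : ℕ | (((k.factorial : ℂ)⁻¹) • annihilationPart κ x ^ k) (bosonState i) ≠ 0}.Finite := by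
  have key : ∀ (d : ℕ) (v : Db), v ∈ lowStates d → ∀ k, d ≤ k → (annihilationPart κ x ^ k) v = 0 := by
    intro d
    induction d with
    | zero =>
      intro v hv k _
      have : v = 0 := by simpa [lowStates] using hv
      simp [this]
    | succ d ih =>
      intro v hv k hk
      obtain ⟨k, rfl⟩ : ∃ l, k = l + 1 := ⟨k - 1, by omega⟩
      rw [pow_succ, Module.End.mul_apply]
      exact ih _ (annihilationPart_lowStates κ x d v hv) k (by omega)
  refine (Set.finite_Iio ((i.2.sum fun _ k => k) + 1)).subset fun k hk => ?_
  by_contra h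
  refine hk ?_
  rw [LinearMap.smul_apply, key _ _ (Submodule.subset_span ⟨i, ?_, rfl⟩) k (not_lt.mp h), smul_zero]
  simp

/-- Span of the boson states without bosons in the modes above `B`. -/
def boundedStates (B : ℕ) : Submodule ℂ Db :=
  Submodule.span ℂ (bosonState '' {i | ∀ n ∈ i.2.support, (n : ℕ) ≤ B})

theorem annihilate_bounded (B : ℕ) (n : ℕ+) (v : Db) (hv : v ∈ boundedStates B) :
    annihilate n v ∈ boundedStates B ∧ (B < n → annihilate n v = 0) := by
  induction hv using Submodule.span_induction with
  | zero => simp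
  | add u w _ _ hu hw =>
    rw [map_add]
    exact ⟨add_mem hu.1 hw.1, fun h => by rw [hu.2 h, hw.2 h, add_zero]⟩
  | smul c u _ hu =>
    rw [map_smul]
    exact ⟨Submodule.smul_mem _ _ hu.1, fun h => by rw [hu.2 h, smul_zero]⟩
  | mem u hu =>
    obtain ⟨i, hi, rfl⟩ := hu
    refine ⟨?_, fun h => annihilate_boson_eq_zero ?_⟩
    · rw [annihilate, onBasis_boson]
      refine Submodule.smul_mem _ _ (Submodule.subset_span ⟨_, fun m hm => hi m ?_, rfl⟩)
      simp only [Finsupp.mem_support_iff, Finsupp.coe_tsub, Pi.sub_apply] at hm ⊢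
      omega
    · by_contra h'
      have := hi n (by simpa using h')
      omega

theorem prod_annihilate_bounded (B : ℕ) (l : List ℤ) (hl : ∀ a ∈ l, 0 < a) :
    (∀ v ∈ boundedStates B, (l.map mode).prod v ∈ boundedStates B) ∧
    ((∃ a ∈ l, (B : ℤ) < a) → ∀ v ∈ boundedStates B, (l.map mode).prod v = 0) := by
  induction l with
  | nil => simp
  | cons a l ih =>
    obtain ⟨ih1, ih2⟩ := ih fun b hb => hl b (by simp [hb])
    have ha : 0 < a := hl a (by simp)
    obtain ⟨n, rfl⟩ : ∃ n : ℕ+, a = n := ⟨⟨a.toNat, by omega⟩, by simp; omega⟩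
    simp only [List.map_cons, List.prod_cons, Module.End.mul_apply, mode_pos]
    refine ⟨fun v hv => (annihilate_bounded B n _ (ih1 v hv)).1, ?_⟩
    rintro ⟨b, hb, hB⟩ v hv
    rcases List.mem_cons.mp hb with rfl | hb
    · exact (annihilate_bounded B n _ (ih1 v hv)).2 (by exact_mod_cast hB)
    · rw [ih2 ⟨b, hb, hB⟩ v hv, map_zero]

/-- The cubic family is locally finite. -/
theorem finite_cubic (i : FockIndex) :
    {p : ℤ × ℤ × ℤ | (if p.1 ≠ 0 ∧ p.2.1 ≠ 0 ∧ p.2.2 ≠ 0 ∧ p.1 + p.2.1 + p.2.2 = 0 then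
      normalOrdered [p.1, p.2.1, p.2.2] else 0) (bosonState i) ≠ 0}.Finite := by
  set B : ℕ := i.2.support.sup fun n => (n : ℕ) with hB
  have hi : bosonState i ∈ boundedStates B :=
    Submodule.subset_span ⟨i, fun n hn => Finset.le_sup (f := fun n : ℕ+ => (n : ℕ)) hn, rfl⟩
  have hfin : (Set.Icc (-(2 * B : ℤ)) (2 * B)).Finite := Set.finite_Icc _ _
  refine (hfin.prod (hfin.prod hfin)).subset ?_
  rintro ⟨n, m, l⟩ hp
  simp only [Set.mem_ofPred_eq] at hp
  split_ifs at hp with hc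
  · have hle : ∀ a ∈ [n, m, l], a ≤ (B : ℤ) := by
      intro a ha
      by_contra hlt
      push Not at hlt
      refine hp ?_
      rw [normalOrdered, Module.End.mul_apply, (prod_annihilate_bounded B _ ?_).2
        ⟨a, ?_, hlt⟩ _ hi, map_zero]
      · intro b hb
        simpa using (List.mem_filter.mp hb).2
      · exact List.mem_filter.mpr ⟨ha, by simp; omega⟩
    simp only [List.mem_cons, List.not_mem_nil, or_false, forall_eq_or_imp, forall_eq] at hle
    simp only [Set.mem_prod, Set.mem_Icc]
    omega
  · simp at hp

end LocallyFinite

end AnyonCFT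

end

/-!
The corollary says that the correlation functions of anyon vertex operators turn eigenstates of the
collective field Hamiltonians into eigenfunctions of the deformed Calogero-Sutherland operator.

*Closed form.* A vertex operator maps a coherent state `exp (∑ pₙ c₋ₙ / n) |Q⟩` to a multiple of a
coherent state of shifted charge (`hasSum_vertexForm_coherent`); the sum over intermediate states
is a multivariate exponential series (`hasSum_expCoeff`), which converges absolutely because the
imaginary parts are ordered. By induction a product of vertex operators maps `|Q⟩` to a coherent
state whose parameters are weighted power sums, with weights `ν` for `x` and `-1/ν` for `y`, and
whose prefactor is an exponential times a product of pair contractions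
(`productElem_chargedVacuum`). Taking adjoints, `f_η` is a gauge factor, the plane wave times the
groundstate `Ψ₀`, times the polynomial
`bosonPoly κ η`, in which each `c₋ₙ` is replaced by the deformed power sum
`pₙ = ∑ κ_a z_a^n` (`anyonCorrelation_eq`). Deformed power sums generate polynomials in `Λ_{N,M,g}`
(`bosonPoly_mem`), and the closed form is analytic on the whole regular region.

*Eigenvalue equations.* Under `bosonPoly`, the operator `c₋ₙ` is multiplication by `pₙ`, and by the
chain rule `z_a ∂/∂z_a` becomes `∑ₙ κ_a z_a^n cₙ` (`bosonPoly_create`, `eulerDerivation_bosonPoly`).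
Conjugating `∑_a (ν / κ_a) (z_a ∂/∂z_a)²` with the gauge factor produces first and zeroth order
terms. The second and first order terms are the boson operator `ℋ^{ν,3}`
(`sum_eval_eulerDerivation_sq`). In the zeroth order terms the three-body part is constant by the
cotangent identity `pairCot_three`, and the two-body part cancels the pair potentials
(`sum_gaugeField_sq`, `two_body_terms_cancel`). What remains is a constant, which gives the shift of
the eigenvalue. The momentum operator and `ℋ^{ν,2}` are treated in the same way
(`sum_eval_eulerDerivation`).
-/

noncomputable section

namespace AnyonCFT

/-! ### The multivariate exponential series -/

section ExpCoeff

variable {ι : Type*}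

/-- The coefficient `∏ₙ tₙ^{dₙ} / dₙ!` of the monomial `d` in the exponential `exp (∑ₙ tₙ Xₙ)`. -/
def expCoeff (t : ι → ℂ) (d : ι →₀ ℕ) : ℂ := d.prod fun n k => t n ^ k / (k.factorial : ℂ)

theorem expCoeff_eq_prod (t : ι → ℂ) {d : ι →₀ ℕ} {s : Finset ι} (h : d.support ⊆ s) :
    expCoeff t d = ∏ n ∈ s, t n ^ d n / ((d n).factorial : ℂ) :=
  Finsupp.prod_of_support_subset _ h _ (by simp)

/-- The recursion `∂ₙ exp = tₙ exp` of the exponential series, coefficientwise. -/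
theorem expCoeff_add_single (t : ι → ℂ) (d : ι →₀ ℕ) (n : ι) :
    ((d n : ℂ) + 1) * expCoeff t (d + Finsupp.single n 1) = t n * expCoeff t d := by
  classical
  have h1 : (d + Finsupp.single n 1).support ⊆ insert n d.support := fun a ha => by
    by_cases h : a = n
    · simp [h]
    · simpa [h] using ha
  rw [expCoeff_eq_prod t h1, expCoeff_eq_prod t (Finset.subset_insert n d.support),
    ← Finset.mul_prod_erase _ _ (Finset.mem_insert_self n _),
    ← Finset.mul_prod_erase _ _ (Finset.mem_insert_self n d.support)]
  have h2 : ∀ a ∈ (insert n d.support).erase n,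
      t a ^ ((d + Finsupp.single n 1 : ι →₀ ℕ) a) /
          (((d + Finsupp.single n 1 : ι →₀ ℕ) a).factorial : ℂ) =
        t a ^ d a / ((d a).factorial : ℂ) := fun a ha => by
    simp [Finsupp.single_eq_of_ne (Finset.ne_of_mem_erase ha)]
  rw [Finset.prod_congr rfl h2]
  have h3 : ((d n).factorial : ℂ) ≠ 0 := by exact_mod_cast (d n).factorial_ne_zero
  have h4 : ((d n : ℂ) + 1) ≠ 0 := by exact_mod_cast (d n).succ_ne_zero
  simp only [Finsupp.add_apply, Finsupp.single_eq_same, Nat.factorial_succ]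
  push_cast
  field_simp
  ring

theorem sum_finsupp_prod (s : Finset ι) (T : ι → Finset ℕ) (h : ι → ℕ → ℂ) :
    ∑ l ∈ s.finsupp T, ∏ n ∈ s, h n (l n) = ∏ n ∈ s, ∑ k ∈ T n, h n k := by
  classical
  rw [Finset.prod_sum, Finset.finsupp, Finset.sum_map]
  refine Finset.sum_congr rfl fun p _ => ?_
  rw [← Finset.prod_attach s]
  refine Finset.prod_congr rfl fun n _ => ?_
  simp [Finsupp.indicator_apply]

/-- `exp (∑ aₙ Xₙ) exp (∑ bₙ Xₙ) = exp (∑ (aₙ + bₙ) Xₙ)`, coefficientwise. -/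
theorem sum_expCoeff_mul [DecidableEq ι] (a b : ι → ℂ) (m : ι →₀ ℕ) :
    ∑ l ∈ Finset.Iic m, expCoeff a l * expCoeff b (m - l) = expCoeff (a + b) m := by
  have hI : Finset.Iic m = m.support.finsupp fun n => Finset.range (m n + 1) := by
    ext l
    rw [Finset.mem_Iic, Finset.mem_finsupp_iff]
    refine ⟨fun h => ⟨Finsupp.support_mono h, fun n _ => ?_⟩, fun h n => ?_⟩
    · have := h n
      simp only [Finset.mem_range]; omega
    · by_cases hn : n ∈ m.support
      · have := h.2 n hn
        simp only [Finset.mem_range] at this; omega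
      · have : l n = 0 := by simpa using fun h' => hn (h.1 h')
        omega
  have h1 : ∀ l ∈ Finset.Iic m, expCoeff a l * expCoeff b (m - l) =
      ∏ n ∈ m.support, (a n ^ l n / ((l n).factorial : ℂ)) *
        (b n ^ (m n - l n) / ((m n - l n).factorial : ℂ)) := fun l hl => by
    rw [Finset.mem_Iic] at hl
    rw [expCoeff_eq_prod a (Finsupp.support_mono hl),
      expCoeff_eq_prod b (Finsupp.support_mono (tsub_le_self (b := l))), ← Finset.prod_mul_distrib]
    rfl
  rw [Finset.sum_congr rfl h1, hI, sum_finsupp_prod _ _ fun n k =>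
    (a n ^ k / (k.factorial : ℂ)) * (b n ^ (m n - k) / ((m n - k).factorial : ℂ)),
    expCoeff_eq_prod _ subset_rfl]
  refine Finset.prod_congr rfl fun n _ => ?_
  rw [Pi.add_apply, add_pow, Finset.sum_div]
  refine Finset.sum_congr rfl fun k hk => ?_
  have hk : k ≤ m n := by simp only [Finset.mem_range] at hk; omega
  rw [Nat.cast_choose ℂ hk]
  have h3 : ((m n).factorial : ℂ) ≠ 0 := by exact_mod_cast (m n).factorial_ne_zero
  have h4 : (k.factorial : ℂ) ≠ 0 := by exact_mod_cast k.factorial_ne_zero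
  have h5 : ((m n - k).factorial : ℂ) ≠ 0 := by exact_mod_cast (m n - k).factorial_ne_zero
  field_simp

/-- Every finite set of finitely supported functions lies in a box. -/
theorem exists_subset_finsupp (u : Finset (ι →₀ ℕ)) :
    ∃ (F : Finset ι) (K : ℕ), u ⊆ F.finsupp fun _ => Finset.range K := by
  classical
  refine ⟨u.biUnion fun d => d.support, (u.sup fun d => d.support.sup d) + 1, fun d hd => ?_⟩
  rw [Finset.mem_finsupp_iff]
  refine ⟨Finset.subset_biUnion_of_mem (fun d : ι →₀ ℕ => d.support) hd, fun n _ => ?_⟩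
  rw [Finset.mem_range, Nat.lt_succ_iff]
  by_cases hn : n ∈ d.support
  · exact (Finset.le_sup (f := d) hn).trans
      (Finset.le_sup (f := fun d : ι →₀ ℕ => d.support.sup d) hd)
  · simp [Finsupp.notMem_support_iff.mp hn]

/-- The partial sums of the exponential series over boxes factorize. -/
theorem sum_expCoeff_box (t : ι → ℂ) (F : Finset ι) (K : ℕ) :
    ∑ d ∈ F.finsupp (fun _ => Finset.range K), expCoeff t d =
      ∏ n ∈ F, ∑ k ∈ Finset.range K, t n ^ k / (k.factorial : ℂ) := by
  rw [← sum_finsupp_prod F (fun _ => Finset.range K) fun n k => t n ^ k / (k.factorial : ℂ)]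
  exact Finset.sum_congr rfl fun d hd =>
    expCoeff_eq_prod t (Finset.mem_finsupp_iff.mp hd).1

theorem summable_norm_expCoeff {t : ι → ℂ} (ht : Summable fun n => ‖t n‖) :
    Summable fun d => ‖expCoeff t d‖ := by
  classical
  have hn : ∀ d, ((‖expCoeff t d‖ : ℝ) : ℂ) = expCoeff (fun n => (‖t n‖ : ℂ)) d := fun d => by
    rw [expCoeff, Finsupp.prod, norm_prod, expCoeff, Finsupp.prod]
    push_cast
    simp
  refine summable_of_sum_le (c := Real.exp (∑' n, ‖t n‖)) (fun _ => norm_nonneg _) fun u => ?_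
  obtain ⟨F, K, hu⟩ := exists_subset_finsupp u
  calc ∑ d ∈ u, ‖expCoeff t d‖
      ≤ ∑ d ∈ F.finsupp (fun _ => Finset.range K), ‖expCoeff t d‖ :=
        Finset.sum_le_sum_of_subset_of_nonneg hu fun _ _ _ => norm_nonneg _
    _ = ∏ n ∈ F, ∑ k ∈ Finset.range K, ‖t n‖ ^ k / (k.factorial : ℝ) := by
        have := sum_expCoeff_box (fun n => (‖t n‖ : ℂ)) F K
        simp only [← hn] at this
        exact_mod_cast this
    _ ≤ ∏ n ∈ F, Real.exp ‖t n‖ :=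
        Finset.prod_le_prod (fun _ _ => Finset.sum_nonneg fun _ _ => by positivity)
          fun n _ => Real.sum_le_exp_of_nonneg (norm_nonneg _) K
    _ = Real.exp (∑ n ∈ F, ‖t n‖) := (Real.exp_sum _ _).symm
    _ ≤ Real.exp (∑' n, ‖t n‖) :=
        Real.exp_le_exp.mpr (ht.sum_le_tsum F fun _ _ => norm_nonneg _)

open Filter Topology in
/-- The multivariate exponential series `∑_d ∏ₙ tₙ^{dₙ} / dₙ! = exp (∑ₙ tₙ)`. -/
theorem hasSum_expCoeff {t : ι → ℂ} (ht : Summable fun n => ‖t n‖) :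
    HasSum (expCoeff t) (Complex.exp (∑' n, t n)) := by
  classical
  have hS := (summable_norm_expCoeff ht).of_norm.hasSum
  set S := ∑' d, expCoeff t d with hSdef
  suffices h : Tendsto (fun F : Finset ι => Complex.exp (∑ n ∈ F, t n)) atTop (𝓝 S) by
    have h' := (Complex.continuous_exp.tendsto _).comp ht.of_norm.hasSum
    rw [show Complex.exp (∑' n, t n) = S from tendsto_nhds_unique h' h]
    exact hS
  have hmono : Tendsto (fun p : Finset ι × ℕ => p.1.finsupp fun _ => Finset.range (p.2 + 1))
      atTop atTop := by
    refine tendsto_atTop_finset_of_monotone ?_ fun d => ?_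
    · rintro ⟨F, K⟩ ⟨F', K'⟩ ⟨h1, h2⟩ d hd
      have h2 : K ≤ K' := h2
      simp only [Finset.mem_finsupp_iff, Finset.mem_range] at hd ⊢
      refine ⟨hd.1.trans h1, fun n hn => ?_⟩
      by_cases hF : n ∈ F
      · exact (hd.2 n hF).trans_le (by omega)
      · have h0 : d n = 0 := by simpa using fun h' => hF (hd.1 h')
        omega
    · obtain ⟨F, K, h⟩ := exists_subset_finsupp {d}
      have hd := h (Finset.mem_singleton_self d)
      refine ⟨(F, K), ?_⟩
      simp only [Finset.mem_finsupp_iff, Finset.mem_range] at hd ⊢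
      exact ⟨hd.1, fun n hn => (hd.2 n hn).trans K.lt_succ_self⟩
  have hlim := hS.comp hmono
  rw [← prod_atTop_atTop_eq] at hlim
  refine (closed_nhds_basis S).tendsto_right_iff.mpr fun V hV => ?_
  have hev : ∀ᶠ p : Finset ι × ℕ in atTop ×ˢ atTop,
      ∏ n ∈ p.1, ∑ k ∈ Finset.range (p.2 + 1), t n ^ k / (k.factorial : ℂ) ∈ V := by
    filter_upwards [hlim.eventually hV.1] with p hp
    rwa [← sum_expCoeff_box]
  -- Iterated limit: for a fixed finite set `F` of variables the bound `K` on the exponents tends to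
  -- infinity first; closed neighbourhoods survive that limit.
  refine hev.curry.mono fun F hF => ?_
  rw [Complex.exp_sum]
  refine hV.2.mem_of_tendsto (tendsto_finsetProd F fun n _ => ?_) hF
  have := (NormedSpace.expSeries_div_hasSum_exp (t n)).tendsto_sum_nat
  rw [← Complex.exp_eq_exp_ℂ] at this
  exact this.comp (tendsto_add_atTop_nat 1)

end ExpCoeff

/-! ### Norms and monomials of the boson states -/

/-- The norm `∏ₙ √(n^{mₙ} mₙ!)` of the unnormalized state `∏ₙ c₋ₙ^{mₙ} |Q⟩`. -/
def stateNorm (m : ℕ+ →₀ ℕ) : ℝ := m.prod fun n k => Real.sqrt ((n : ℝ) ^ k * k.factorial)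

theorem stateNorm_pos (m : ℕ+ →₀ ℕ) : 0 < stateNorm m :=
  Finset.prod_pos fun n _ => Real.sqrt_pos.mpr (by have := n.pos; positivity)

theorem stateNorm_ne_zero (m : ℕ+ →₀ ℕ) : (stateNorm m : ℂ) ≠ 0 := by
  exact_mod_cast (stateNorm_pos m).ne'

theorem stateNorm_add_single (m : ℕ+ →₀ ℕ) (n : ℕ+) :
    stateNorm (m + Finsupp.single n 1) = Real.sqrt ((n : ℝ) * ((m n : ℝ) + 1)) * stateNorm m := by
  have h1 : (m + Finsupp.single n 1).support ⊆ insert n m.support := fun a ha => by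
    by_cases h : a = n
    · simp [h]
    · simpa [h] using ha
  rw [stateNorm, stateNorm, Finsupp.prod_of_support_subset _ h1 _ (by simp),
    Finsupp.prod_of_support_subset _ (Finset.subset_insert n m.support) _ (by simp),
    ← Finset.mul_prod_erase _ _ (Finset.mem_insert_self n _),
    ← Finset.mul_prod_erase _ _ (Finset.mem_insert_self n m.support), ← mul_assoc]
  have hn : (0 : ℝ) < n := by exact_mod_cast n.pos
  congr 1
  · rw [← Real.sqrt_mul (by positivity)]
    simp only [Finsupp.add_apply, Finsupp.single_eq_same, Nat.factorial_succ]
    push_cast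
    ring_nf
  · refine Finset.prod_congr rfl fun a ha => ?_
    simp [Finsupp.single_eq_of_ne (Finset.ne_of_mem_erase ha)]

/-- The value of the monomial `m` at `(p₁, p₂, …)`. -/
def powerMonomial {A : Type*} [CommMonoid A] (p : ℕ+ → A) (m : ℕ+ →₀ ℕ) : A :=
  m.prod fun n k => p n ^ k

theorem powerMonomial_add {A : Type*} [CommMonoid A] (p : ℕ+ → A) (l m : ℕ+ →₀ ℕ) :
    powerMonomial p (l + m) = powerMonomial p l * powerMonomial p m :=
  Finsupp.prod_add_index' (by simp) fun _ _ _ => pow_add _ _ _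

/-- The coefficients of `exp (∑ (pₙ / n) Xₙ)` are the monomials in the `pₙ`, divided by the squared
norms of the boson states. -/
theorem expCoeff_div (p : ℕ+ → ℂ) (m : ℕ+ →₀ ℕ) :
    expCoeff (fun n => p n / (n : ℂ)) m = powerMonomial p m / (stateNorm m : ℂ) ^ 2 := by
  rw [expCoeff, powerMonomial, stateNorm, Finsupp.prod, Finsupp.prod, Finsupp.prod]
  push_cast
  rw [← Finset.prod_pow, ← Finset.prod_div_distrib]
  refine Finset.prod_congr rfl fun n _ => ?_
  have hn : (0 : ℝ) < n := by exact_mod_cast n.pos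
  rw [← Complex.ofReal_pow, Real.sq_sqrt (by positivity), div_pow, div_div]
  push_cast
  rfl

theorem expCoeff_mul_powerMonomial (t p : ℕ+ → ℂ) (m : ℕ+ →₀ ℕ) :
    expCoeff t m * powerMonomial p m = expCoeff (fun n => t n * p n) m := by
  rw [expCoeff, powerMonomial, expCoeff, Finsupp.prod, Finsupp.prod, Finsupp.prod,
    ← Finset.prod_mul_distrib]
  refine Finset.prod_congr rfl fun n _ => ?_
  rw [mul_pow]
  ring

theorem expCoeff_conj {ι : Type*} (t : ι → ℂ) (m : ι →₀ ℕ) :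
    conj (expCoeff t m) = expCoeff (fun n => conj (t n)) m := by
  simp [expCoeff, Finsupp.prod, map_prod]

theorem powerMonomial_conj (p : ℕ+ → ℂ) (m : ℕ+ →₀ ℕ) :
    conj (powerMonomial p m) = powerMonomial (fun n => conj (p n)) m := by
  simp [powerMonomial, Finsupp.prod, map_prod]

/-! ### Matrix elements of the exponentials -/

theorem annihilate_boson (n : ℕ+) (q : ℤ) (m : ℕ+ →₀ ℕ) :
    annihilate n (bosonState (q, m)) = ((Real.sqrt ((n : ℝ) * (m n : ℝ)) : ℝ) : ℂ) •
      bosonState (q, m - Finsupp.single n 1) := by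
  rw [annihilate, onBasis_boson]

/-- The coefficients `κ e^{inx} / n` of the annihilation operators in `annihilationPart`. -/
def shiftCoeff (κ : ℝ) (x : ℂ) (n : ℕ+) : ℂ :=
  (κ : ℂ) / (n : ℂ) * Complex.exp (Complex.I * (n : ℂ) * x)

theorem sumOp_boson {ι : Type} (T : ι → Module.End ℂ Db) (i : FockIndex) {S : Finset ι}
    (hS : ∀ k ∉ S, T k (bosonState i) = 0) :
    sumOp T (bosonState i) = ∑ k ∈ S, T k (bosonState i) := by
  rw [sumOp, onBasis_boson]
  refine finsum_eq_sum_of_support_subset _ fun k hk => ?_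
  by_contra h
  exact hk (hS k h)

theorem annihilationPart_boson (κ : ℝ) (x : ℂ) (q : ℤ) (m : ℕ+ →₀ ℕ) :
    annihilationPart κ x (bosonState (q, m)) = ∑ n ∈ m.support,
      (shiftCoeff κ x n * ((Real.sqrt ((n : ℝ) * (m n : ℝ)) : ℝ) : ℂ)) •
        bosonState (q, m - Finsupp.single n 1) := by
  rw [annihilationPart, sumOp_boson (S := m.support)]
  · refine Finset.sum_congr rfl fun n _ => ?_
    rw [LinearMap.smul_apply, mode_pos, annihilate_boson, smul_smul]
    rfl
  · intro n hn
    rw [LinearMap.smul_apply, mode_pos, annihilate_boson_eq_zero (by simpa using hn), smul_zero]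

theorem bosonState_apply (i j : FockIndex) : bosonState i j = if j = i then 1 else 0 := by
  classical
  rw [bosonState, Finsupp.single_apply]
  simp [eq_comm]

/-- The `k`-th power of the annihilation part lowers the total occupation number by `k`; its matrix
elements are the coefficients of `(∑ tₙ Xₙ)^k`, up to the norms of the states. -/
theorem annihilationPart_pow_boson (κ : ℝ) (x : ℂ) (k : ℕ) (q q' : ℤ) (m l : ℕ+ →₀ ℕ) :
    (annihilationPart κ x ^ k) (bosonState (q, m)) (q', l) =
      if q' = q ∧ l ≤ m ∧ (m - l).degree = k then
        (k.factorial : ℂ) * ((stateNorm m : ℂ) / (stateNorm l : ℂ) *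
          expCoeff (shiftCoeff κ x) (m - l)) else 0 := by
  induction k generalizing m with
  | zero =>
    rw [pow_zero, Module.End.one_apply, bosonState_apply]
    have h : ((q', l) = ((q, m) : FockIndex)) ↔ q' = q ∧ l ≤ m ∧ (m - l).degree = 0 := by
      rw [Prod.mk.injEq, Finsupp.degree_eq_zero_iff, tsub_eq_zero_iff_le]
      exact and_congr_right fun _ => le_antisymm_iff
    by_cases hc : (q', l) = ((q, m) : FockIndex)
    · rw [if_pos hc, if_pos (h.mp hc)]
      obtain ⟨rfl, rfl⟩ := Prod.mk.inj hc
      simp [expCoeff, div_self (stateNorm_ne_zero l)]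
    · rw [if_neg hc, if_neg (fun h' => hc (h.mpr h'))]
  | succ k ih =>
    rw [pow_succ, Module.End.mul_apply, annihilationPart_boson, map_sum, Finsupp.finsetSum_apply]
    simp only [map_smul, Finsupp.smul_apply, ih, smul_eq_mul]
    by_cases hc : q' = q ∧ l ≤ m ∧ (m - l).degree = k + 1
    · rw [if_pos hc]
      obtain ⟨hq, hl, hd⟩ := hc
      obtain ⟨d, rfl⟩ := exists_add_of_le hl
      rw [add_tsub_cancel_left] at hd ⊢
      have hterm : ∀ n ∈ (l + d).support,
          shiftCoeff κ x n * ((Real.sqrt ((n : ℝ) * ((l + d) n : ℝ)) : ℝ) : ℂ) *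
            (if q' = q ∧ l ≤ l + d - Finsupp.single n 1 ∧
                (l + d - Finsupp.single n 1 - l).degree = k then
              (k.factorial : ℂ) * ((stateNorm (l + d - Finsupp.single n 1) : ℂ) / stateNorm l *
                expCoeff (shiftCoeff κ x) (l + d - Finsupp.single n 1 - l)) else 0) =
          (d n : ℂ) * ((k.factorial : ℂ) * ((stateNorm (l + d) : ℂ) / stateNorm l *
            expCoeff (shiftCoeff κ x) d)) := by
        intro n hm
        by_cases hn : d n = 0
        · rw [if_neg, hn]
          · simp
          · rintro ⟨-, h, -⟩
            have := h n
            simp only [Finsupp.coe_tsub, Finsupp.coe_add, Pi.sub_apply, Pi.add_apply, hn,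
              Finsupp.single_eq_same] at this
            simp only [Finsupp.mem_support_iff, Finsupp.add_apply, hn] at hm
            omega
        · obtain ⟨e, rfl⟩ : ∃ e, d = e + Finsupp.single n 1 :=
            ⟨d - Finsupp.single n 1, (tsub_add_cancel_of_le (by
              rw [Finsupp.single_le_iff]; omega)).symm⟩
          have h1 : l + (e + Finsupp.single n 1) - Finsupp.single n 1 = l + e := by
            rw [← add_assoc, add_tsub_cancel_right]
          rw [h1, add_tsub_cancel_left, if_pos, ← add_assoc, stateNorm_add_single]
          · have h2 := expCoeff_add_single (shiftCoeff κ x) e n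
            simp only [Finsupp.add_apply, Finsupp.single_eq_same]
            push_cast
            linear_combination (-(Real.sqrt ((n : ℝ) * ((l n : ℝ) + e n + 1)) : ℂ) *
              k.factorial * (stateNorm (l + e) / stateNorm l)) * h2
          · refine ⟨hq, le_self_add, ?_⟩
            rw [map_add, Finsupp.degree_single] at hd
            omega
      rw [Finset.sum_congr rfl hterm, ← Finset.sum_mul, ← Nat.cast_sum]
      have hs : ∑ n ∈ (l + d).support, d n = k + 1 := by
        rw [← hd, Finsupp.degree_apply]
        refine (Finset.sum_subset (Finsupp.support_mono le_add_self) fun n _ hn => ?_).symm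
        simpa using hn
      rw [hs, Nat.factorial_succ]
      push_cast
      ring
    · rw [if_neg hc]
      refine Finset.sum_eq_zero fun n hn => ?_
      rw [if_neg, mul_zero]
      rintro ⟨hq, hl, hd⟩
      have h1 : m - Finsupp.single n 1 + Finsupp.single n 1 = m := tsub_add_cancel_of_le (by
        rw [Finsupp.single_le_iff]
        have : m n ≠ 0 := by simpa using hn
        omega)
      obtain ⟨d, h2⟩ := exists_add_of_le hl
      rw [h2, add_tsub_cancel_left] at hd
      refine hc ⟨hq, ?_, ?_⟩
      · rw [← h1, h2, add_assoc]; exact le_self_add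
      · rw [← h1, h2, add_assoc, add_tsub_cancel_left, map_add, hd, Finsupp.degree_single]

theorem expAnnihilationPart_boson (κ : ℝ) (x : ℂ) (q q' : ℤ) (m l : ℕ+ →₀ ℕ) :
    expAnnihilationPart κ x (bosonState (q, m)) (q', l) =
      if q' = q ∧ l ≤ m then
        (stateNorm m : ℂ) / (stateNorm l : ℂ) * expCoeff (shiftCoeff κ x) (m - l) else 0 := by
  have hfin := finite_annihilationPart_pow κ x (q, m)
  rw [expAnnihilationPart, sumOp_boson (S := hfin.toFinset ∪ {(m - l).degree}),
    Finsupp.finsetSum_apply]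
  · simp only [LinearMap.smul_apply, Finsupp.smul_apply, annihilationPart_pow_boson, smul_eq_mul]
    rw [Finset.sum_eq_single (m - l).degree]
    · by_cases hc : q' = q ∧ l ≤ m
      · rw [if_pos ⟨hc.1, hc.2, rfl⟩, if_pos hc, inv_mul_cancel_left₀]
        exact_mod_cast Nat.factorial_ne_zero _
      · rw [if_neg fun h => hc ⟨h.1, h.2.1⟩, if_neg hc, mul_zero]
    · intro k _ hk
      rw [if_neg fun h => hk h.2.2.symm, mul_zero]
    · intro h
      simp at h
  · intro k hk
    by_contra h
    exact hk (by simp only [Finset.mem_union, Set.Finite.mem_toFinset]; exact Or.inl h)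

/-! ### Products of vertex operators on a charged vacuum -/

theorem expCharge_apply (ν₀ κ : ℝ) (x : ℂ) (v : Db) (q : ℤ) (m : ℕ+ →₀ ℕ) :
    expCharge ν₀ κ x v (q, m) =
      Complex.exp (-Complex.I * κ * (ν₀ * q) * x / 2) * v (q, m) := by
  classical
  induction v using Finsupp.induction_linear with
  | zero => simp
  | add u w hu hw => rw [map_add, Finsupp.add_apply, hu, hw, Finsupp.add_apply, mul_add]
  | single i b =>
    have h : (Finsupp.single i b : Db) = b • bosonState i := by simp [bosonState]
    rw [h, map_smul, expCharge, onBasis_boson]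
    simp only [Finsupp.smul_apply, bosonState_apply, smul_eq_mul]
    by_cases hi : (q, m) = i
    · subst hi
      simp only [if_true]
      ring
    · simp [hi]

theorem raise_apply (v : Db) (q : ℤ) (m : ℕ+ →₀ ℕ) : raise v (q, m) = v (q - 1, m) := by
  simp [raise, sub_eq_add_neg]

theorem raise_zpow_apply (a : ℤ) (v : Db) (q : ℤ) (m : ℕ+ →₀ ℕ) :
    (raise ^ a) v (q, m) = v (q - a, m) := by
  induction a generalizing v with
  | zero => simp
  | succ k ih =>
    rw [zpow_add_one, LinearEquiv.mul_apply, ih, raise_apply, sub_sub]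
  | pred k ih =>
    rw [zpow_sub_one, LinearEquiv.mul_apply, ih]
    have h := raise_apply (raise⁻¹ v) (q - -(k : ℤ) + 1) m
    rw [add_sub_cancel_right] at h
    rw [← h, ← LinearEquiv.mul_apply, mul_inv_cancel, LinearEquiv.coe_one, id]
    congr 2
    ring

theorem braket_eq_sum {η : Db} (η' : Db) {S : Finset FockIndex} (h : ∀ i ∉ S, η i = 0) :
    braket η η' = ∑ i ∈ S, conj (η i) * η' i := by
  classical
  rw [braket, Finsupp.sum, Finset.sum_subset (Finset.subset_union_right (s₁ := S)) fun i _ hi => by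
    simp [Finsupp.notMem_support_iff.mp hi]]
  refine (Finset.sum_subset Finset.subset_union_left fun i _ hi => ?_).symm
  simp [h i hi]

/-- Matrix elements of a vertex operator: the sum over `l` runs through the states between the
creation and the annihilation exponential. -/
theorem vertexForm_boson (ν₀ : ℝ) (a : ℤ) (x : ℂ) (q q' : ℤ) (m m' : ℕ+ →₀ ℕ) :
    vertexForm ν₀ a x (bosonState (q, m)) (bosonState (q', m')) =
      if q = q' + a then
        Complex.exp (-Complex.I * (a * ν₀ * ν₀ * (q + q') / 2) * x) *
          ∑ l ∈ Finset.Iic m,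
            conj ((stateNorm m : ℂ) / (stateNorm l : ℂ) *
              expCoeff (shiftCoeff (a * ν₀) (conj x)) (m - l)) *
            (if l ≤ m' then (stateNorm m' : ℂ) / (stateNorm l : ℂ) *
              expCoeff (shiftCoeff (-(a * ν₀)) x) (m' - l) else 0)
      else 0 := by
  classical
  rw [vertexForm, braket_eq_sum (S := (Finset.Iic m).map ⟨fun l => (q, l),
    Prod.mk_right_injective q⟩), Finset.sum_map]
  · simp only [Function.Embedding.coeFn_mk, expCharge_apply, raise_zpow_apply,
      expAnnihilationPart_boson]
    by_cases hq : q = q' + a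
    · rw [if_pos hq, Finset.mul_sum]
      refine Finset.sum_congr rfl fun l hl => ?_
      have hq' : q - a = q' := by omega
      rw [if_pos ⟨trivial, Finset.mem_Iic.mp hl⟩, hq']
      have he : Complex.exp (-Complex.I * (a * ν₀ * ν₀ * (q + q') / 2) * x) =
          Complex.exp (-Complex.I * ((a * ν₀ : ℝ) : ℂ) * (ν₀ * q) * x / 2) *
            Complex.exp (-Complex.I * ((a * ν₀ : ℝ) : ℂ) * (ν₀ * q') * x / 2) := by
        rw [← Complex.exp_add]
        congr 1
        push_cast
        ring
      rw [he]
      simp only [true_and]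
      ring
    · rw [if_neg hq]
      refine Finset.sum_eq_zero fun l _ => ?_
      rw [if_neg (c := q - a = q' ∧ l ≤ m') fun h => hq (by omega)]
      simp
  · rintro ⟨q'', l⟩ hi
    rw [expAnnihilationPart_boson, if_neg]
    rintro ⟨rfl, hl⟩
    exact hi (Finset.mem_map.mpr ⟨l, Finset.mem_Iic.mpr hl, rfl⟩)

/-- The coefficients of `c exp (∑_{n>0} pₙ c₋ₙ / n) |Q⟩` in the boson states. -/
def coherentCoeff (c : ℂ) (p : ℕ+ → ℂ) (Q : ℤ) (i : FockIndex) : ℂ :=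
  if i.1 = Q then c * (powerMonomial p i.2 / (stateNorm i.2 : ℂ)) else 0

/-- Coherent states are eigenvectors of the exponential of annihilation operators. -/
theorem hasSum_annihilation_coherent {t p : ℕ+ → ℂ} (h : Summable fun n => ‖t n * p n‖)
    (l : ℕ+ →₀ ℕ) :
    HasSum (fun m' : ℕ+ →₀ ℕ => (if l ≤ m' then (stateNorm m' : ℂ) / (stateNorm l : ℂ) *
        expCoeff t (m' - l) else 0) * (powerMonomial p m' / (stateNorm m' : ℂ)))
      (Complex.exp (∑' n, t n * p n) * (powerMonomial p l / (stateNorm l : ℂ))) := by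
  have hinj : Function.Injective fun d : ℕ+ →₀ ℕ => l + d := add_right_injective l
  rw [← hinj.hasSum_iff]
  · refine ((hasSum_expCoeff h).mul_right _).congr_fun fun d => ?_
    simp only [Function.comp_apply]
    rw [if_pos le_self_add, add_tsub_cancel_left, powerMonomial_add,
      ← expCoeff_mul_powerMonomial t p d]
    have := stateNorm_ne_zero (l + d)
    have := stateNorm_ne_zero l
    field_simp
  · intro m' hm'
    rw [if_neg, zero_mul]
    intro hl
    obtain ⟨d, rfl⟩ := exists_add_of_le hl
    exact hm' ⟨d, rfl⟩

/-- The exponential of creation operators shifts the parameters of a coherent state. -/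
theorem sum_creation_coherent (t p : ℕ+ → ℂ) (m : ℕ+ →₀ ℕ) :
    ∑ l ∈ Finset.Iic m, conj ((stateNorm m : ℂ) / (stateNorm l : ℂ) * expCoeff t (m - l)) *
        (powerMonomial p l / (stateNorm l : ℂ)) =
      powerMonomial (fun n => p n + n * conj (t n)) m / (stateNorm m : ℂ) := by
  have h1 : ∀ l, conj ((stateNorm m : ℂ) / (stateNorm l : ℂ) * expCoeff t (m - l)) *
        (powerMonomial p l / (stateNorm l : ℂ)) = (stateNorm m : ℂ) *
        (expCoeff (fun n => p n / (n : ℂ)) l * expCoeff (fun n => conj (t n)) (m - l)) := by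
    intro l
    rw [expCoeff_div, map_mul, map_div₀, Complex.conj_ofReal, Complex.conj_ofReal, expCoeff_conj]
    have := stateNorm_ne_zero l
    field_simp
  have h2 : ((fun n => p n / (n : ℂ)) + fun n => conj (t n)) =
      fun n : ℕ+ => (p n + n * conj (t n)) / (n : ℂ) := by
    funext n
    have hn : ((n : ℕ) : ℂ) ≠ 0 := by exact_mod_cast n.ne_zero
    simp only [Pi.add_apply]
    field_simp
  simp only [h1]
  rw [← Finset.mul_sum, sum_expCoeff_mul, h2, expCoeff_div]
  have := stateNorm_ne_zero m
  field_simp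

/-- A vertex operator maps a coherent state to a coherent state. -/
theorem hasSum_vertexForm_coherent (ν₀ : ℝ) (a : ℤ) (x : ℂ) (c : ℂ) {p : ℕ+ → ℂ} (Q : ℤ)
    (h : Summable fun n => ‖shiftCoeff (-(a * ν₀)) x n * p n‖) (i : FockIndex) :
    HasSum (fun k => vertexForm ν₀ a x (bosonState i) (bosonState k) * coherentCoeff c p Q k)
      (coherentCoeff
        (c * Complex.exp (-Complex.I * (a * ν₀ * (ν₀ * Q + a * ν₀ / 2)) * x) *
          Complex.exp (∑' n, shiftCoeff (-(a * ν₀)) x n * p n))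
        (fun n => p n + n * conj (shiftCoeff (a * ν₀) (conj x) n)) (Q + a) i) := by
  obtain ⟨q, m⟩ := i
  -- Only intermediate states of charge `Q` contribute.
  have hinj : Function.Injective fun m' : ℕ+ →₀ ℕ => ((Q, m') : FockIndex) :=
    Prod.mk_right_injective Q
  rw [← hinj.hasSum_iff]
  · by_cases hq : q = Q + a
    · simp only [coherentCoeff, Function.comp_def, vertexForm_boson, if_pos hq, if_true]
      rw [← sum_creation_coherent]
      have hs := (hasSum_sum fun l (_ : l ∈ Finset.Iic m) =>
        (hasSum_annihilation_coherent h l).mul_left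
          (conj ((stateNorm m : ℂ) / (stateNorm l : ℂ) *
            expCoeff (shiftCoeff (a * ν₀) (conj x)) (m - l)))).mul_left
        (c * Complex.exp (-Complex.I * (a * ν₀ * ν₀ * (q + Q) / 2) * x))
      have he : Complex.exp (-Complex.I * (a * ν₀ * (ν₀ * Q + a * ν₀ / 2)) * x) =
          Complex.exp (-Complex.I * (a * ν₀ * ν₀ * (q + Q) / 2) * x) := by
        congr 1
        rw [hq]
        push_cast
        ring
      have hv : ∀ (A E F : ℂ) (f g : (ℕ+ →₀ ℕ) → ℂ), A * E * F * ∑ l ∈ Finset.Iic m, f l * g l =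
          A * E * ∑ l ∈ Finset.Iic m, f l * (F * g l) := fun A E F f g => by
        rw [Finset.mul_sum, Finset.mul_sum]
        exact Finset.sum_congr rfl fun l _ => by ring
      rw [he, hv]
      refine hs.congr_fun fun m' => ?_
      rw [Finset.mul_sum, Finset.sum_mul, Finset.mul_sum]
      refine Finset.sum_congr rfl fun l _ => ?_
      ring
    · simp only [coherentCoeff, Function.comp_def, vertexForm_boson, if_neg hq, zero_mul]
      exact hasSum_zero
  · rintro ⟨q', m'⟩ hk
    have hq' : q' ≠ Q := fun hq' => hk ⟨m', by rw [hq']⟩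
    rw [coherentCoeff, if_neg hq', mul_zero]

/-- The total charge `∑ aⱼ` of a list of vertex operators. -/
def totalCharge (L : List (ℤ × ℂ)) : ℤ := (L.map Prod.fst).sum

/-- The weighted power sum `∑ κⱼ e^{-inxⱼ}` of a list of vertex operators. -/
def vertexPowerSum (ν₀ : ℝ) (L : List (ℤ × ℂ)) (n : ℕ+) : ℂ :=
  (L.map fun p => (p.1 * ν₀ : ℂ) * Complex.exp (-Complex.I * (n : ℂ) * p.2)).sum

/-- The product of the pair factors `h p p'` over all pairs `p` before `p'` in a list. -/
def pairProd {α : Type*} (h : α → α → ℂ) : List α → ℂ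
  | [] => 1
  | p :: L => (L.map (h p)).prod * pairProd h L

/-- The factor `e^{-iκκ'(x-y)/2} (1 - e^{i(x-y)})^{κκ'}` from the contraction of `φ_κ(x)` with
`φ_κ'(y)`. -/
def contraction (ν₀ : ℝ) (p p' : ℤ × ℂ) : ℂ :=
  Complex.exp (-Complex.I * (p.1 * ν₀ * (p'.1 * ν₀)) * (p.2 - p'.2) / 2) *
    (1 - Complex.exp (Complex.I * (p.2 - p'.2))) ^ (p.1 * ν₀ * (p'.1 * ν₀) : ℂ)

/-- The vacuum amplitude of a product of vertex operators acting on `|Q⟩`. -/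
def vertexAmplitude (ν₀ : ℝ) (Q : ℤ) (L : List (ℤ × ℂ)) : ℂ :=
  Complex.exp (-Complex.I * (L.map fun p => (p.1 * ν₀ : ℂ) * p.2).sum *
    (ν₀ * Q + ν₀ * totalCharge L / 2)) * pairProd (contraction ν₀) L

theorem summable_norm_pnat_pow_div {z : ℂ} (hz : ‖z‖ < 1) :
    Summable fun n : ℕ+ => ‖z ^ (n : ℕ) / (n : ℂ)‖ := by
  refine Summable.of_nonneg_of_le (fun _ => norm_nonneg _) (fun n => ?_)
    ((summable_geometric_of_lt_one (norm_nonneg z) hz).comp_injective PNat.coe_injective)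
  rw [norm_div, norm_pow, Complex.norm_natCast]
  exact div_le_self (by positivity) (by exact_mod_cast n.pos)

theorem hasSum_pnat_pow_div {z : ℂ} (hz : ‖z‖ < 1) :
    HasSum (fun n : ℕ+ => z ^ (n : ℕ) / (n : ℂ)) (-Complex.log (1 - z)) := by
  have h := Complex.hasSum_taylorSeries_neg_log hz
  rw [← PNat.coe_injective.hasSum_iff] at h
  · exact h
  · intro n hn
    have : n = 0 := by
      by_contra h0
      exact hn ⟨⟨n, Nat.pos_of_ne_zero h0⟩, rfl⟩
    simp [this]

theorem norm_exp_I_mul_lt_one {u : ℂ} (h : 0 < u.im) : ‖Complex.exp (Complex.I * u)‖ < 1 := by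
  rw [Complex.norm_exp, Real.exp_lt_one_iff]
  simpa using h

theorem one_sub_exp_ne_zero {u : ℂ} (h : 0 < u.im) : 1 - Complex.exp (Complex.I * u) ≠ 0 := by
  intro h0
  have := norm_exp_I_mul_lt_one h
  rw [← sub_eq_zero.mp h0] at this
  simp at this

theorem shiftCoeff_mul_exp (κ κ' : ℝ) (x y : ℂ) (n : ℕ+) :
    shiftCoeff (-κ) x n * (κ' * Complex.exp (-Complex.I * (n : ℂ) * y)) =
      -(κ * κ' : ℂ) * (Complex.exp (Complex.I * (x - y)) ^ (n : ℕ) / (n : ℂ)) := by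
  rw [shiftCoeff, ← Complex.exp_nat_mul]
  have : Complex.exp ((n : ℕ) * (Complex.I * (x - y))) =
      Complex.exp (Complex.I * (n : ℂ) * x) * Complex.exp (-Complex.I * (n : ℂ) * y) := by
    rw [← Complex.exp_add]
    congr 1
    ring
  rw [this]
  push_cast
  ring

/-- The annihilation part of `φ_κ(x)` on the coherent state of a product of vertex operators: the
exponents are logarithmic series in `e^{i(x-y)}`, which converge for `Im y < Im x`. -/
theorem summable_shiftCoeff_mul_vertexPowerSum (ν₀ : ℝ) (a : ℤ) (x : ℂ) (L : List (ℤ × ℂ))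
    (hL : ∀ p ∈ L, p.2.im < x.im) :
    (Summable fun n => ‖shiftCoeff (-(a * ν₀)) x n * vertexPowerSum ν₀ L n‖) ∧
    Complex.exp (∑' n, shiftCoeff (-(a * ν₀)) x n * vertexPowerSum ν₀ L n) =
      (L.map fun p => (1 - Complex.exp (Complex.I * (x - p.2))) ^
        (a * ν₀ * (p.1 * ν₀) : ℂ)).prod := by
  induction L with
  | nil => simp [vertexPowerSum, summable_zero]
  | cons p L ih =>
    obtain ⟨ih1, ih2⟩ := ih fun p' hp' => hL p' (by simp [hp'])
    have him : 0 < (x - p.2).im := by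
      have := hL p (by simp)
      simpa using this
    have hz := norm_exp_I_mul_lt_one him
    have hterm : ∀ n, shiftCoeff (-(a * ν₀)) x n * vertexPowerSum ν₀ (p :: L) n =
        -(a * ν₀ * (p.1 * ν₀) : ℂ) * (Complex.exp (Complex.I * (x - p.2)) ^ (n : ℕ) / (n : ℂ)) +
          shiftCoeff (-(a * ν₀)) x n * vertexPowerSum ν₀ L n := by
      intro n
      have := shiftCoeff_mul_exp (a * ν₀) (p.1 * ν₀) x p.2 n
      push_cast at this
      rw [← this, vertexPowerSum, vertexPowerSum, List.map_cons, List.sum_cons, mul_add]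
    have h1 := (summable_norm_pnat_pow_div hz).mul_left ‖-(a * ν₀ * (p.1 * ν₀) : ℂ)‖
    simp only [← norm_mul] at h1
    simp only [hterm]
    refine ⟨(h1.add ih1).of_nonneg_of_le (fun _ => norm_nonneg _) fun n => norm_add_le _ _, ?_⟩
    rw [h1.of_norm.tsum_add ih1.of_norm, Complex.exp_add, ih2, List.map_cons, List.prod_cons,
      tsum_mul_left, (hasSum_pnat_pow_div hz).tsum_eq,
      Complex.cpow_def_of_ne_zero (one_sub_exp_ne_zero him)]
    congr 2
    ring

/-- The amplitude of a product of vertex operators is built up one factor at a time. -/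
theorem vertexAmplitude_cons (ν₀ : ℝ) (Q : ℤ) (p : ℤ × ℂ) (L : List (ℤ × ℂ)) :
    vertexAmplitude ν₀ Q (p :: L) = vertexAmplitude ν₀ Q L *
      Complex.exp (-Complex.I * (p.1 * ν₀ * (ν₀ * (Q + totalCharge L : ℤ) + p.1 * ν₀ / 2)) * p.2) *
      (L.map fun p' => (1 - Complex.exp (Complex.I * (p.2 - p'.2))) ^
        (p.1 * ν₀ * (p'.1 * ν₀) : ℂ)).prod := by
  have h1 : (L.map (contraction ν₀ p)).prod =
      Complex.exp (-Complex.I * (p.1 * ν₀) / 2 * (p.2 * (ν₀ * totalCharge L) -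
        (L.map fun p => (p.1 * ν₀ : ℂ) * p.2).sum)) *
      (L.map fun p' => (1 - Complex.exp (Complex.I * (p.2 - p'.2))) ^
        (p.1 * ν₀ * (p'.1 * ν₀) : ℂ)).prod := by
    induction L with
    | nil => simp [totalCharge]
    | cons p' L ih =>
      rw [List.map_cons, List.prod_cons, ih, contraction]
      have : Complex.exp (-Complex.I * (p.1 * ν₀) / 2 * (p.2 * (ν₀ * totalCharge (p' :: L)) -
          ((p' :: L).map fun p => (p.1 * ν₀ : ℂ) * p.2).sum)) =
          Complex.exp (-Complex.I * (p.1 * ν₀ * (p'.1 * ν₀)) * (p.2 - p'.2) / 2) *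
          Complex.exp (-Complex.I * (p.1 * ν₀) / 2 * (p.2 * (ν₀ * totalCharge L) -
            (L.map fun p => (p.1 * ν₀ : ℂ) * p.2).sum)) := by
        rw [← Complex.exp_add]
        congr 1
        simp only [totalCharge, List.map_cons, List.sum_cons]
        push_cast
        ring
      rw [this, List.map_cons, List.prod_cons]
      ring
  rw [vertexAmplitude, pairProd, h1, vertexAmplitude]
  have : Complex.exp (-Complex.I * ((p :: L).map fun p => (p.1 * ν₀ : ℂ) * p.2).sum *
        (ν₀ * Q + ν₀ * totalCharge (p :: L) / 2)) *
      Complex.exp (-Complex.I * (p.1 * ν₀) / 2 * (p.2 * (ν₀ * totalCharge L) -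
        (L.map fun p => (p.1 * ν₀ : ℂ) * p.2).sum)) =
      Complex.exp (-Complex.I * (L.map fun p => (p.1 * ν₀ : ℂ) * p.2).sum *
        (ν₀ * Q + ν₀ * totalCharge L / 2)) *
      Complex.exp (-Complex.I * (p.1 * ν₀ * (ν₀ * (Q + totalCharge L : ℤ) + p.1 * ν₀ / 2)) *
        p.2) := by
    rw [← Complex.exp_add, ← Complex.exp_add]
    congr 1
    simp only [totalCharge, List.map_cons, List.sum_cons]
    push_cast
    ring
  linear_combination ((L.map fun p' => (1 - Complex.exp (Complex.I * (p.2 - p'.2))) ^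
        (p.1 * ν₀ * (p'.1 * ν₀) : ℂ)).prod * pairProd (contraction ν₀) L) * this

/-- A product of vertex operators with decreasing imaginary parts maps the charged vacuum to a
coherent state. -/
theorem productElem_chargedVacuum (ν₀ : ℝ) (Q : ℤ) (L : List (ℤ × ℂ))
    (hL : L.Pairwise fun p p' => p'.2.im < p.2.im) :
    ProductConverges ν₀ L (Q, 0) ∧ ∀ i, productElem ν₀ L i (Q, 0) =
      coherentCoeff (vertexAmplitude ν₀ Q L) (vertexPowerSum ν₀ L) (Q + totalCharge L) i := by
  induction L with
  | nil =>
    refine ⟨trivial, fun ⟨q, m⟩ => ?_⟩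
    rw [productElem, coherentCoeff]
    simp only [Prod.mk.injEq, totalCharge, List.map_nil, List.sum_nil, add_zero]
    by_cases hq : q = Q
    · by_cases hm : m = 0
      · simp [hq, hm, vertexAmplitude, pairProd, powerMonomial, stateNorm]
      · obtain ⟨n, hn⟩ := Finsupp.support_nonempty_iff.mpr hm
        have h0 : powerMonomial (vertexPowerSum ν₀ []) m = 0 := by
          refine Finset.prod_eq_zero hn ?_
          simp only [vertexPowerSum, List.map_nil, List.sum_nil]
          exact zero_pow (by simpa using hn)
        simp [hm, h0]
    · simp [hq]
  | cons p L ih =>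
    rw [List.pairwise_cons] at hL
    obtain ⟨ih1, ih2⟩ := ih hL.2
    obtain ⟨hs, he⟩ := summable_shiftCoeff_mul_vertexPowerSum ν₀ p.1 p.2 L hL.1
    have hsum := hasSum_vertexForm_coherent ν₀ p.1 p.2 (vertexAmplitude ν₀ Q L)
      (Q + totalCharge L) hs
    simp only [← ih2, he] at hsum
    refine ⟨⟨ih1, fun i => (hsum i).summable⟩, fun i => ?_⟩
    rw [productElem, (hsum i).tsum_eq, vertexAmplitude_cons]
    have h1 : Q + totalCharge L + p.1 = Q + totalCharge (p :: L) := by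
      simp only [totalCharge, List.map_cons, List.sum_cons]
      ring
    have h2 : (fun n => vertexPowerSum ν₀ L n +
        n * conj (shiftCoeff (p.1 * ν₀) (conj p.2) n)) = vertexPowerSum ν₀ (p :: L) := by
      funext n
      have hn : ((n : ℕ) : ℂ) ≠ 0 := by exact_mod_cast n.ne_zero
      rw [shiftCoeff, map_mul, map_div₀, ← Complex.exp_conj, map_mul, map_mul, Complex.conj_conj,
        Complex.conj_I, Complex.conj_natCast, Complex.conj_ofReal, vertexPowerSum, vertexPowerSum,
        List.map_cons, List.sum_cons]
      push_cast
      rw [add_comm]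
      congr 1
      field_simp
    rw [h1, h2]

/-! ### The correlation function in closed form -/

/-- The deformed power sum `∑_I κ_I X_I^n`. -/
def powerSumPoly {ι : Type*} [Fintype ι] (κ : ι → ℂ) (n : ℕ+) : MvPolynomial ι ℂ :=
  ∑ a, MvPolynomial.C (κ a) * MvPolynomial.X a ^ (n : ℕ)

/-- The linear map from boson states to polynomials that turns `∏ₙ c₋ₙ^{mₙ} |Q⟩` into the product
`∏ₙ pₙ^{mₙ}` of deformed power sums, for every charge `Q`. -/
def bosonPoly {ι : Type*} [Fintype ι] (κ : ι → ℂ) : Db →ₗ[ℂ] MvPolynomial ι ℂ :=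
  Finsupp.linearCombination ℂ fun i =>
    ((stateNorm i.2 : ℂ)⁻¹) • powerMonomial (powerSumPoly κ) i.2

theorem bosonPoly_boson {ι : Type*} [Fintype ι] (κ : ι → ℂ) (i : FockIndex) :
    bosonPoly κ (bosonState i) =
      ((stateNorm i.2 : ℂ)⁻¹) • powerMonomial (powerSumPoly κ) i.2 := by
  simp [bosonPoly, bosonState]

/-- The statistics parameters: `ν` for the `x` variables, `-1/ν` for the `y` variables. -/
def anyonCharge (ν : ℝ) (N M : ℕ) : Fin N ⊕ Fin M → ℂ :=
  Sum.elim (fun _ => (ν : ℂ)) fun _ => -(ν : ℂ)⁻¹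

theorem pairProd_append {α : Type*} (h : α → α → ℂ) (L₁ L₂ : List α) :
    pairProd h (L₁ ++ L₂) =
      pairProd h L₁ * pairProd h L₂ * (L₁.map fun p => (L₂.map (h p)).prod).prod := by
  induction L₁ with
  | nil => simp [pairProd]
  | cons p L ih =>
    simp only [List.cons_append, pairProd, ih, List.map_append, List.prod_append, List.map_cons,
      List.prod_cons]
    ring

theorem pairProd_ofFn {α : Type*} (h : α → α → ℂ) {n : ℕ} (f : Fin n → α) :
    pairProd h (List.ofFn f) = ∏ j, ∏ j' ∈ Finset.Ioi j, h (f j) (f j') := by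
  induction n with
  | zero => simp [pairProd]
  | succ n ih =>
    rw [List.ofFn_succ, pairProd, ih, Fin.prod_univ_succ, Fin.Ioi_zero_eq_map, Finset.prod_map,
      List.map_ofFn, List.prod_ofFn]
    congr 1
    refine Finset.prod_congr rfl fun j _ => ?_
    rw [Fin.Ioi_succ, Finset.prod_map]
    rfl

/-- The adjoint of a contraction is a factor of the groundstate. Complex conjugation commutes with
the principal power because `1 - e^{i(x̄-ȳ)}` lies in the right half plane. -/
theorem conj_contraction (ν₀ : ℝ) (a b : ℤ) {x y : ℂ} (h : (x - y).im < 0) :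
    conj (contraction ν₀ (a, conj x) (b, conj y)) = sinePower (a * ν₀ * (b * ν₀)) (x - y) := by
  have h1 : 0 < (conj x - conj y).im := by simpa using h
  have harg : (1 - Complex.exp (Complex.I * (conj x - conj y))).arg ≠ Real.pi := by
    have h2 : 0 < (1 - Complex.exp (Complex.I * (conj x - conj y))).re := by
      have := (Complex.re_le_norm _).trans_lt (norm_exp_I_mul_lt_one h1)
      simp only [Complex.sub_re, Complex.one_re]
      linarith
    exact (Complex.mem_slitPlane_iff_arg.mp (Or.inl h2)).1
  have hpow := Complex.conj_cpow _ ((a * ν₀ * (b * ν₀) : ℝ) : ℂ) harg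
  rw [Complex.conj_ofReal] at hpow
  push_cast at hpow
  rw [contraction, sinePower, map_mul, ← Complex.exp_conj, ← hpow, map_sub, ← Complex.exp_conj]
  simp only [map_mul, map_sub, map_neg, map_div₀, Complex.conj_conj, Complex.conj_I,
    Complex.conj_ofReal, map_intCast, map_one, map_ofNat, neg_neg]
  push_cast
  rfl

theorem sinePower_neg_one (u : ℂ) :
    sinePower (-1) u = (Complex.exp (Complex.I * u / 2) - Complex.exp (-(Complex.I * u / 2)))⁻¹ := by
  rw [sinePower]
  push_cast
  have h : Complex.exp (Complex.I * u / 2) - Complex.exp (-(Complex.I * u / 2)) =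
      Complex.exp (Complex.I * u / 2) * (1 - Complex.exp (-Complex.I * u)) := by
    rw [mul_sub, mul_one, ← Complex.exp_add]
    congr 2
    ring
  rw [Complex.cpow_neg_one, h, mul_inv, ← Complex.exp_neg]
  congr 2
  ring

theorem evalExp_powerMonomial {N M : ℕ} (κ : Fin N ⊕ Fin M → ℂ) (m : ℕ+ →₀ ℕ)
    (x : Fin N → ℂ) (y : Fin M → ℂ) :
    evalExp (powerMonomial (powerSumPoly κ) m) x y =
      powerMonomial (fun n => ∑ j, κ (Sum.inl j) * Complex.exp (Complex.I * x j) ^ (n : ℕ) +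
        ∑ k, κ (Sum.inr k) * Complex.exp (Complex.I * y k) ^ (n : ℕ)) m := by
  simp [evalExp, powerMonomial, Finsupp.prod, map_prod, powerSumPoly, map_sum]

theorem anyonFactors_pairwise (r s : ℕ) {N M : ℕ} {x : Fin N → ℂ} {y : Fin M → ℂ}
    (h : (x, y) ∈ orderedRegion N M) :
    (anyonFactors r s x y).Pairwise fun p p' => p'.2.im < p.2.im := by
  obtain ⟨-, -, h1, h2, h3⟩ := h
  rw [anyonFactors, List.pairwise_append, List.pairwise_ofFn, List.pairwise_ofFn]
  refine ⟨fun j j' hj => h1 j j' hj, fun k k' hk => h2 k k' hk, ?_⟩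
  intro p hp p' hp'
  obtain ⟨j, rfl⟩ := List.mem_ofFn.mp hp
  obtain ⟨k, rfl⟩ := List.mem_ofFn.mp hp'
  exact h3 j k

/-- The product `Φ_ν^{N,M}` raises the charge by `r N - s M`. -/
theorem totalCharge_anyonFactors (r s : ℕ) {N M : ℕ} (x : Fin N → ℂ) (y : Fin M → ℂ) :
    totalCharge (anyonFactors r s x y) = r * N - s * M := by
  simp [totalCharge, anyonFactors, List.map_ofFn, Function.comp_def]
  ring

/-- The right hand side of the closed formula for the correlation function:
`e^{iq₀(∑xⱼ - ∑yₖ/g)} Ψ₀ P(z,w)`. -/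
def correlationFormula (ν : ℝ) (q₀ : ℝ) {N M : ℕ} (P : MvPolynomial (Fin N ⊕ Fin M) ℂ)
    (x : Fin N → ℂ) (y : Fin M → ℂ) : ℂ :=
  Complex.exp (Complex.I * (q₀ : ℂ) * ((∑ j, x j) - (∑ k, y k) / ((ν ^ 2 : ℝ) : ℂ))) *
    groundState (ν ^ 2) x y * evalExp P x y

/-- The adjoint of the amplitude is the plane wave times the groundstate. -/
theorem conj_vertexAmplitude {ν₀ ν : ℝ} {r s : ℕ} (hν0 : ν ≠ 0) (hν : ν = r * ν₀)
    (hνinv : 1 / ν = s * ν₀) (Q : ℤ) {N M : ℕ} {x : Fin N → ℂ} {y : Fin M → ℂ}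
    (h : (x, y) ∈ adjointRegion N M) :
    conj (vertexAmplitude ν₀ Q (anyonFactors r s (conjConfig x) (conjConfig y))) =
      Complex.exp (Complex.I * ((1 / 2 * (N * ν ^ 2 - M) + ν₀ * ν * Q : ℝ) : ℂ) *
        ((∑ j, x j) - (∑ k, y k) / ((ν ^ 2 : ℝ) : ℂ))) * groundState (ν ^ 2) x y := by
  obtain ⟨-, -, h1, h2, h3⟩ := h
  have hr : (r * ν₀ : ℂ) = ν := by rw [hν]; push_cast; rfl
  have hs : (s * ν₀ : ℂ) = (ν : ℂ)⁻¹ := by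
    rw [← one_div]; exact_mod_cast hνinv.symm
  have hc : (ν : ℂ) ≠ 0 := by exact_mod_cast hν0
  rw [vertexAmplitude, map_mul, mul_comm (Complex.exp (Complex.I * _ * _))]
  rw [mul_comm]
  congr 1
  · rw [groundState, anyonFactors, pairProd_append, pairProd_ofFn, pairProd_ofFn,
      div_eq_mul_inv, ← Finset.prod_inv_distrib]
    simp only [map_mul, map_prod, List.map_ofFn, List.prod_ofFn, Function.comp_def]
    congr 1
    · congr 1
      · refine Finset.prod_congr rfl fun j _ => Finset.prod_congr rfl fun j' hj => ?_
        have := h1 j j' (Finset.mem_Ioi.mp hj)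
        simp only [conjConfig, Complex.conj_im] at this
        have hc := conj_contraction ν₀ r r (x := x j) (y := x j') (by simp; linarith)
        rw [show (((r : ℤ) : ℝ) * ν₀ * (((r : ℤ) : ℝ) * ν₀)) = ν ^ 2 by rw [hν]; push_cast; ring]
          at hc
        exact hc
      · refine Finset.prod_congr rfl fun k _ => Finset.prod_congr rfl fun k' hk => ?_
        have := h2 k k' (Finset.mem_Ioi.mp hk)
        simp only [conjConfig, Complex.conj_im] at this
        have hc := conj_contraction ν₀ (-s) (-s) (x := y k) (y := y k') (by simp; linarith)
        rw [show (((-s : ℤ) : ℝ) * ν₀ * (((-s : ℤ) : ℝ) * ν₀)) = 1 / ν ^ 2 by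
          rw [← one_div_pow, hνinv]; push_cast; ring] at hc
        exact hc
    · refine Finset.prod_congr rfl fun j _ => ?_
      rw [← Finset.prod_inv_distrib]
      refine Finset.prod_congr rfl fun k _ => ?_
      have := h3 j k
      simp only [conjConfig, Complex.conj_im] at this
      have hc := conj_contraction ν₀ r (-s) (x := x j) (y := y k) (by simp; linarith)
      rw [show (((r : ℤ) : ℝ) * ν₀ * (((-s : ℤ) : ℝ) * ν₀)) = -1 by
        push_cast
        rw [neg_mul, ← hνinv, ← hν]
        field_simp, sinePower_neg_one] at hc
      refine hc.trans ?_
      congr 3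
      ring
  · rw [← Complex.exp_conj]
    congr 1
    rw [totalCharge_anyonFactors, anyonFactors]
    simp only [List.map_append, List.sum_append, List.map_ofFn, List.sum_ofFn, Function.comp_def,
      ← Finset.mul_sum, conjConfig]
    push_cast
    simp only [map_mul, map_add, map_sub, map_neg, map_div₀, Complex.conj_I, Complex.conj_ofReal,
      map_intCast, map_natCast, map_sum, Complex.conj_conj, map_ofNat, neg_neg, neg_mul]
    have e1 : ∀ a : ℂ, (ν₀ : ℂ) * Q + ν₀ * (r * N - s * M) / 2 =
      ν₀ * Q + ((r * ν₀) * N - (s * ν₀) * M) / 2 := fun _ => by ring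
    rw [e1 0, hr, hs]
    field_simp
    ring

/-- The correlation function in closed form, for an `η` whose charge is that of `Φ |Q⟩`. -/
theorem anyonCorrelation_eq {ν₀ ν : ℝ} {r s : ℕ} (hν0 : ν ≠ 0) (hν : ν = r * ν₀)
    (hνinv : 1 / ν = s * ν₀) (Q : ℤ) {N M : ℕ} {η : Db}
    (hη : ∀ i ∈ η.support, i.1 = Q + (r * N - s * M)) {x : Fin N → ℂ} {y : Fin M → ℂ}
    (h : (x, y) ∈ adjointRegion N M) :
    anyonCorrelation ν₀ r s Q η x y =
      correlationFormula ν (1 / 2 * (N * ν ^ 2 - M) + ν₀ * ν * Q)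
        (bosonPoly (anyonCharge ν N M) η) x y := by
  have hr : (r * ν₀ : ℂ) = ν := by rw [hν]; push_cast; rfl
  have hs : (s * ν₀ : ℂ) = (ν : ℂ)⁻¹ := by
    rw [← one_div]; exact_mod_cast hνinv.symm
  have hev : evalExp (bosonPoly (anyonCharge ν N M) η) x y = η.sum fun i b =>
      b * ((stateNorm i.2 : ℂ)⁻¹ *
        evalExp (powerMonomial (powerSumPoly (anyonCharge ν N M)) i.2) x y) := by
    rw [bosonPoly, Finsupp.linearCombination_apply, Finsupp.sum, evalExp, map_sum, Finsupp.sum]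
    simp [MvPolynomial.smul_eval, evalExp]
  rw [correlationFormula, ← conj_vertexAmplitude hν0 hν hνinv Q h, hev, anyonCorrelation, formValue,
    chargedVacuum, bosonState, Finsupp.sum_single_index (by simp), Finsupp.sum, Finsupp.sum,
    Finset.mul_sum]
  refine Finset.sum_congr rfl fun i hi => ?_
  rw [anyonProductAdjoint, anyonProduct,
    (productElem_chargedVacuum ν₀ Q _ (anyonFactors_pairwise r s h)).2, coherentCoeff,
    totalCharge_anyonFactors, if_pos (hη i hi), evalExp_powerMonomial, map_mul, map_div₀,
    Complex.conj_ofReal, powerMonomial_conj, map_one]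
  have hp : (fun n => conj (vertexPowerSum ν₀ (anyonFactors r s (conjConfig x) (conjConfig y)) n)) =
      fun n : ℕ+ => ∑ j, anyonCharge ν N M (Sum.inl j) * Complex.exp (Complex.I * x j) ^ (n : ℕ) +
        ∑ k, anyonCharge ν N M (Sum.inr k) * Complex.exp (Complex.I * y k) ^ (n : ℕ) := by
    funext n
    simp only [vertexPowerSum, anyonFactors, List.map_append, List.sum_append, List.map_ofFn,
      List.sum_ofFn, Function.comp_def, conjConfig, anyonCharge, Sum.elim_inl, Sum.elim_inr,
      map_add, map_sum, map_mul, ← Complex.exp_conj, Complex.conj_conj, map_neg,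
      Complex.conj_I, map_natCast, map_intCast, Complex.conj_ofReal, neg_neg, ← Complex.exp_nat_mul]
    push_cast
    congr 1
    · refine Finset.sum_congr rfl fun j _ => ?_
      rw [← hr]
      ring_nf
    · refine Finset.sum_congr rfl fun k _ => ?_
      rw [← hs]
      ring_nf
  rw [hp]
  ring

/-! ### Boson operators as differential operators -/

theorem sqrt_mul_stateNorm {m : ℕ+ →₀ ℕ} {n : ℕ+} (hn : m n ≠ 0) :
    Real.sqrt ((n : ℝ) * m n) * stateNorm (m - Finsupp.single n 1) = stateNorm m := by
  obtain ⟨e, rfl⟩ : ∃ e, m = e + Finsupp.single n 1 :=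
    ⟨m - Finsupp.single n 1, (tsub_add_cancel_of_le (by
      rw [Finsupp.single_le_iff]; omega)).symm⟩
  rw [add_tsub_cancel_right, stateNorm_add_single]
  simp

section BosonPoly

variable {ι : Type*} [Fintype ι] (κ : ι → ℂ)

/-- Annihilation operators act on polynomials in the power sums as `n ∂/∂pₙ`. -/
theorem bosonPoly_annihilate_boson (n : ℕ+) (q : ℤ) (m : ℕ+ →₀ ℕ) :
    bosonPoly κ (annihilate n (bosonState (q, m))) =
      ((stateNorm m : ℂ)⁻¹ * ((n : ℂ) * (m n : ℂ))) •
        powerMonomial (powerSumPoly κ) (m - Finsupp.single n 1) := by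
  rw [annihilate_boson, map_smul, bosonPoly_boson, smul_smul]
  by_cases hn : m n = 0
  · simp [hn]
  · congr 1
    have h1 := sqrt_mul_stateNorm hn
    have h2 : Real.sqrt ((n : ℝ) * m n) * Real.sqrt ((n : ℝ) * m n) = (n : ℝ) * m n :=
      Real.mul_self_sqrt (by positivity)
    have h3 := stateNorm_ne_zero (m - Finsupp.single n 1)
    have h4 : ((Real.sqrt ((n : ℝ) * m n) : ℝ) : ℂ) ≠ 0 := by
      have : (0 : ℝ) < (n : ℝ) * m n :=
        mul_pos (by exact_mod_cast n.pos) (by exact_mod_cast Nat.pos_of_ne_zero hn)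
      exact_mod_cast (Real.sqrt_pos.mpr this).ne'
    have h5 : (((n : ℕ) : ℂ) * (m n : ℂ)) =
        ((Real.sqrt ((n : ℝ) * m n) * Real.sqrt ((n : ℝ) * m n) : ℝ) : ℂ) := by
      rw [h2]; push_cast; rfl
    rw [h5, ← h1]
    push_cast
    field_simp

/-- Creation operators act on polynomials as multiplication by deformed power sums. -/
theorem bosonPoly_create (n : ℕ+) (v : Db) :
    bosonPoly κ (create n v) = powerSumPoly κ n * bosonPoly κ v := by
  induction v using Finsupp.induction_linear with
  | zero => simp
  | add u w hu hw => rw [map_add, map_add, hu, hw, map_add, mul_add]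
  | single i b =>
    have h : (Finsupp.single i b : Db) = b • bosonState i := by simp [bosonState]
    have h1 : Real.sqrt ((n : ℝ) * ((i.2 n : ℝ) + 1)) ≠ 0 :=
      (Real.sqrt_pos.mpr (by have := n.pos; positivity)).ne'
    have h1' : ((Real.sqrt ((n : ℝ) * ((i.2 n : ℝ) + 1)) : ℝ) : ℂ) ≠ 0 := by exact_mod_cast h1
    rw [h, map_smul, map_smul, map_smul, mul_smul_comm]
    congr 1
    rw [create, onBasis_boson, map_smul, bosonPoly_boson, bosonPoly_boson, powerMonomial_add,
      stateNorm_add_single, smul_smul, mul_smul_comm, Complex.ofReal_mul, mul_inv,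
      mul_inv_cancel_left₀ h1', mul_comm (powerSumPoly κ n)]
    simp [powerMonomial]

/-- The chain rule for a monomial in the power sums. -/
theorem derivation_powerMonomial {A : Type*} [CommRing A] [Algebra ℂ A] (D : Derivation ℂ A A)
    (p : ℕ+ → A) (m : ℕ+ →₀ ℕ) {S : Finset ℕ+} (hS : m.support ⊆ S) :
    D (powerMonomial p m) =
      ∑ n ∈ S, (m n : A) * powerMonomial p (m - Finsupp.single n 1) * D (p n) := by
  have key : ∀ S' ⊆ S, D (∏ n ∈ S', p n ^ m n) =
      ∑ n ∈ S', (m n : A) * (p n ^ (m n - 1) * ∏ n' ∈ S'.erase n, p n' ^ m n') * D (p n) := by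
    intro S' _
    induction S' using Finset.induction_on with
    | empty => simp
    | insert a S' ha ih =>
      rw [Finset.prod_insert ha, D.leibniz, ih ((Finset.subset_insert _ _).trans ‹_›),
        Finset.sum_insert ha, Finset.erase_insert ha, D.leibniz_pow, smul_eq_mul, smul_eq_mul,
        add_comm, Finset.mul_sum]
      congr 1
      · simp only [smul_eq_mul, nsmul_eq_mul]
        ring
      · refine Finset.sum_congr rfl fun n hn => ?_
        have hne : n ≠ a := fun h => ha (h ▸ hn)
        rw [Finset.erase_insert_of_ne hne.symm, Finset.prod_insert fun h => ha
          (Finset.mem_of_mem_erase h)]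
        ring
  rw [powerMonomial, Finsupp.prod_of_support_subset _ hS _ (by simp), key S subset_rfl]
  refine Finset.sum_congr rfl fun n hn => ?_
  congr 2
  rw [powerMonomial, Finsupp.prod_of_support_subset (s := S) _ ?_ _ (by simp),
    ← Finset.mul_prod_erase _ _ hn]
  · congr 1
    · simp
    · refine Finset.prod_congr rfl fun n' hn' => ?_
      simp [Finsupp.single_eq_of_ne (Finset.ne_of_mem_erase hn')]
  · exact (Finsupp.support_mono tsub_le_self).trans hS

/-- The boson modes `1, …, B`. -/
def modesUpTo (B : ℕ) : Finset ℕ+ := Finset.Iio B.succPNat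

theorem mem_modesUpTo {B : ℕ} {n : ℕ+} : n ∈ modesUpTo B ↔ (n : ℕ) ≤ B := by
  rw [modesUpTo, Finset.mem_Iio, ← PNat.coe_lt_coe, Nat.succPNat_coe, Nat.lt_succ_iff]

theorem support_subset_modesUpTo {B : ℕ} {m : ℕ+ →₀ ℕ} (h : ∀ n ∈ m.support, (n : ℕ) ≤ B) :
    m.support ⊆ modesUpTo B := fun n hn => mem_modesUpTo.mpr (h n hn)

/-- The Euler derivation `X_a ∂/∂X_a`. -/
def eulerDerivation {ι : Type*} (a : ι) : Derivation ℂ (MvPolynomial ι ℂ) (MvPolynomial ι ℂ) :=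
  (MvPolynomial.X a : MvPolynomial ι ℂ) • MvPolynomial.pderiv a

theorem eulerDerivation_X_pow {ι : Type*} [DecidableEq ι] (a b : ι) (n : ℕ) :
    eulerDerivation a (MvPolynomial.X b ^ n : MvPolynomial ι ℂ) =
      if a = b then (n : MvPolynomial ι ℂ) * MvPolynomial.X b ^ n else 0 := by
  rw [eulerDerivation, Derivation.smul_apply, Derivation.leibniz_pow, MvPolynomial.pderiv_X]
  by_cases h : a = b
  · subst h
    rcases n with _ | n
    · simp
    · simp
      ring
  · simp [h, Ne.symm h]

theorem eulerDerivation_powerSumPoly (a : ι) (n : ℕ+) :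
    eulerDerivation a (powerSumPoly κ n) =
      MvPolynomial.C (κ a) * (((n : ℕ) : MvPolynomial ι ℂ) * MvPolynomial.X a ^ (n : ℕ)) := by
  classical
  simp only [powerSumPoly, map_sum, ← MvPolynomial.smul_eq_C_mul, Derivation.map_smul,
    eulerDerivation_X_pow, smul_ite, smul_zero, Finset.sum_ite_eq, Finset.mem_univ, if_true]

/-- The chain rule `X_a ∂/∂X_a = ∑ₙ κ_a X_a^n (n ∂/∂pₙ)`, with `n ∂/∂pₙ` written as `cₙ`. -/
theorem eulerDerivation_bosonPoly (a : ι) {B : ℕ} {v : Db} (hv : v ∈ boundedStates B) :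
    eulerDerivation a (bosonPoly κ v) = ∑ n ∈ modesUpTo B,
      MvPolynomial.C (κ a) * MvPolynomial.X a ^ (n : ℕ) * bosonPoly κ (annihilate n v) := by
  induction hv using Submodule.span_induction with
  | zero => simp
  | add u w _ _ hu hw => simp only [map_add, hu, hw, mul_add, Finset.sum_add_distrib]
  | smul c u _ hu =>
    simp only [map_smul, Derivation.map_smul, hu, Finset.smul_sum, mul_smul_comm]
  | mem u hu =>
    obtain ⟨⟨q, m⟩, hi, rfl⟩ := hu
    rw [bosonPoly_boson, Derivation.map_smul,
      derivation_powerMonomial _ _ _ (support_subset_modesUpTo hi), Finset.smul_sum]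
    refine Finset.sum_congr rfl fun n _ => ?_
    rw [bosonPoly_annihilate_boson, eulerDerivation_powerSumPoly, MvPolynomial.smul_eq_C_mul,
      MvPolynomial.smul_eq_C_mul]
    simp only [map_mul, map_natCast]
    ring

theorem sumOp_bounded {τ : Type} (T : τ → Module.End ℂ Db) {B : ℕ} {S : Finset τ}
    (hS : ∀ k ∉ S, ∀ v ∈ boundedStates B, T k v = 0) {v : Db} (hv : v ∈ boundedStates B) :
    sumOp T v = ∑ k ∈ S, T k v := by
  induction hv using Submodule.span_induction with
  | zero => simp
  | add u w _ _ hu hw => simp only [map_add, hu, hw, Finset.sum_add_distrib]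
  | smul c u _ hu => simp only [map_smul, hu, Finset.smul_sum]
  | mem u hu =>
    obtain ⟨i, hi, rfl⟩ := hu
    exact sumOp_boson T i fun k hk => hS k hk _ (Submodule.subset_span ⟨i, hi, rfl⟩)

theorem annihilate_eq_zero {B : ℕ} {n : ℕ+} (hn : n ∉ modesUpTo B) {v : Db}
    (hv : v ∈ boundedStates B) : annihilate n v = 0 :=
  (annihilate_bounded B n v hv).2 (by simpa [mem_modesUpTo] using hn)

/-- The six sign patterns of the terms of the cubic interaction, two positive or two negative
indices. -/
def cubicIndex (σ : Fin 6) (n m : ℕ+) : ℤ × ℤ × ℤ :=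
  match σ with
  | 0 => (n, m, -((n + m : ℕ+) : ℤ))
  | 1 => (n, -((n + m : ℕ+) : ℤ), m)
  | 2 => (-((n + m : ℕ+) : ℤ), n, m)
  | 3 => (-(n : ℤ), -(m : ℤ), ((n + m : ℕ+) : ℤ))
  | 4 => (-(n : ℤ), ((n + m : ℕ+) : ℤ), -(m : ℤ))
  | 5 => (((n + m : ℕ+) : ℤ), -(n : ℤ), -(m : ℤ))

theorem cubicIndex_injective :
    Function.Injective fun p : Fin 6 × ℕ+ × ℕ+ => cubicIndex p.1 p.2.1 p.2.2 := by
  rintro ⟨σ, n, m⟩ ⟨σ', n', m'⟩ h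
  have hn := n.pos
  have hm := m.pos
  have hn' := n'.pos
  have hm' := m'.pos
  have h1 : σ = σ' ∧ (n : ℕ) = n' ∧ (m : ℕ) = m' := by
    fin_cases σ <;> fin_cases σ' <;> simp only [cubicIndex, Prod.mk.injEq, PNat.add_coe] at h <;>
      first
        | (exfalso; omega)
        | exact ⟨rfl, by omega, by omega⟩
  obtain ⟨rfl, h2, h3⟩ := h1
  rw [PNat.eq h2, PNat.eq h3]

/-- Every index triple of the cubic interaction has one of the six sign patterns. -/
theorem exists_cubicIndex {B : ℕ} {a b c : ℤ} (ha : a ≠ 0) (hb : b ≠ 0) (hc : c ≠ 0)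
    (h : a + b + c = 0) (haB : a ≤ B) (hbB : b ≤ B) (hcB : c ≤ B) :
    ∃ (σ : Fin 6) (n m : ℕ+), (n : ℕ) ≤ B ∧ (m : ℕ) ≤ B ∧ cubicIndex σ n m = (a, b, c) := by
  have lift : ∀ k : ℤ, 0 < k → ∃ n : ℕ+, (n : ℤ) = k := fun k hk =>
    ⟨⟨k.toNat, by omega⟩, by simp; omega⟩
  rcases lt_or_gt_of_ne ha with ha | ha <;> rcases lt_or_gt_of_ne hb with hb | hb <;>
    rcases lt_or_gt_of_ne hc with hc | hc
  · omega
  · obtain ⟨n, hn⟩ := lift (-a) (by omega)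
    obtain ⟨m, hm⟩ := lift (-b) (by omega)
    exact ⟨3, n, m, by omega, by omega, by simp [cubicIndex]; omega⟩
  · obtain ⟨n, hn⟩ := lift (-a) (by omega)
    obtain ⟨m, hm⟩ := lift (-c) (by omega)
    exact ⟨4, n, m, by omega, by omega, by simp [cubicIndex]; omega⟩
  · obtain ⟨n, hn⟩ := lift b (by omega)
    obtain ⟨m, hm⟩ := lift c (by omega)
    exact ⟨2, n, m, by omega, by omega, by simp [cubicIndex]; omega⟩
  · obtain ⟨n, hn⟩ := lift (-b) (by omega)
    obtain ⟨m, hm⟩ := lift (-c) (by omega)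
    exact ⟨5, n, m, by omega, by omega, by simp [cubicIndex]; omega⟩
  · obtain ⟨n, hn⟩ := lift a (by omega)
    obtain ⟨m, hm⟩ := lift c (by omega)
    exact ⟨1, n, m, by omega, by omega, by simp [cubicIndex]; omega⟩
  · obtain ⟨n, hn⟩ := lift a (by omega)
    obtain ⟨m, hm⟩ := lift b (by omega)
    exact ⟨0, n, m, by omega, by omega, by simp [cubicIndex]; omega⟩
  · omega

theorem normalOrdered_cubicIndex (σ : Fin 6) (n m : ℕ+) :
    normalOrdered [(cubicIndex σ n m).1, (cubicIndex σ n m).2.1, (cubicIndex σ n m).2.2] =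
      if (σ : ℕ) < 3 then create (n + m) * (annihilate n * annihilate m)
        else create n * create m * annihilate (n + m) := by
  have h : ∀ k : ℕ+, (0 : ℤ) < k := fun k => by exact_mod_cast k.pos
  have h0 : ∀ k : ℕ+, ((k : ℕ) : ℤ) ≠ 0 := fun k => (h k).ne'
  have h1 : ∀ k : ℕ+, ¬ ((k : ℕ) : ℤ) < 0 := fun k => (h k).le.not_gt
  have h2 : ∀ k : ℕ+, -((k : ℕ) : ℤ) < 0 := fun k => neg_neg_of_pos (h k)
  have h3 : ∀ k : ℕ+, ¬ 0 < -((k : ℕ) : ℤ) := fun k => (h2 k).le.not_gt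
  have h4 : ∀ k : ℕ+, -((k : ℕ) : ℤ) ≠ 0 := fun k => (h2 k).ne
  rw [← mode_pos, ← mode_pos, ← mode_pos, ← mode_neg, ← mode_neg, ← mode_neg]
  generalize hk : n + m = k
  fin_cases σ <;> simp only [cubicIndex, hk] <;>
    simp only [normalOrdered, List.filter_cons, List.filter_nil, h, h0, h1, h2, h3, h4,
      decide_true, decide_false, if_true, Bool.false_eq_true, if_false, List.map_cons, List.map_nil,
      List.prod_cons, List.prod_nil, mul_one] <;> rfl

/-- The six index patterns of the cubic interaction give three equal terms of each of the two types
`c₋ₙ₋ₘ cₙ cₘ` and `c₋ₙ c₋ₘ cₙ₊ₘ`. -/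
theorem cubicTerm_bounded {B : ℕ} {v : Db} (hv : v ∈ boundedStates B) :
    cubicTerm v =
      (3 : ℂ) • (∑ n ∈ modesUpTo B, ∑ m ∈ modesUpTo B,
        create (n + m) (annihilate n (annihilate m v))) +
      (3 : ℂ) • ∑ n ∈ modesUpTo B, ∑ m ∈ modesUpTo B,
        create n (create m (annihilate (n + m) v)) := by
  classical
  rw [cubicTerm, sumOp_bounded (S := ((Finset.univ : Finset (Fin 6)) ×ˢ
    (modesUpTo B ×ˢ modesUpTo B)).image fun p => cubicIndex p.1 p.2.1 p.2.2) _ _ hv,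
    Finset.sum_image fun p _ p' _ h => cubicIndex_injective h, Finset.sum_product]
  · have hpos : ∀ n : ℕ+, (0 : ℤ) < n := fun n => by exact_mod_cast n.pos
    have hA : ∀ (σ : Fin 6) (n m : ℕ+),
        (if (cubicIndex σ n m).1 ≠ 0 ∧ (cubicIndex σ n m).2.1 ≠ 0 ∧ (cubicIndex σ n m).2.2 ≠ 0 ∧
          (cubicIndex σ n m).1 + (cubicIndex σ n m).2.1 + (cubicIndex σ n m).2.2 = 0 then
          normalOrdered [(cubicIndex σ n m).1, (cubicIndex σ n m).2.1, (cubicIndex σ n m).2.2]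
          else 0) = if (σ : ℕ) < 3 then create (n + m) * (annihilate n * annihilate m)
            else create n * create m * annihilate (n + m) := by
      intro σ n m
      have h1 := hpos n
      have h2 := hpos m
      have h3 := hpos (n + m)
      have h4 : ((n + m : ℕ+) : ℤ) = n + m := by push_cast; rfl
      rw [if_pos]
      · exact normalOrdered_cubicIndex σ n m
      · fin_cases σ <;> simp only [cubicIndex] <;> omega
    simp only [hA, Fin.sum_univ_six, Finset.sum_product]
    simp
    module
  · rintro ⟨a, b, c⟩ hp u hu
    by_contra h
    split_ifs at h with hc
    · have hle : ∀ d ∈ [a, b, c], d ≤ (B : ℤ) := by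
        intro d hd
        by_contra hlt
        push Not at hlt
        refine h ?_
        rw [normalOrdered, Module.End.mul_apply, (prod_annihilate_bounded B _ ?_).2
          ⟨d, ?_, hlt⟩ _ hu, map_zero]
        · intro b hb
          simpa using (List.mem_filter.mp hb).2
        · exact List.mem_filter.mpr ⟨hd, by simp; omega⟩
      obtain ⟨σ, n, m, hn, hm, he⟩ := exists_cubicIndex hc.1 hc.2.1 hc.2.2.1 hc.2.2.2
        (hle a (by simp)) (hle b (by simp)) (hle c (by simp))
      exact hp (Finset.mem_image.mpr ⟨(σ, n, m), by simp [mem_modesUpTo, hn, hm], he⟩)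
    · simp at h

theorem chargeOp_boson (ν₀ : ℝ) (i : FockIndex) :
    chargeOp ν₀ (bosonState i) = ((ν₀ : ℂ) * (i.1 : ℂ)) • bosonState i := by
  have h : mode 0 = chargeNumber := rfl
  rw [chargeOp, LinearMap.smul_apply, h, chargeNumber, onBasis_boson, smul_smul]

theorem chargeOp_mul_annihilate (ν₀ : ℝ) (n : ℕ+) :
    chargeOp ν₀ * annihilate n = annihilate n * chargeOp ν₀ := by
  refine Finsupp.lhom_ext' fun i => LinearMap.ext_ring ?_
  change chargeOp ν₀ (annihilate n (bosonState i)) = annihilate n (chargeOp ν₀ (bosonState i))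
  rw [chargeOp_boson, map_smul, annihilate, onBasis_boson, map_smul, chargeOp_boson, smul_comm]

theorem chargeOp_mul_create (ν₀ : ℝ) (n : ℕ+) :
    chargeOp ν₀ * create n = create n * chargeOp ν₀ := by
  refine Finsupp.lhom_ext' fun i => LinearMap.ext_ring ?_
  change chargeOp ν₀ (create n (bosonState i)) = create n (chargeOp ν₀ (bosonState i))
  rw [chargeOp_boson, map_smul, create, onBasis_boson, map_smul, chargeOp_boson, smul_comm]

/-- On states of definite charge, `ℋ^{ν,2}` acts as a differential operator in the power sums. -/
theorem bosonPoly_H2 (ν₀ : ℝ) {c : ℂ} {B : ℕ} {v : Db} (hv : v ∈ boundedStates B)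
    (hc : chargeOp ν₀ v = c • v) :
    bosonPoly κ (H2 ν₀ v) = (c ^ 2 / 2) • bosonPoly κ v +
      ∑ n ∈ modesUpTo B, powerSumPoly κ n * bosonPoly κ (annihilate n v) := by
  rw [H2, LinearMap.add_apply, LinearMap.smul_apply, pow_two, Module.End.mul_apply, hc, map_smul, hc,
    sumOp_bounded (S := modesUpTo B) _ _ hv, map_add, map_sum]
  · simp only [Module.End.mul_apply, mode_pos, mode_neg, bosonPoly_create, map_smul, smul_smul]
    congr 2
    ring
  · intro n hn u hu
    rw [Module.End.mul_apply, mode_pos, annihilate_eq_zero hn hu, map_zero]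

/-- On states of definite charge, `ℋ^{ν,3}` acts as a second order differential operator in the
power sums. -/
theorem bosonPoly_H3 (ν₀ ν : ℝ) {c : ℂ} {B : ℕ} {v : Db} (hv : v ∈ boundedStates B)
    (hc : chargeOp ν₀ v = c • v) :
    bosonPoly κ (H3 ν₀ ν v) =
      (ν : ℂ) • (∑ n ∈ modesUpTo B, ∑ m ∈ modesUpTo B,
        powerSumPoly κ (n + m) * bosonPoly κ (annihilate n (annihilate m v))) +
      (ν : ℂ) • (∑ n ∈ modesUpTo B, ∑ m ∈ modesUpTo B,
        powerSumPoly κ n * (powerSumPoly κ m * bosonPoly κ (annihilate (n + m) v))) +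
      ∑ n ∈ modesUpTo B, ((1 - (ν : ℂ) ^ 2) * (n : ℂ) + 2 * ν * c) •
        (powerSumPoly κ n * bosonPoly κ (annihilate n v)) +
      (ν / 3 * c ^ 3 - (ν : ℂ) ^ 3 / 12 * c) • bosonPoly κ v := by
  have h1 : ∀ n : ℕ+, chargeOp ν₀ (create n (annihilate n v)) = c • create n (annihilate n v) :=
    fun n => by
      have ha : chargeOp ν₀ (annihilate n v) = c • annihilate n v := by
        rw [← Module.End.mul_apply, chargeOp_mul_annihilate, Module.End.mul_apply, hc, map_smul]
      rw [← Module.End.mul_apply, chargeOp_mul_create, Module.End.mul_apply, ha, map_smul]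
  have h3 : (chargeOp ν₀ ^ 3) v = c ^ 3 • v := by
    rw [pow_succ, pow_two, Module.End.mul_apply, hc, map_smul, Module.End.mul_apply, hc, map_smul, hc,
      smul_smul, smul_smul]
    congr 1
    ring
  rw [H3, LinearMap.sub_apply, LinearMap.add_apply, LinearMap.add_apply, LinearMap.smul_apply,
    LinearMap.smul_apply, LinearMap.smul_apply, h3, hc, cubicTerm_bounded hv,
    sumOp_bounded (S := modesUpTo B) _ _ hv]
  · simp only [Module.End.mul_apply, LinearMap.add_apply, LinearMap.smul_apply,
      Module.End.one_apply, mode_pos, mode_neg, h1, map_add, map_sub, map_smul, map_sum,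
      bosonPoly_create, smul_add, smul_smul, add_smul, Finset.sum_add_distrib]
    module
  · intro n hn u hu
    rw [Module.End.mul_apply, Module.End.mul_apply, mode_pos, annihilate_eq_zero hn hu, map_zero,
      map_zero]

end BosonPoly

/-- The deformed power sums satisfy `(∂_{z_j} + g ∂_{w_k}) pₙ = 0` at `z_j = w_k` because
`ν - ν² / ν = 0`. -/
theorem powerSumPoly_mem {ν : ℝ} (hν : ν ≠ 0) (N M : ℕ) (n : ℕ+) :
    powerSumPoly (anyonCharge ν N M) n ∈ deformedSymmetric N M (ν ^ 2) := by
  classical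
  have hc : (ν : ℂ) ≠ 0 := by exact_mod_cast hν
  refine ⟨fun σ τ => ?_, fun j k v hv => ?_⟩
  · simp only [powerSumPoly, map_add, map_sum, map_mul, map_pow, MvPolynomial.rename_C,
      MvPolynomial.rename_X, Fintype.sum_sum_type, anyonCharge, Sum.elim_inl, Sum.elim_inr,
      Equiv.sumCongr_apply, Sum.map_inl, Sum.map_inr]
    congr 1
    · exact Equiv.sum_comp σ fun j => MvPolynomial.C (ν : ℂ) * MvPolynomial.X (Sum.inl j) ^ (n : ℕ)
    · exact Equiv.sum_comp τ fun k =>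
        MvPolynomial.C (-(ν : ℂ)⁻¹) * MvPolynomial.X (Sum.inr k) ^ (n : ℕ)
  · have hd : ∀ a, MvPolynomial.eval v (MvPolynomial.pderiv a
        (powerSumPoly (anyonCharge ν N M) n)) =
        anyonCharge ν N M a * ((n : ℕ) * v a ^ ((n : ℕ) - 1)) := by
      intro a
      rw [powerSumPoly, map_sum, map_sum, Finset.sum_eq_single a]
      · simp
      · intro b _ hb
        simp [MvPolynomial.pderiv_X_of_ne hb]
      · simp
    rw [hd, hd, hv]
    simp only [anyonCharge, Sum.elim_inl, Sum.elim_inr]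
    push_cast
    field_simp
    ring

theorem bosonPoly_mem {ν : ℝ} (hν : ν ≠ 0) (N M : ℕ) (v : Db) :
    bosonPoly (anyonCharge ν N M) v ∈ deformedSymmetric N M (ν ^ 2) := by
  rw [bosonPoly, Finsupp.linearCombination_apply]
  refine Subalgebra.sum_mem _ fun i _ => Subalgebra.smul_mem _ (Subalgebra.smul_mem _ ?_ _) _
  exact Subalgebra.prod_mem _ fun n _ => Subalgebra.pow_mem _ (powerSumPoly_mem hν N M n) _

/-! ### The algebra of the gauge transformation -/

/-- `(z + w) / (z - w)`, which is `-i cot ((x - y) / 2)` at `z = e^{ix}`, `w = e^{iy}`. It vanishes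
at `z = w`, by the convention for division by zero. -/
def pairCot (z w : ℂ) : ℂ := (z + w) / (z - w)

/-- `z w / (z - w)²`, which is `-1 / (4 sin² ((x - y) / 2))` at `z = e^{ix}`, `w = e^{iy}`. It vanishes
at `z = w`, by the convention for division by zero. -/
def pairInvSq (z w : ℂ) : ℂ := z * w / (z - w) ^ 2

theorem pairCot_self (z : ℂ) : pairCot z z = 0 := by simp [pairCot]

theorem pairInvSq_self (z : ℂ) : pairInvSq z z = 0 := by simp [pairInvSq]

theorem pairCot_swap (z w : ℂ) : pairCot w z = -pairCot z w := by
  rw [pairCot, pairCot, ← neg_sub z w, div_neg, add_comm]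

theorem pairInvSq_swap (z w : ℂ) : pairInvSq w z = pairInvSq z w := by
  rw [pairInvSq, pairInvSq, ← neg_sub z w, neg_sq, mul_comm]

theorem pairCot_sq {z w : ℂ} (h : z ≠ w) : pairCot z w ^ 2 = 1 + 4 * pairInvSq z w := by
  have := sub_ne_zero.mpr h
  rw [pairCot, pairInvSq]
  field_simp
  ring

/-- The cotangent identity. -/
theorem pairCot_three {z w u : ℂ} (h1 : z ≠ w) (h2 : z ≠ u) (h3 : w ≠ u) :
    pairCot z w * pairCot z u + pairCot w z * pairCot w u + pairCot u z * pairCot u w = 1 := by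
  rw [pairCot_swap z w, pairCot_swap z u, pairCot_swap w u]
  have := sub_ne_zero.mpr h1
  have := sub_ne_zero.mpr h2
  have := sub_ne_zero.mpr h3
  simp only [pairCot]
  field_simp
  ring

/-- Division of `zⁿ - wⁿ` by `z - w`: the pair terms acting on power sums are polynomial. -/
theorem sub_pow_mul_pairCot {z w : ℂ} (h : z ≠ w) {n : ℕ} (hn : 1 ≤ n) :
    (z ^ n - w ^ n) * pairCot z w =
      z ^ n + w ^ n + 2 * ∑ i ∈ Finset.Ico 1 n, z ^ i * w ^ (n - i) := by
  have h0 := sub_ne_zero.mpr h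
  rw [pairCot, mul_div_assoc', div_eq_iff h0]
  induction n, hn using Nat.le_induction with
  | base => simp; ring
  | succ n hn ih =>
    have hs : ∑ i ∈ Finset.Ico 1 (n + 1), z ^ i * w ^ (n + 1 - i) =
        w * ∑ i ∈ Finset.Ico 1 n, z ^ i * w ^ (n - i) + z ^ n * w := by
      rw [Finset.sum_Ico_succ_top hn, Finset.mul_sum]
      congr 1
      · refine Finset.sum_congr rfl fun i hi => ?_
        have : n + 1 - i = (n - i) + 1 := by
          have := (Finset.mem_Ico.mp hi).2
          omega
        rw [this]
        ring
      · simp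
    rw [hs]
    linear_combination w * ih

section Gauge

variable {ι : Type*} [Fintype ι]

/-- The logarithmic derivative `-i ∂_a log B` of the gauge factor
`B = e^{iA ∑ κ_a x_a} ∏_{a<b} [x_a - x_b]^{κ_a κ_b}`, as a function of `z_a = e^{ix_a}`. -/
def gaugeField (κ : ι → ℂ) (A : ℂ) (z : ι → ℂ) (a : ι) : ℂ :=
  κ a * (A + 1 / 2 * ∑ b, κ b * pairCot (z a) (z b))

theorem sum_pairCot_eq_zero (κ z : ι → ℂ) :
    ∑ a, ∑ b, κ a * κ b * pairCot (z a) (z b) = 0 := by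
  have h : ∑ a, ∑ b, κ a * κ b * pairCot (z a) (z b) =
      -∑ a, ∑ b, κ a * κ b * pairCot (z a) (z b) := by
    conv_lhs => rw [Finset.sum_comm]
    rw [← Finset.sum_neg_distrib]
    refine Finset.sum_congr rfl fun a _ => ?_
    rw [← Finset.sum_neg_distrib]
    refine Finset.sum_congr rfl fun b _ => ?_
    rw [pairCot_swap]
    ring
  exact CharZero.eq_neg_self_iff.mp h

theorem sum_gaugeField (κ : ι → ℂ) (A : ℂ) (z : ι → ℂ) :
    ∑ a, gaugeField κ A z a = A * ∑ a, κ a := by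
  have h := sum_pairCot_eq_zero κ z
  simp only [gaugeField, mul_add, Finset.sum_add_distrib]
  have h2 : ∑ a, κ a * (1 / 2 * ∑ b, κ b * pairCot (z a) (z b)) =
      1 / 2 * ∑ a, ∑ b, κ a * κ b * pairCot (z a) (z b) := by
    rw [Finset.mul_sum]
    refine Finset.sum_congr rfl fun a _ => ?_
    rw [Finset.mul_sum, Finset.mul_sum, Finset.mul_sum]
    exact Finset.sum_congr rfl fun b _ => by ring
  rw [h2, h, mul_zero, add_zero, Finset.mul_sum]
  exact Finset.sum_congr rfl fun a _ => mul_comm _ _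

/-- The cotangent identity with the corrections at coinciding indices, where `pairCot` and
`pairInvSq` vanish. -/
theorem pairCot_three_sum {ι : Type*} [DecidableEq ι] {z : ι → ℂ} (hz : Function.Injective z)
    (a b c : ι) :
    pairCot (z a) (z b) * pairCot (z a) (z c) + pairCot (z b) (z a) * pairCot (z b) (z c) +
      pairCot (z c) (z a) * pairCot (z c) (z b) =
    1 + (if a = b then 4 * pairInvSq (z a) (z c) else 0) +
      (if b = c then 4 * pairInvSq (z a) (z b) else 0) +
      (if a = c then 4 * pairInvSq (z a) (z b) else 0) -
      (if a = b then if b = c then 1 else 0 else 0) := by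
  by_cases hab : a = b
  · subst hab
    by_cases hac : a = c
    · subst hac
      simp [pairCot_self, pairInvSq_self]
    · have h := pairCot_sq (hz.ne (Ne.symm hac))
      rw [pairInvSq_swap] at h
      simp only [pairCot_self, pairInvSq_self, hac, if_true, if_false]
      linear_combination h
  · by_cases hbc : b = c
    · subst hbc
      have h := pairCot_sq (hz.ne hab)
      simp only [pairCot_self, hab, if_true, if_false]
      linear_combination h
    · by_cases hac : a = c
      · subst hac
        have h := pairCot_sq (hz.ne (Ne.symm hab))
        rw [pairInvSq_swap] at h
        simp only [pairCot_self, hab, hbc, if_true, if_false]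
        linear_combination h
      · simp only [hab, hbc, hac, if_false]
        rw [pairCot_three (hz.ne hab) (hz.ne hac) (hz.ne hbc)]
        ring

/-- The three-body terms of the gauge transformation reduce to two-body terms and a constant. -/
theorem sum_pairCot_mul_pairCot (κ : ι → ℂ) {z : ι → ℂ} (hz : Function.Injective z) :
    ∑ a, ∑ b, ∑ c, κ a * κ b * κ c * (pairCot (z a) (z b) * pairCot (z a) (z c)) =
      (∑ a, κ a) ^ 3 / 3 + 4 * ∑ a, ∑ b, κ a * κ b ^ 2 * pairInvSq (z a) (z b) -
        (∑ a, κ a ^ 3) / 3 := by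
  classical
  -- Symmetrize over the three indices, so that the cotangent identity applies.
  set F : ι → ι → ι → ℂ := fun a b c =>
    κ a * κ b * κ c * (pairCot (z a) (z b) * pairCot (z a) (z c)) with hF
  set X := ∑ a, ∑ b, ∑ c, F a b c with hX
  have h1 : ∑ a, ∑ b, ∑ c, F b a c = X := Finset.sum_comm
  have h2 : ∑ a, ∑ b, ∑ c, F c a b = X := by
    have : ∀ a, ∑ b, ∑ c, F c a b = ∑ c, ∑ b, F c a b := fun a => Finset.sum_comm
    simp only [this]
    exact Finset.sum_comm
  have h3 : X + X + X = ∑ a, ∑ b, ∑ c, κ a * κ b * κ c *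
      (1 + (if a = b then 4 * pairInvSq (z a) (z c) else 0) +
      (if b = c then 4 * pairInvSq (z a) (z b) else 0) +
      (if a = c then 4 * pairInvSq (z a) (z b) else 0) -
      (if a = b then if b = c then 1 else 0 else 0)) := by
    have h : X + X + X = ∑ a, ∑ b, ∑ c, F a b c + ∑ a, ∑ b, ∑ c, F b a c +
        ∑ a, ∑ b, ∑ c, F c a b := by rw [h1, h2]
    rw [h]
    simp only [← Finset.sum_add_distrib]
    refine Finset.sum_congr rfl fun a _ => Finset.sum_congr rfl fun b _ =>
      Finset.sum_congr rfl fun c _ => ?_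
    rw [← pairCot_three_sum hz]
    simp only [hF]
    ring
  simp only [mul_add, mul_sub, mul_ite, mul_zero, mul_one, Finset.sum_add_distrib,
    Finset.sum_sub_distrib] at h3
  have e0 : ∑ a, ∑ b, ∑ c, κ a * κ b * κ c = (∑ a, κ a) ^ 3 := by
    rw [pow_succ, pow_two, Finset.sum_mul_sum, Finset.sum_mul]
    refine Finset.sum_congr rfl fun a _ => ?_
    rw [Finset.sum_mul_sum]
  have e1 : ∑ a, ∑ b, ∑ c, (if a = b then κ a * κ b * κ c * (4 * pairInvSq (z a) (z c)) else 0) =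
      4 * ∑ a, ∑ b, κ a * κ b ^ 2 * pairInvSq (z a) (z b) := by
    rw [Finset.sum_comm (f := fun a b => κ a * κ b ^ 2 * pairInvSq (z a) (z b)), Finset.mul_sum]
    refine Finset.sum_congr rfl fun a _ => ?_
    rw [Finset.sum_eq_single a, Finset.mul_sum]
    · refine Finset.sum_congr rfl fun b _ => ?_
      rw [if_pos rfl, pairInvSq_swap (z a)]
      ring
    · intro b _ hb
      simp [Ne.symm hb]
    · simp
  have e2 : ∑ a, ∑ b, ∑ c, (if b = c then κ a * κ b * κ c * (4 * pairInvSq (z a) (z b)) else 0) =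
      4 * ∑ a, ∑ b, κ a * κ b ^ 2 * pairInvSq (z a) (z b) := by
    simp only [Finset.sum_ite_eq, Finset.mem_univ, if_true, Finset.mul_sum]
    refine Finset.sum_congr rfl fun a _ => Finset.sum_congr rfl fun b _ => ?_
    ring
  have e3 : ∑ a, ∑ b, ∑ c, (if a = c then κ a * κ b * κ c * (4 * pairInvSq (z a) (z b)) else 0) =
      4 * ∑ a, ∑ b, κ a * κ b ^ 2 * pairInvSq (z a) (z b) := by
    simp only [Finset.sum_ite_eq, Finset.mem_univ, if_true, Finset.mul_sum]
    rw [Finset.sum_comm]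
    refine Finset.sum_congr rfl fun a _ => Finset.sum_congr rfl fun b _ => ?_
    rw [pairInvSq_swap]
    ring
  have e4 : ∑ a, ∑ b, ∑ c, (if a = b then if b = c then κ a * κ b * κ c else 0 else 0) =
      ∑ a, κ a ^ 3 := by
    refine Finset.sum_congr rfl fun a _ => ?_
    rw [Finset.sum_eq_single a]
    · simp; ring
    · intro b _ hb
      simp [Ne.symm hb]
    · simp
  rw [e0, e1, e2, e3, e4] at h3
  linear_combination h3 / 3

/-- The zeroth order terms that the gauge transformation produces. -/
theorem sum_gaugeField_sq {κ : ι → ℂ} (hκ : ∀ a, κ a ≠ 0) (A : ℂ) {z : ι → ℂ}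
    (hz : Function.Injective z) :
    ∑ a, (κ a)⁻¹ * (-κ a * ∑ b, κ b * pairInvSq (z a) (z b) + gaugeField κ A z a ^ 2) =
      (∑ a, κ a) * A ^ 2 + (∑ a, κ a) ^ 3 / 12 - (∑ a, κ a ^ 3) / 12 +
        ∑ a, ∑ b, (κ a * κ b ^ 2 - κ b) * pairInvSq (z a) (z b) := by
  have h1 : ∀ a, (κ a)⁻¹ * (-κ a * ∑ b, κ b * pairInvSq (z a) (z b) + gaugeField κ A z a ^ 2) =
      κ a * A ^ 2 + A * ∑ b, κ a * κ b * pairCot (z a) (z b) +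
        1 / 4 * ∑ b, ∑ c, κ a * κ b * κ c * (pairCot (z a) (z b) * pairCot (z a) (z c)) -
        ∑ b, κ b * pairInvSq (z a) (z b) := by
    intro a
    have e1 : ∑ b, κ a * κ b * pairCot (z a) (z b) = κ a * ∑ b, κ b * pairCot (z a) (z b) := by
      rw [Finset.mul_sum]
      exact Finset.sum_congr rfl fun b _ => by ring
    have e2 : ∑ b, ∑ c, κ a * κ b * κ c * (pairCot (z a) (z b) * pairCot (z a) (z c)) =
        κ a * (∑ b, κ b * pairCot (z a) (z b)) ^ 2 := by
      rw [pow_two, Finset.sum_mul_sum, Finset.mul_sum]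
      refine Finset.sum_congr rfl fun b _ => ?_
      rw [Finset.mul_sum]
      exact Finset.sum_congr rfl fun c _ => by ring
    rw [e1, e2, gaugeField]
    have := hκ a
    field_simp
    ring
  simp only [h1, Finset.sum_sub_distrib, Finset.sum_add_distrib, ← Finset.mul_sum,
    ← Finset.sum_mul, sum_pairCot_eq_zero, sum_pairCot_mul_pairCot κ hz, sub_mul]
  ring

/-- The first order terms that the gauge transformation produces. -/
theorem sum_gaugeField_mul_pow (κ : ι → ℂ) (A ν : ℂ)
    (hκ : ∀ a, ν * (1 - κ a ^ 2) = (1 - ν ^ 2) * κ a)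
    {z : ι → ℂ} (hz : Function.Injective z) {n : ℕ} (hn : 1 ≤ n) :
    ν * (2 * ∑ a, gaugeField κ A z a * z a ^ n + n * ∑ a, z a ^ n) =
      ((1 - ν ^ 2) * n + 2 * ν * A + ν * ∑ a, κ a) * ∑ a, κ a * z a ^ n +
      ν * ∑ i ∈ Finset.Ico 1 n, (∑ a, κ a * z a ^ i) * ∑ a, κ a * z a ^ (n - i) := by
  classical
  have hpair : ∀ a b, (z a ^ n - z b ^ n) * pairCot (z a) (z b) =
      z a ^ n + z b ^ n + 2 * ∑ i ∈ Finset.Ico 1 n, z a ^ i * z b ^ (n - i) -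
        if a = b then 2 * n * z a ^ n else 0 := by
    intro a b
    by_cases hab : a = b
    · subst hab
      have : ∀ i ∈ Finset.Ico 1 n, z a ^ i * z a ^ (n - i) = z a ^ n := fun i hi => by
        rw [← pow_add, Nat.add_sub_cancel' (Finset.mem_Ico.mp hi).2.le]
      rw [Finset.sum_congr rfl this, Finset.sum_const, Nat.card_Ico, pairCot_self]
      simp only [if_true, nsmul_eq_mul]
      push_cast [hn]
      ring
    · rw [sub_pow_mul_pairCot (hz.ne hab) hn]
      simp [hab]
  -- Antisymmetrize the factor `z a ^ n`, as `pairCot` is odd.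
  set S := ∑ a, ∑ b, κ a * κ b * (z a ^ n * pairCot (z a) (z b)) with hS
  have h2S : S + S = ∑ a, ∑ b, κ a * κ b * ((z a ^ n - z b ^ n) * pairCot (z a) (z b)) := by
    have : S = ∑ a, ∑ b, κ a * κ b * (z b ^ n * pairCot (z b) (z a)) := by
      rw [hS, Finset.sum_comm]
      exact Finset.sum_congr rfl fun a _ => Finset.sum_congr rfl fun b _ => by ring
    conv_lhs => enter [2]; rw [this]
    rw [hS, ← Finset.sum_add_distrib]
    refine Finset.sum_congr rfl fun a _ => ?_
    rw [← Finset.sum_add_distrib]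
    refine Finset.sum_congr rfl fun b _ => ?_
    rw [pairCot_swap (z a) (z b)]
    ring
  have e1 : ∑ a, ∑ b, κ a * κ b * z a ^ n = (∑ a, κ a) * ∑ a, κ a * z a ^ n := by
    rw [mul_comm, Finset.sum_mul_sum]
    exact Finset.sum_congr rfl fun a _ => Finset.sum_congr rfl fun b _ => by ring
  have e2 : ∑ a, ∑ b, κ a * κ b * z b ^ n = (∑ a, κ a) * ∑ a, κ a * z a ^ n := by
    rw [Finset.sum_mul_sum]
    exact Finset.sum_congr rfl fun a _ => Finset.sum_congr rfl fun b _ => by ring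
  have e3 : ∑ a, ∑ b, κ a * κ b * (2 * ∑ i ∈ Finset.Ico 1 n, z a ^ i * z b ^ (n - i)) =
      2 * ∑ i ∈ Finset.Ico 1 n, (∑ a, κ a * z a ^ i) * ∑ a, κ a * z a ^ (n - i) := by
    simp only [Finset.sum_mul_sum]
    rw [Finset.sum_comm (s := Finset.Ico 1 n), Finset.mul_sum]
    refine Finset.sum_congr rfl fun a _ => ?_
    rw [Finset.sum_comm (s := Finset.Ico 1 n), Finset.mul_sum]
    refine Finset.sum_congr rfl fun b _ => ?_
    rw [Finset.mul_sum, Finset.mul_sum, Finset.mul_sum]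
    exact Finset.sum_congr rfl fun i _ => by ring
  have e4 : ∑ a, ∑ b, κ a * κ b * (if a = b then 2 * n * z a ^ n else 0) =
      2 * n * ∑ a, κ a ^ 2 * z a ^ n := by
    simp only [mul_ite, mul_zero, Finset.sum_ite_eq, Finset.mem_univ, if_true, Finset.mul_sum]
    exact Finset.sum_congr rfl fun a _ => by ring
  simp only [hpair, mul_sub, mul_add, Finset.sum_sub_distrib, Finset.sum_add_distrib, e1, e2, e3,
    e4] at h2S
  have e5 : ∑ a, gaugeField κ A z a * z a ^ n = A * ∑ a, κ a * z a ^ n + 1 / 2 * S := by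
    rw [hS, Finset.mul_sum, Finset.mul_sum, ← Finset.sum_add_distrib]
    refine Finset.sum_congr rfl fun a _ => ?_
    rw [gaugeField, mul_add, add_mul, Finset.mul_sum, Finset.mul_sum, Finset.sum_mul, Finset.mul_sum]
    congr 1
    · ring
    · exact Finset.sum_congr rfl fun b _ => by ring
  have e6 : ν * ∑ a, z a ^ n - ν * ∑ a, κ a ^ 2 * z a ^ n = (1 - ν ^ 2) * ∑ a, κ a * z a ^ n := by
    rw [Finset.mul_sum, Finset.mul_sum, Finset.mul_sum, ← Finset.sum_sub_distrib]
    exact Finset.sum_congr rfl fun a _ => by linear_combination z a ^ n * hκ a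
  rw [e5]
  linear_combination n * e6 + ν / 2 * h2S

end Gauge

/-! ### Intertwining of the boson operators with differential operators -/

section Intertwining

variable {ι : Type*} [Fintype ι]

theorem eval_powerSumPoly (κ z : ι → ℂ) (n : ℕ+) :
    MvPolynomial.eval z (powerSumPoly κ n) = ∑ a, κ a * z a ^ (n : ℕ) := by
  simp [powerSumPoly, map_sum]

theorem eval_eulerDerivation_bosonPoly (κ z : ι → ℂ) (a : ι) {B : ℕ} {v : Db}
    (hv : v ∈ boundedStates B) :
    MvPolynomial.eval z (eulerDerivation a (bosonPoly κ v)) = ∑ n ∈ modesUpTo B,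
      κ a * z a ^ (n : ℕ) * MvPolynomial.eval z (bosonPoly κ (annihilate n v)) := by
  rw [eulerDerivation_bosonPoly κ a hv, map_sum]
  simp

theorem eval_eulerDerivation_sq_bosonPoly (κ z : ι → ℂ) (a : ι) {B : ℕ} {v : Db}
    (hv : v ∈ boundedStates B) :
    MvPolynomial.eval z (eulerDerivation a (eulerDerivation a (bosonPoly κ v))) =
      ∑ n ∈ modesUpTo B,
        κ a * (n * z a ^ (n : ℕ)) * MvPolynomial.eval z (bosonPoly κ (annihilate n v)) +
      ∑ n ∈ modesUpTo B, ∑ m ∈ modesUpTo B, κ a ^ 2 * z a ^ ((n + m : ℕ+) : ℕ) *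
        MvPolynomial.eval z (bosonPoly κ (annihilate n (annihilate m v))) := by
  classical
  rw [eulerDerivation_bosonPoly κ a hv, map_sum, map_sum,
    Finset.sum_comm (s := modesUpTo B) (t := modesUpTo B), ← Finset.sum_add_distrib]
  refine Finset.sum_congr rfl fun n _ => ?_
  rw [← MvPolynomial.smul_eq_C_mul, smul_mul_assoc, Derivation.map_smul, Derivation.leibniz,
    eulerDerivation_X_pow, if_pos rfl, MvPolynomial.smul_eq_C_mul]
  simp only [smul_eq_mul, map_mul, map_add, MvPolynomial.eval_C, MvPolynomial.eval_X, map_pow,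
    map_natCast]
  rw [eval_eulerDerivation_bosonPoly κ z a (annihilate_bounded B n v hv).1, mul_add, add_comm,
    Finset.mul_sum, Finset.mul_sum]
  congr 1
  · ring
  · refine Finset.sum_congr rfl fun m _ => ?_
    rw [PNat.add_coe, pow_add]
    ring

/-- The double sum over modes `n`, `m` regrouped by `n + m`. -/
theorem sum_modesUpTo_Ico (B : ℕ) (P : ℕ → ℂ) {q : ℕ+ → ℂ} (hq : ∀ k ∉ modesUpTo B, q k = 0) :
    ∑ n ∈ modesUpTo B, (∑ i ∈ Finset.Ico 1 (n : ℕ), P i * P (n - i)) * q n =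
      ∑ n ∈ modesUpTo B, ∑ m ∈ modesUpTo B, P n * P m * q (n + m) := by
  have hR : ∑ n ∈ modesUpTo B, ∑ m ∈ modesUpTo B, P n * P m * q (n + m) =
      ∑ p ∈ (modesUpTo B ×ˢ modesUpTo B).filter (fun p => p.1 + p.2 ∈ modesUpTo B),
        P p.1 * P p.2 * q (p.1 + p.2) := by
    rw [← Finset.sum_product', Finset.sum_filter]
    refine Finset.sum_congr rfl fun p _ => ?_
    split_ifs with h
    · rfl
    · rw [hq _ h, mul_zero]
  rw [hR]
  simp only [Finset.sum_mul]
  rw [Finset.sum_sigma']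
  symm
  refine Finset.sum_bij (fun p _ => ⟨p.1 + p.2, (p.1 : ℕ)⟩) ?_ ?_ ?_ ?_
  · rintro ⟨a, b⟩ h
    have := b.pos
    simp only [Finset.mem_filter] at h
    simp only [Finset.mem_sigma, Finset.mem_Ico, PNat.add_coe]
    exact ⟨h.2, a.pos, by omega⟩
  · rintro ⟨a, b⟩ _ ⟨a', b'⟩ _ h
    obtain ⟨h1, h2⟩ := Sigma.mk.inj h
    obtain rfl : a = a' := PNat.eq (eq_of_heq h2)
    exact congrArg (Prod.mk a) (add_left_cancel h1)
  · rintro ⟨n, i⟩ h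
    simp only [Finset.mem_sigma, Finset.mem_Ico] at h
    obtain ⟨a, rfl⟩ : ∃ a : ℕ+, (a : ℕ) = i := ⟨⟨i, h.2.1⟩, rfl⟩
    obtain ⟨b, hb⟩ : ∃ b : ℕ+, (b : ℕ) = n - a := ⟨⟨n - a, by omega⟩, rfl⟩
    have hn : a + b = n := PNat.eq (by rw [PNat.add_coe]; omega)
    have hB := mem_modesUpTo.mp h.1
    refine ⟨(a, b), ?_, Sigma.ext hn HEq.rfl⟩
    rw [Finset.mem_filter, Finset.mem_product, hn, mem_modesUpTo, mem_modesUpTo]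
    exact ⟨⟨show (a : ℕ) ≤ B by omega, show (b : ℕ) ≤ B by omega⟩, h.1⟩
  · rintro ⟨a, b⟩ _
    simp

/-- The momentum operator on the boson states is the Euler operator on polynomials. -/
theorem sum_eval_eulerDerivation (κ z : ι → ℂ) (ν₀ : ℝ) {c : ℂ} {B : ℕ} {v : Db}
    (hv : v ∈ boundedStates B) (hc : chargeOp ν₀ v = c • v) :
    ∑ a, MvPolynomial.eval z (eulerDerivation a (bosonPoly κ v)) =
      MvPolynomial.eval z (bosonPoly κ (H2 ν₀ v)) -
        c ^ 2 / 2 * MvPolynomial.eval z (bosonPoly κ v) := by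
  rw [bosonPoly_H2 κ ν₀ hv hc]
  simp only [eval_eulerDerivation_bosonPoly κ z _ hv, map_add, MvPolynomial.smul_eval, map_sum,
    map_mul, eval_powerSumPoly, Finset.sum_mul]
  rw [Finset.sum_comm]
  ring

/-- The operator `ℋ^{ν,3}` on the boson states is the gauge transformed deformed Calogero-Sutherland
operator on polynomials, up to its zeroth order terms. -/
theorem sum_eval_eulerDerivation_sq {κ : ι → ℂ} (hκ0 : ∀ a, κ a ≠ 0) (ν₀ ν : ℝ)
    (hκ : ∀ a, (ν : ℂ) * (1 - κ a ^ 2) = (1 - (ν : ℂ) ^ 2) * κ a) (A : ℂ)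
    {z : ι → ℂ} (hz : Function.Injective z) {B : ℕ} {v : Db} (hv : v ∈ boundedStates B)
    {c : ℂ} (hcA : c = A + (∑ a, κ a) / 2) (hc : chargeOp ν₀ v = c • v) :
    ∑ a, (ν : ℂ) * (κ a)⁻¹ *
      (MvPolynomial.eval z (eulerDerivation a (eulerDerivation a (bosonPoly κ v))) +
        2 * gaugeField κ A z a * MvPolynomial.eval z (eulerDerivation a (bosonPoly κ v))) =
      MvPolynomial.eval z (bosonPoly κ (H3 ν₀ ν v)) -
        (ν / 3 * c ^ 3 - (ν : ℂ) ^ 3 / 12 * c) * MvPolynomial.eval z (bosonPoly κ v) := by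
  set q : ℕ+ → ℂ := fun n => MvPolynomial.eval z (bosonPoly κ (annihilate n v)) with hq
  set q2 : ℕ+ → ℕ+ → ℂ := fun n m =>
    MvPolynomial.eval z (bosonPoly κ (annihilate n (annihilate m v))) with hq2
  have hL : ∀ a, (ν : ℂ) * (κ a)⁻¹ *
      (MvPolynomial.eval z (eulerDerivation a (eulerDerivation a (bosonPoly κ v))) +
        2 * gaugeField κ A z a * MvPolynomial.eval z (eulerDerivation a (bosonPoly κ v))) =
      ∑ n ∈ modesUpTo B, (ν : ℂ) * (2 * (gaugeField κ A z a * z a ^ (n : ℕ)) +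
        n * z a ^ (n : ℕ)) * q n +
      ∑ n ∈ modesUpTo B, ∑ m ∈ modesUpTo B,
        ν * (κ a * z a ^ ((n + m : ℕ+) : ℕ) * q2 n m) := by
    intro a
    have h0 := hκ0 a
    rw [eval_eulerDerivation_sq_bosonPoly κ z a hv, eval_eulerDerivation_bosonPoly κ z a hv,
      mul_add, mul_add, add_right_comm]
    simp only [Finset.mul_sum]
    rw [← Finset.sum_add_distrib]
    congr 1
    · refine Finset.sum_congr rfl fun n _ => ?_
      simp only [hq]
      field_simp
      ring
    · refine Finset.sum_congr rfl fun n _ => Finset.sum_congr rfl fun m _ => ?_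
      simp only [hq2]
      field_simp
  have hqz : ∀ k ∉ modesUpTo B, q k = 0 := fun k hk => by
    simp only [hq]
    rw [annihilate_eq_zero hk hv, map_zero, map_zero]
  have h1 : ∀ n : ℕ+, ∑ a, (ν : ℂ) * (2 * (gaugeField κ A z a * z a ^ (n : ℕ)) +
        n * z a ^ (n : ℕ)) * q n =
      ((1 - (ν : ℂ) ^ 2) * n + 2 * ν * c) * ((∑ a, κ a * z a ^ (n : ℕ)) * q n) +
      ν * ((∑ i ∈ Finset.Ico 1 (n : ℕ), (∑ a, κ a * z a ^ i) * ∑ a, κ a * z a ^ ((n : ℕ) - i)) *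
        q n) := by
    intro n
    have h := sum_gaugeField_mul_pow κ A ν hκ hz n.pos
    rw [← Finset.sum_mul, ← Finset.mul_sum, Finset.sum_add_distrib, ← Finset.mul_sum,
      ← Finset.mul_sum, hcA]
    refine (congrArg (· * q n) h).trans ?_
    ring
  have h2 : ∑ a, ∑ n ∈ modesUpTo B, ∑ m ∈ modesUpTo B,
        (ν : ℂ) * (κ a * z a ^ ((n + m : ℕ+) : ℕ) * q2 n m) =
      ν * ∑ n ∈ modesUpTo B, ∑ m ∈ modesUpTo B,
        (∑ a, κ a * z a ^ ((n + m : ℕ+) : ℕ)) * q2 n m := by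
    rw [Finset.sum_comm, Finset.mul_sum]
    refine Finset.sum_congr rfl fun n _ => ?_
    rw [Finset.sum_comm, Finset.mul_sum]
    refine Finset.sum_congr rfl fun m _ => ?_
    rw [Finset.sum_mul, Finset.mul_sum]
  rw [Finset.sum_congr rfl fun a _ => hL a, Finset.sum_add_distrib, h2, Finset.sum_comm,
    Finset.sum_congr rfl fun n _ => h1 n, Finset.sum_add_distrib, ← Finset.mul_sum,
    sum_modesUpTo_Ico B (fun i => ∑ a, κ a * z a ^ i) hqz, bosonPoly_H3 κ ν₀ ν hv hc]
  simp only [map_add, MvPolynomial.smul_eval, map_sum, map_mul, eval_powerSumPoly, hq, hq2,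
    mul_assoc]
  ring

end Intertwining

/-! ### The pair potentials -/

/-- A symmetric double sum with vanishing diagonal is twice the sum over ordered pairs. -/
theorem sum_sum_eq_Ioi {n : ℕ} {f : Fin n → Fin n → ℂ} (hf : ∀ j j', f j j' = f j' j)
    (h0 : ∀ j, f j j = 0) : ∑ j, ∑ j', f j j' = 2 * ∑ j, ∑ j' ∈ Finset.Ioi j, f j j' := by
  have h1 : ∀ j, ∑ j', f j j' = ∑ j' ∈ Finset.Iio j, f j j' + ∑ j' ∈ Finset.Ioi j, f j j' := by
    intro j
    rw [← Finset.sum_union (Finset.disjoint_left.mpr fun a ha hb =>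
      lt_asymm (Finset.mem_Iio.mp ha) (Finset.mem_Ioi.mp hb))]
    refine (Finset.sum_subset (Finset.subset_univ _) fun a _ ha => ?_).symm
    have : a = j := by
      simp only [Finset.mem_union, Finset.mem_Iio, Finset.mem_Ioi, not_or, not_lt] at ha
      exact le_antisymm ha.2 ha.1
    rw [this, h0]
  have h2 : ∑ j, ∑ j' ∈ Finset.Iio j, f j j' = ∑ j, ∑ j' ∈ Finset.Ioi j, f j j' := by
    rw [Finset.sum_comm' (t' := Finset.univ) (s' := fun j => Finset.Ioi j) (by simp)]
    exact Finset.sum_congr rfl fun j _ => Finset.sum_congr rfl fun j' _ => hf _ _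
  rw [Finset.sum_congr rfl fun j _ => h1 j, Finset.sum_add_distrib, h2]
  ring

theorem pairPotential_sub (x y : ℂ) :
    pairPotential (x - y) =
      -2 * pairInvSq (Complex.exp (Complex.I * x)) (Complex.exp (Complex.I * y)) := by
  have hz := Complex.exp_ne_zero (Complex.I * x)
  have hw := Complex.exp_ne_zero (Complex.I * y)
  have h : Complex.sin ((x - y) / 2) ^ 2 =
      -((Complex.exp (Complex.I * x) - Complex.exp (Complex.I * y)) ^ 2 /
        (4 * (Complex.exp (Complex.I * x) * Complex.exp (Complex.I * y)))) := by
    have e1 : Complex.cos (x - y) =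
        (Complex.exp (Complex.I * x) / Complex.exp (Complex.I * y) +
          Complex.exp (Complex.I * y) / Complex.exp (Complex.I * x)) / 2 := by
      rw [Complex.cos, ← Complex.exp_sub, ← Complex.exp_sub]
      ring_nf
    have e2 := Complex.cos_two_mul ((x - y) / 2)
    rw [mul_div_cancel₀ _ two_ne_zero, e1] at e2
    have e3 := Complex.sin_sq_add_cos_sq ((x - y) / 2)
    have e4 : Complex.sin ((x - y) / 2) ^ 2 = (1 - (Complex.exp (Complex.I * x) /
        Complex.exp (Complex.I * y) + Complex.exp (Complex.I * y) /
        Complex.exp (Complex.I * x)) / 2) / 2 := by linear_combination e3 + e2 / 2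
    rw [e4]
    field_simp
    ring
  rw [pairPotential, h, pairInvSq]
  -- At coincidences both sides are zero, by the convention for division by zero.
  by_cases h0 : Complex.exp (Complex.I * x) - Complex.exp (Complex.I * y) = 0
  · simp [h0]
  · field_simp
    ring

/-- The pair potentials of the deformed Calogero-Sutherland operator cancel the two-body terms of
the gauge transformation. -/
theorem two_body_terms_cancel {ν : ℝ} (hν : ν ≠ 0) {N M : ℕ} (x : Fin N → ℂ) (y : Fin M → ℂ)
    {z : Fin N ⊕ Fin M → ℂ} (hzx : ∀ j, z (Sum.inl j) = Complex.exp (Complex.I * x j))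
    (hzy : ∀ k, z (Sum.inr k) = Complex.exp (Complex.I * y k)) :
    (ν : ℂ) * ∑ a, ∑ b, (anyonCharge ν N M a * anyonCharge ν N M b ^ 2 - anyonCharge ν N M b) *
        pairInvSq (z a) (z b) +
      ((∑ j, ∑ j' ∈ Finset.Ioi j, (ν : ℂ) ^ 2 * ((ν : ℂ) ^ 2 - 1) * pairPotential (x j - x j')) +
      (∑ k, ∑ k' ∈ Finset.Ioi k, ((ν : ℂ) ^ 2 - 1) / (ν : ℂ) ^ 2 * pairPotential (y k - y k')) +
      ∑ j, ∑ k, (1 - (ν : ℂ) ^ 2) * pairPotential (x j - y k)) = 0 := by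
  have hc : (ν : ℂ) ≠ 0 := by exact_mod_cast hν
  have hx := sum_sum_eq_Ioi
    (f := fun j j' => pairInvSq (z (Sum.inl j : Fin N ⊕ Fin M)) (z (Sum.inl j')))
    (fun _ _ => pairInvSq_swap _ _) fun _ => pairInvSq_self _
  have hy := sum_sum_eq_Ioi
    (f := fun k k' => pairInvSq (z (Sum.inr k : Fin N ⊕ Fin M)) (z (Sum.inr k')))
    (fun _ _ => pairInvSq_swap _ _) fun _ => pairInvSq_self _
  have hyx : ∑ k, ∑ j, pairInvSq (z (Sum.inr k : Fin N ⊕ Fin M)) (z (Sum.inl j)) =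
      ∑ j, ∑ k, pairInvSq (z (Sum.inl j)) (z (Sum.inr k)) := by
    rw [Finset.sum_comm]
    exact Finset.sum_congr rfl fun _ _ => Finset.sum_congr rfl fun _ _ => pairInvSq_swap _ _
  simp only [Fintype.sum_sum_type, Finset.sum_add_distrib, anyonCharge, Sum.elim_inl, Sum.elim_inr,
    pairPotential_sub, ← hzx, ← hzy, ← Finset.mul_sum, hx, hy, hyx]
  field_simp
  ring

/-! ### Logarithmic derivatives of the gauge factor -/

/-- `f` has the logarithmic derivative `-i f' / f = c` at `t`, in a form without division. -/
def HasLogDeriv (f : ℂ → ℂ) (c t : ℂ) : Prop := HasDerivAt f (Complex.I * c * f t) t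

theorem hasLogDeriv_const (a t : ℂ) : HasLogDeriv (fun _ => a) 0 t := by
  simpa [HasLogDeriv] using hasDerivAt_const t a

theorem HasLogDeriv.mul {f g : ℂ → ℂ} {c d t : ℂ} (hf : HasLogDeriv f c t)
    (hg : HasLogDeriv g d t) : HasLogDeriv (fun s => f s * g s) (c + d) t := by
  refine (HasDerivAt.mul hf hg).congr_deriv ?_
  ring

theorem HasLogDeriv.inv {f : ℂ → ℂ} {c t : ℂ} (hf : HasLogDeriv f c t) (h : f t ≠ 0) :
    HasLogDeriv (fun s => (f s)⁻¹) (-c) t := by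
  refine (HasDerivAt.inv hf h).congr_deriv ?_
  field_simp

theorem HasLogDeriv.prod {τ : Type*} {s : Finset τ} {f : τ → ℂ → ℂ} {c : τ → ℂ} {t : ℂ}
    (h : ∀ a ∈ s, HasLogDeriv (f a) (c a) t) :
    HasLogDeriv (fun u => ∏ a ∈ s, f a u) (∑ a ∈ s, c a) t := by
  classical
  induction s using Finset.induction_on with
  | empty => simpa using hasLogDeriv_const 1 t
  | insert a s ha ih =>
    simp only [Finset.prod_insert ha, Finset.sum_insert ha]
    exact (h a (by simp)).mul (ih fun b hb => h b (by simp [hb]))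

theorem hasLogDeriv_exp {f : ℂ → ℂ} {c t : ℂ} (h : HasDerivAt f (Complex.I * c) t) :
    HasLogDeriv (fun s => Complex.exp (f s)) c t := by
  refine h.cexp.congr_deriv ?_
  ring

theorem pairCot_exp (x y : ℂ) :
    pairCot (Complex.exp (Complex.I * x)) (Complex.exp (Complex.I * y)) =
      (1 + Complex.exp (-Complex.I * (x - y))) / (1 - Complex.exp (-Complex.I * (x - y))) := by
  have h : Complex.exp (Complex.I * y) =
      Complex.exp (Complex.I * x) * Complex.exp (-Complex.I * (x - y)) := by
    rw [← Complex.exp_add]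
    congr 1
    ring
  have hx := Complex.exp_ne_zero (Complex.I * x)
  rw [pairCot, h]
  rw [show Complex.exp (Complex.I * x) + Complex.exp (Complex.I * x) *
      Complex.exp (-Complex.I * (x - y)) = Complex.exp (Complex.I * x) *
      (1 + Complex.exp (-Complex.I * (x - y))) by ring,
    show Complex.exp (Complex.I * x) - Complex.exp (Complex.I * x) *
      Complex.exp (-Complex.I * (x - y)) = Complex.exp (Complex.I * x) *
      (1 - Complex.exp (-Complex.I * (x - y))) by ring, mul_div_mul_left _ _ hx]

theorem hasDerivAt_sinePower (a : ℝ) {u : ℂ} (h : 1 - Complex.exp (-Complex.I * u) ∈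
    Complex.slitPlane) :
    HasDerivAt (sinePower a) (Complex.I * (a / 2 * ((1 + Complex.exp (-Complex.I * u)) /
      (1 - Complex.exp (-Complex.I * u)))) * sinePower a u) u := by
  have h0 := Complex.slitPlane_ne_zero h
  have h1 : HasDerivAt (fun u => Complex.exp (Complex.I * a * u / 2))
      (Complex.exp (Complex.I * a * u / 2) * (Complex.I * a / 2)) u := by
    have : HasDerivAt (fun u : ℂ => Complex.I * a * u / 2) (Complex.I * a / 2) u := by
      simpa using ((hasDerivAt_id u).const_mul (Complex.I * a)).div_const 2
    exact this.cexp
  have h2 : HasDerivAt (fun u => 1 - Complex.exp (-Complex.I * u))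
      (Complex.I * Complex.exp (-Complex.I * u)) u := by
    have : HasDerivAt (fun u : ℂ => -Complex.I * u) (-Complex.I) u := by
      simpa using (hasDerivAt_id u).const_mul (-Complex.I)
    refine (this.cexp.const_sub 1).congr_deriv ?_
    ring
  refine (h1.mul (h2.cpow_const (c := (a : ℂ)) h)).congr_deriv ?_
  rw [sinePower, Complex.cpow_sub _ _ h0, Complex.cpow_one]
  generalize Complex.exp (-Complex.I * u) = w at h0 ⊢
  field_simp
  ring

theorem hasLogDeriv_sinePower_sub_const (a : ℝ) {t y : ℂ}
    (h : 1 - Complex.exp (-Complex.I * (t - y)) ∈ Complex.slitPlane) :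
    HasLogDeriv (fun s => sinePower a (s - y))
      (a / 2 * pairCot (Complex.exp (Complex.I * t)) (Complex.exp (Complex.I * y))) t := by
  rw [pairCot_exp]
  exact (hasDerivAt_sinePower a h).comp_sub_const t y

theorem hasLogDeriv_sinePower_const_sub (a : ℝ) {x t : ℂ}
    (h : 1 - Complex.exp (-Complex.I * (x - t)) ∈ Complex.slitPlane) :
    HasLogDeriv (fun s => sinePower a (x - s))
      (a / 2 * pairCot (Complex.exp (Complex.I * t)) (Complex.exp (Complex.I * x))) t := by
  rw [pairCot_swap, pairCot_exp]
  refine ((hasDerivAt_sinePower a h).comp_const_sub x t).congr_deriv ?_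
  ring

theorem exp_sub_exp_eq_sin (u : ℂ) :
    Complex.exp (Complex.I * u / 2) - Complex.exp (-(Complex.I * u / 2)) =
      2 * Complex.I * Complex.sin (u / 2) := by
  have h := Complex.two_sin (u / 2)
  have e1 : Complex.I * u / 2 = u / 2 * Complex.I := by ring
  have e2 : -(Complex.I * u / 2) = -(u / 2) * Complex.I := by ring
  rw [e2, e1]
  linear_combination (-Complex.I) * h - (Complex.exp (-(u / 2) * Complex.I) -
    Complex.exp (u / 2 * Complex.I)) * Complex.I_sq

/-- The factors `[s - y]` in the denominator of the groundstate. -/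
theorem hasLogDeriv_sine {t y : ℂ} (h : Complex.sin ((t - y) / 2) ≠ 0) :
    HasLogDeriv (fun s => Complex.exp (Complex.I * (s - y) / 2) -
      Complex.exp (Complex.I * (y - s) / 2))
      (1 / 2 * pairCot (Complex.exp (Complex.I * t)) (Complex.exp (Complex.I * y))) t := by
  have h1 : HasDerivAt (fun s : ℂ => Complex.I * (s - y) / 2) (Complex.I / 2) t := by
    simpa using (((hasDerivAt_id t).sub_const y).const_mul Complex.I).div_const 2
  have h2 : HasDerivAt (fun s : ℂ => Complex.I * (y - s) / 2) (-Complex.I / 2) t := by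
    simpa using (((hasDerivAt_id t).const_sub y).const_mul Complex.I).div_const 2
  refine (h1.cexp.sub h2.cexp).congr_deriv ?_
  have hE := Complex.exp_ne_zero (Complex.I * (t - y) / 2)
  have e1 : Complex.I * (y - t) / 2 = -(Complex.I * (t - y) / 2) := by ring
  have e2 : Complex.exp (-Complex.I * (t - y)) =
      Complex.exp (-(Complex.I * (t - y) / 2)) / Complex.exp (Complex.I * (t - y) / 2) := by
    rw [← Complex.exp_sub]
    congr 1
    ring
  have h0 : Complex.exp (Complex.I * (t - y) / 2) - Complex.exp (-(Complex.I * (t - y) / 2)) ≠ 0 := by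
    rw [exp_sub_exp_eq_sin]
    simp [h, Complex.I_ne_zero]
  rw [pairCot_exp, e1, e2]
  have h3 : 1 - Complex.exp (-(Complex.I * (t - y) / 2)) / Complex.exp (Complex.I * (t - y) / 2) =
      (Complex.exp (Complex.I * (t - y) / 2) - Complex.exp (-(Complex.I * (t - y) / 2))) /
        Complex.exp (Complex.I * (t - y) / 2) := by
    field_simp
  rw [h3]
  field_simp
  ring_nf

/-- The ordered product over pairs has the unordered sum of cotangents as logarithmic derivative,
since `pairCot` is odd. -/
theorem hasLogDeriv_pairProduct (α : ℝ) {n : ℕ} {x : Fin n → ℂ} (hx : ∀ j j', j < j' →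
    1 - Complex.exp (-Complex.I * (x j - x j')) ∈ Complex.slitPlane) (j : Fin n) :
    HasLogDeriv (fun t => ∏ a, ∏ b ∈ Finset.Ioi a,
        sinePower α (Function.update x j t a - Function.update x j t b))
      (α / 2 * ∑ b, pairCot (Complex.exp (Complex.I * x j)) (Complex.exp (Complex.I * x b)))
      (x j) := by
  set c : Fin n → ℂ := fun b =>
    α / 2 * pairCot (Complex.exp (Complex.I * x j)) (Complex.exp (Complex.I * x b)) with hc
  have h1 : ∀ a, ∀ b ∈ Finset.Ioi a, HasLogDeriv (fun t =>
      sinePower α (Function.update x j t a - Function.update x j t b))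
      ((if a = j then c b else 0) + if b = j then c a else 0) (x j) := by
    intro a b hab
    have hlt := Finset.mem_Ioi.mp hab
    have hs := hx a b hlt
    by_cases haj : a = j
    · subst haj
      have hb : b ≠ a := hlt.ne'
      simp only [Function.update_self, Function.update_of_ne hb, if_true, hb, if_false, add_zero]
      exact hasLogDeriv_sinePower_sub_const α hs
    · by_cases hbj : b = j
      · subst hbj
        simp only [Function.update_self, Function.update_of_ne haj, if_true, haj, if_false,
          zero_add]
        exact hasLogDeriv_sinePower_const_sub α hs
      · simp only [Function.update_of_ne haj, Function.update_of_ne hbj, haj, hbj, if_false,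
          add_zero]
        exact hasLogDeriv_const _ _
  have h2 := HasLogDeriv.prod (s := Finset.univ) fun a _ => HasLogDeriv.prod (h1 a)
  have h3 : ∑ a, ∑ b ∈ Finset.Ioi a, ((if a = j then c b else 0) + if b = j then c a else 0) =
      α / 2 * ∑ b, pairCot (Complex.exp (Complex.I * x j)) (Complex.exp (Complex.I * x b)) := by
    have e1 : ∑ a, ∑ b ∈ Finset.Ioi a, (if b = j then c a else 0) = ∑ a ∈ Finset.Iio j, c a := by
      rw [Finset.sum_comm' (t' := Finset.univ) (s' := fun b => Finset.Iio b) (by simp),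
        Finset.sum_eq_single j]
      · simp
      · intro b _ hb
        simp [hb]
      · simp
    have e2 : ∑ a, ∑ b ∈ Finset.Ioi a, (if a = j then c b else 0) = ∑ b ∈ Finset.Ioi j, c b := by
      rw [Finset.sum_eq_single j]
      · simp
      · intro b _ hb
        simp [hb]
      · simp
    simp only [Finset.sum_add_distrib]
    rw [e1, e2, Finset.mul_sum, ← Finset.sum_union (Finset.disjoint_left.mpr fun a ha hb =>
      lt_asymm (Finset.mem_Iio.mp hb) (Finset.mem_Ioi.mp ha))]
    refine Finset.sum_subset (Finset.subset_univ _) fun a _ ha => ?_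
    have : a = j := by
      simp only [Finset.mem_union, Finset.mem_Iio, Finset.mem_Ioi, not_or, not_lt] at ha
      exact le_antisymm ha.1 ha.2
    rw [hc, this]
    simp [pairCot_self]
  rwa [h3] at h2

/-- The variables `z_j = e^{ix_j}`, `w_k = e^{iy_k}`. -/
def expConfig {N M : ℕ} (x : Fin N → ℂ) (y : Fin M → ℂ) : Fin N ⊕ Fin M → ℂ :=
  Sum.elim (fun j => Complex.exp (Complex.I * x j)) fun k => Complex.exp (Complex.I * y k)

/-- The factor `e^{iq₀(∑xⱼ - ∑yₖ/g)} Ψ₀` in the closed formula for the correlation function. -/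
def gaugeFactor (ν q₀ : ℝ) {N M : ℕ} (x : Fin N → ℂ) (y : Fin M → ℂ) : ℂ :=
  Complex.exp (Complex.I * (q₀ : ℂ) * ((∑ j, x j) - (∑ k, y k) / ((ν ^ 2 : ℝ) : ℂ))) *
    groundState (ν ^ 2) x y

theorem hasDerivAt_sum_update {n : ℕ} (x : Fin n → ℂ) (j : Fin n) :
    HasDerivAt (fun t => ∑ a, Function.update x j t a) 1 (x j) := by
  have h : (fun t => ∑ a, Function.update x j t a) =
      fun t => t + ∑ a ∈ Finset.univ.erase j, x a := by
    funext t
    rw [← Finset.add_sum_erase _ _ (Finset.mem_univ j), Function.update_self]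
    congr 1
    exact Finset.sum_congr rfl fun a ha => Function.update_of_ne (Finset.ne_of_mem_erase ha) _ _
  rw [h]
  exact (hasDerivAt_id (x j)).add_const _

theorem sine_ne_zero {x y : ℂ} (h : Complex.sin ((x - y) / 2) ≠ 0) :
    Complex.exp (Complex.I * (x - y) / 2) - Complex.exp (Complex.I * (y - x) / 2) ≠ 0 := by
  have e1 : Complex.I * (y - x) / 2 = -(Complex.I * (x - y) / 2) := by ring
  rw [e1, exp_sub_exp_eq_sin]
  simp [h, Complex.I_ne_zero]

/-- The logarithmic derivative of the gauge factor in the `x` variables. The exponents of its pair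
factors are the products of the statistics parameters: `ν²`, `1/ν²` and `-1`. -/
theorem hasLogDeriv_gaugeFactor_left {ν : ℝ} (hν : ν ≠ 0) {q₀ : ℝ} {A : ℂ} (hq : (q₀ : ℂ) = ν * A)
    {N M : ℕ} {x : Fin N → ℂ} {y : Fin M → ℂ} (h : (x, y) ∈ regularRegion N M) (j : Fin N) :
    HasLogDeriv (fun t => gaugeFactor ν q₀ (Function.update x j t) y)
      (gaugeField (anyonCharge ν N M) A (expConfig x y) (Sum.inl j)) (x j) := by
  have h1 : ∀ j j', j < j' →
    1 - Complex.exp (-Complex.I * (x j - x j')) ∈ Complex.slitPlane := h.1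
  have h2 : ∀ k k', k < k' →
    1 - Complex.exp (-Complex.I * (y k - y k')) ∈ Complex.slitPlane := h.2.1
  have h3 : ∀ j k, Complex.sin ((x j - y k) / 2) ≠ 0 := h.2.2
  have hc : (ν : ℂ) ≠ 0 := by exact_mod_cast hν
  have hexp := hasLogDeriv_exp (c := q₀) ((((hasDerivAt_sum_update x j).sub_const
    ((∑ k, y k) / ((ν ^ 2 : ℝ) : ℂ))).const_mul (Complex.I * (q₀ : ℂ))).congr_deriv (mul_one _))
  have hpair := hasLogDeriv_pairProduct (ν ^ 2) h1 j
  have hcross : HasLogDeriv (fun t => ∏ a, ∏ k,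
      (Complex.exp (Complex.I * (Function.update x j t a - y k) / 2) -
        Complex.exp (Complex.I * (y k - Function.update x j t a) / 2)))
      (∑ a, ∑ k, if a = j then 1 / 2 * pairCot (Complex.exp (Complex.I * x j))
        (Complex.exp (Complex.I * y k)) else 0) (x j) := by
    refine HasLogDeriv.prod fun a _ => HasLogDeriv.prod fun k _ => ?_
    by_cases haj : a = j
    · subst haj
      simp only [Function.update_self, if_true]
      exact hasLogDeriv_sine (h3 a k)
    · simp only [Function.update_of_ne haj, haj, if_false]
      exact hasLogDeriv_const _ _
  have hcross0 : ∏ a, ∏ k, (Complex.exp (Complex.I * (Function.update x j (x j) a - y k) / 2) -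
        Complex.exp (Complex.I * (y k - Function.update x j (x j) a) / 2)) ≠ 0 := by
    rw [Function.update_eq_self]
    exact Finset.prod_ne_zero_iff.mpr fun a _ => Finset.prod_ne_zero_iff.mpr fun k _ =>
      sine_ne_zero (h3 a k)
  have hall := hexp.mul ((hpair.mul (hasLogDeriv_const
    (∏ k, ∏ k' ∈ Finset.Ioi k, sinePower (1 / ν ^ 2) (y k - y k')) (x j))).mul (hcross.inv hcross0))
  have hsum : (q₀ : ℂ) + (((ν ^ 2 : ℝ) : ℂ) / 2 * ∑ b, pairCot (Complex.exp (Complex.I * x j))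
      (Complex.exp (Complex.I * x b)) + 0 + -∑ a, ∑ k, if a = j then 1 / 2 *
        pairCot (Complex.exp (Complex.I * x j)) (Complex.exp (Complex.I * y k)) else 0) =
      gaugeField (anyonCharge ν N M) A (expConfig x y) (Sum.inl j) := by
    have hcr : (∑ a, ∑ k, if a = j then 1 / 2 * pairCot (Complex.exp (Complex.I * x j))
        (Complex.exp (Complex.I * y k)) else 0) =
        ∑ k, 1 / 2 * pairCot (Complex.exp (Complex.I * x j)) (Complex.exp (Complex.I * y k)) := by
      rw [Finset.sum_eq_single j (by intro b _ hb; simp [hb]) (by simp)]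
      simp
    rw [hcr, gaugeField, hq]
    simp only [Fintype.sum_sum_type, anyonCharge, expConfig, Sum.elim_inl, Sum.elim_inr,
      ← Finset.mul_sum]
    push_cast
    field_simp
    ring
  rw [hsum] at hall
  simpa only [gaugeFactor, groundState, div_eq_mul_inv] using hall

theorem hasLogDeriv_gaugeFactor_right {ν : ℝ} (hν : ν ≠ 0) {q₀ : ℝ} {A : ℂ}
    (hq : (q₀ : ℂ) = ν * A) {N M : ℕ} {x : Fin N → ℂ} {y : Fin M → ℂ}
    (h : (x, y) ∈ regularRegion N M) (k : Fin M) :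
    HasLogDeriv (fun t => gaugeFactor ν q₀ x (Function.update y k t))
      (gaugeField (anyonCharge ν N M) A (expConfig x y) (Sum.inr k)) (y k) := by
  have h1 : ∀ j j', j < j' →
    1 - Complex.exp (-Complex.I * (x j - x j')) ∈ Complex.slitPlane := h.1
  have h2 : ∀ k k', k < k' →
    1 - Complex.exp (-Complex.I * (y k - y k')) ∈ Complex.slitPlane := h.2.1
  have h3 : ∀ j k, Complex.sin ((x j - y k) / 2) ≠ 0 := h.2.2
  have hc : (ν : ℂ) ≠ 0 := by exact_mod_cast hν
  have hexp : HasLogDeriv (fun t => Complex.exp (Complex.I * (q₀ : ℂ) * ((∑ j, x j) -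
      (∑ k', Function.update y k t k') / ((ν ^ 2 : ℝ) : ℂ)))) (-q₀ / ((ν ^ 2 : ℝ) : ℂ)) (y k) := by
    refine hasLogDeriv_exp (((((hasDerivAt_sum_update y k).div_const _).const_sub
      (∑ j, x j)).const_mul (Complex.I * (q₀ : ℂ))).congr_deriv ?_)
    ring
  have hpair := hasLogDeriv_pairProduct (1 / ν ^ 2) h2 k
  have hcross : HasLogDeriv (fun t => ∏ j, ∏ b,
      (Complex.exp (Complex.I * (x j - Function.update y k t b) / 2) -
        Complex.exp (Complex.I * (Function.update y k t b - x j) / 2)))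
      (∑ j, ∑ b, if b = k then 1 / 2 * pairCot (Complex.exp (Complex.I * y k))
        (Complex.exp (Complex.I * x j)) else 0) (y k) := by
    refine HasLogDeriv.prod fun j _ => HasLogDeriv.prod fun b _ => ?_
    by_cases hbk : b = k
    · subst hbk
      simp only [Function.update_self, if_true]
      have h0 : Complex.sin ((y b - x j) / 2) ≠ 0 := by
        rw [← neg_sub, neg_div, Complex.sin_neg]
        exact neg_ne_zero.mpr (h3 j b)
      have := (hasLogDeriv_const (-1) (y b)).mul (hasLogDeriv_sine h0)
      simpa using this
    · simp only [Function.update_of_ne hbk, hbk, if_false]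
      exact hasLogDeriv_const _ _
  have hcross0 : ∏ j, ∏ b, (Complex.exp (Complex.I * (x j - Function.update y k (y k) b) / 2) -
        Complex.exp (Complex.I * (Function.update y k (y k) b - x j) / 2)) ≠ 0 := by
    rw [Function.update_eq_self]
    exact Finset.prod_ne_zero_iff.mpr fun a _ => Finset.prod_ne_zero_iff.mpr fun k _ =>
      sine_ne_zero (h3 a k)
  have hall := hexp.mul (((hasLogDeriv_const
    (∏ j, ∏ j' ∈ Finset.Ioi j, sinePower (ν ^ 2) (x j - x j')) (y k)).mul hpair).mul
      (hcross.inv hcross0))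
  have hsum : -(q₀ : ℂ) / ((ν ^ 2 : ℝ) : ℂ) + (0 + ((1 / ν ^ 2 : ℝ) : ℂ) / 2 *
      ∑ b, pairCot (Complex.exp (Complex.I * y k)) (Complex.exp (Complex.I * y b)) +
        -∑ j, ∑ b, if b = k then 1 / 2 *
        pairCot (Complex.exp (Complex.I * y k)) (Complex.exp (Complex.I * x j)) else 0) =
      gaugeField (anyonCharge ν N M) A (expConfig x y) (Sum.inr k) := by
    rw [gaugeField, hq]
    simp only [Finset.sum_ite_eq', Finset.mem_univ, if_true, Fintype.sum_sum_type, anyonCharge,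
      expConfig, Sum.elim_inl, Sum.elim_inr, ← Finset.mul_sum]
    push_cast
    field_simp
    ring
  rw [hsum] at hall
  simpa only [gaugeFactor, groundState, div_eq_mul_inv] using hall

/-! ### The gauge transformation in one variable -/

section Slice

variable {ι : Type*} [DecidableEq ι]

theorem hasDerivAt_eval_update (z : ι → ℂ) (a : ι) (P : MvPolynomial ι ℂ) (t : ℂ) :
    HasDerivAt (fun s => MvPolynomial.eval (Function.update z a (Complex.exp (Complex.I * s))) P)
      (Complex.I * MvPolynomial.eval (Function.update z a (Complex.exp (Complex.I * t)))
        (eulerDerivation a P)) t := by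
  induction P using MvPolynomial.induction_on with
  | C c =>
    have h : eulerDerivation a (MvPolynomial.C c : MvPolynomial ι ℂ) = 0 :=
      (eulerDerivation a).map_algebraMap c
    simpa [h] using hasDerivAt_const t c
  | add P Q hP hQ =>
    simp only [map_add, mul_add]
    exact hP.add hQ
  | mul_X P b hP =>
    have hb : HasDerivAt (fun s => Function.update z a (Complex.exp (Complex.I * s)) b)
        (Complex.I * MvPolynomial.eval (Function.update z a (Complex.exp (Complex.I * t)))
          (eulerDerivation a (MvPolynomial.X b))) t := by
      have hX := eulerDerivation_X_pow a b 1
      rw [pow_one] at hX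
      by_cases hab : a = b
      · subst hab
        rw [hX, if_pos rfl]
        simp only [Function.update_self, Nat.cast_one, one_mul, MvPolynomial.eval_X]
        have : HasDerivAt (fun s : ℂ => Complex.I * s) Complex.I t := by
          simpa using (hasDerivAt_id t).const_mul Complex.I
        refine this.cexp.congr_deriv (mul_comm _ _)
      · rw [hX, if_neg hab]
        simp only [Function.update_of_ne (Ne.symm hab), map_zero, mul_zero]
        exact hasDerivAt_const _ _
    simp only [map_mul, MvPolynomial.eval_X, Derivation.leibniz, smul_eq_mul, map_add]
    refine (hP.mul hb).congr_deriv ?_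
    ring

variable [Fintype ι]

theorem hasDerivAt_gaugeField (κ : ι → ℂ) (A : ℂ) {z : ι → ℂ} (hz : Function.Injective z) {a : ι}
    {t : ℂ} (ht : z a = Complex.exp (Complex.I * t)) :
    HasDerivAt (fun s => gaugeField κ A (Function.update z a (Complex.exp (Complex.I * s))) a)
      (Complex.I * (-κ a * ∑ b, κ b * pairInvSq (z a) (z b))) t := by
  have hexp : HasDerivAt (fun s : ℂ => Complex.exp (Complex.I * s))
      (Complex.I * Complex.exp (Complex.I * t)) t := by
    have : HasDerivAt (fun s : ℂ => Complex.I * s) Complex.I t := by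
      simpa using (hasDerivAt_id t).const_mul Complex.I
    exact this.cexp.congr_deriv (mul_comm _ _)
  have hb : ∀ b, HasDerivAt (fun s => κ b *
      pairCot (Function.update z a (Complex.exp (Complex.I * s)) a)
        (Function.update z a (Complex.exp (Complex.I * s)) b))
      (κ b * (Complex.I * (-2 * pairInvSq (z a) (z b)))) t := by
    intro b
    refine HasDerivAt.const_mul _ ?_
    by_cases hab : b = a
    · subst hab
      simp only [pairCot_self, pairInvSq_self, mul_zero]
      exact hasDerivAt_const _ _
    · simp only [Function.update_self, Function.update_of_ne hab]
      have h0 : Complex.exp (Complex.I * t) - z b ≠ 0 := by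
        rw [← ht]
        exact sub_ne_zero.mpr (hz.ne (Ne.symm hab))
      refine ((hexp.add_const (z b)).div (hexp.sub_const (z b)) h0).congr_deriv ?_
      rw [pairInvSq, ht]
      field_simp
      ring
  have hsum := HasDerivAt.fun_sum fun b (_ : b ∈ Finset.univ) => hb b
  refine (((hsum.const_mul (1 / 2)).const_add A).const_mul (κ a)).congr_deriv ?_
  rw [Finset.mul_sum, Finset.mul_sum, Finset.mul_sum, Finset.mul_sum]
  exact Finset.sum_congr rfl fun b _ => by ring

open Filter Topology in
/-- The first two derivatives of a product of the gauge factor with a polynomial in `e^{ix_a}`. -/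
theorem deriv_gauge_mul_eval (κ : ι → ℂ) (A : ℂ) {z : ι → ℂ} (hz : Function.Injective z) {a : ι}
    {t : ℂ} (ht : z a = Complex.exp (Complex.I * t)) (P : MvPolynomial ι ℂ) {G f : ℂ → ℂ}
    (hG : ∀ᶠ s in 𝓝 t, HasLogDeriv G
      (gaugeField κ A (Function.update z a (Complex.exp (Complex.I * s))) a) s)
    (hf : ∀ s, f s =
      G s * MvPolynomial.eval (Function.update z a (Complex.exp (Complex.I * s))) P) :
    deriv f t = Complex.I * (gaugeField κ A z a * MvPolynomial.eval z P +
        MvPolynomial.eval z (eulerDerivation a P)) * G t ∧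
    iteratedDeriv 2 f t = -(MvPolynomial.eval z (eulerDerivation a (eulerDerivation a P)) +
        2 * gaugeField κ A z a * MvPolynomial.eval z (eulerDerivation a P) +
        (-κ a * ∑ b, κ b * pairInvSq (z a) (z b) + gaugeField κ A z a ^ 2) *
          MvPolynomial.eval z P) * G t := by
  obtain rfl : f = _ := funext hf
  have hup : Function.update z a (Complex.exp (Complex.I * t)) = z := by
    rw [← ht, Function.update_eq_self]
  have h1 : ∀ᶠ s in 𝓝 t, deriv (fun s => G s *
      MvPolynomial.eval (Function.update z a (Complex.exp (Complex.I * s))) P) s =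
      Complex.I * (gaugeField κ A (Function.update z a (Complex.exp (Complex.I * s))) a *
        MvPolynomial.eval (Function.update z a (Complex.exp (Complex.I * s))) P +
        MvPolynomial.eval (Function.update z a (Complex.exp (Complex.I * s)))
          (eulerDerivation a P)) * G s := by
    filter_upwards [hG] with s hs
    refine (HasDerivAt.mul hs (hasDerivAt_eval_update z a P s)).deriv.trans ?_
    ring
  refine ⟨by rw [h1.self_of_nhds, hup], ?_⟩
  rw [iteratedDeriv_succ, iteratedDeriv_one, EventuallyEq.deriv_eq h1]
  have hW := hasDerivAt_gaugeField κ A hz ht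
  have hP := hasDerivAt_eval_update z a P t
  have hP1 := hasDerivAt_eval_update z a (eulerDerivation a P) t
  have hG0 : HasDerivAt G _ t := hG.self_of_nhds
  refine (((((hW.mul hP).add hP1).const_mul Complex.I).mul hG0).deriv).trans ?_
  simp only [hup, Pi.add_apply, Pi.mul_apply]
  linear_combination ((-κ a * ∑ b, κ b * pairInvSq (z a) (z b)) * MvPolynomial.eval z P +
    gaugeField κ A z a ^ 2 * MvPolynomial.eval z P +
    2 * gaugeField κ A z a * MvPolynomial.eval z (eulerDerivation a P) +
    MvPolynomial.eval z (eulerDerivation a (eulerDerivation a P))) * G t * Complex.I_sq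

end Slice

/-! ### The regular region -/

theorem isOpen_regularRegion (N M : ℕ) : IsOpen (regularRegion N M) := by
  have h : regularRegion N M =
      (⋂ j, ⋂ j', ⋂ (_ : j < j'), {p : (Fin N → ℂ) × (Fin M → ℂ) |
        1 - Complex.exp (-Complex.I * (p.1 j - p.1 j')) ∈ Complex.slitPlane}) ∩
      ((⋂ k, ⋂ k', ⋂ (_ : k < k'), {p : (Fin N → ℂ) × (Fin M → ℂ) |
        1 - Complex.exp (-Complex.I * (p.2 k - p.2 k')) ∈ Complex.slitPlane}) ∩
      ⋂ j, ⋂ k, {p : (Fin N → ℂ) × (Fin M → ℂ) | Complex.sin ((p.1 j - p.2 k) / 2) ≠ 0}) := by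
    ext p
    simp [regularRegion]
  rw [h]
  refine IsOpen.inter ?_ (IsOpen.inter ?_ ?_)
  · exact isOpen_iInter_of_finite fun j => isOpen_iInter_of_finite fun j' =>
      isOpen_iInter_of_finite fun _ => Complex.isOpen_slitPlane.preimage (by fun_prop)
  · exact isOpen_iInter_of_finite fun j => isOpen_iInter_of_finite fun j' =>
      isOpen_iInter_of_finite fun _ => Complex.isOpen_slitPlane.preimage (by fun_prop)
  · exact isOpen_iInter_of_finite fun j => isOpen_iInter_of_finite fun k =>
      isOpen_ne_fun (by fun_prop) continuous_const

/-- At regular configurations the points `e^{ix_j}`, `e^{iy_k}` are distinct. -/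
theorem expConfig_injective {N M : ℕ} {x : Fin N → ℂ} {y : Fin M → ℂ}
    (h : (x, y) ∈ regularRegion N M) : Function.Injective (expConfig x y) := by
  obtain ⟨h1, h2, h3⟩ := h
  have key : ∀ u v : ℂ, Complex.exp (Complex.I * u) = Complex.exp (Complex.I * v) →
      Complex.exp (-Complex.I * (u - v)) = 1 := fun u v huv => by
    rw [show -Complex.I * (u - v) = Complex.I * v - Complex.I * u by ring, Complex.exp_sub, huv,
      div_self (Complex.exp_ne_zero _)]
  have hx : ∀ j j', j < j' → Complex.exp (Complex.I * x j) ≠ Complex.exp (Complex.I * x j') :=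
    fun j j' hj he => Complex.slitPlane_ne_zero (h1 j j' hj) (sub_eq_zero.mpr (key _ _ he).symm)
  have hy : ∀ j j', j < j' → Complex.exp (Complex.I * y j) ≠ Complex.exp (Complex.I * y j') :=
    fun j j' hj he => Complex.slitPlane_ne_zero (h2 j j' hj) (sub_eq_zero.mpr (key _ _ he).symm)
  have hxy : ∀ j k, Complex.exp (Complex.I * x j) ≠ Complex.exp (Complex.I * y k) := by
    intro j k he
    refine sine_ne_zero (h3 j k) ?_
    have e1 : Complex.I * (y k - x j) / 2 = Complex.I * (x j - y k) / 2 +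
      -Complex.I * (x j - y k) := by ring
    rw [e1, Complex.exp_add, key _ _ he, mul_one, sub_self]
  rintro (j | k) (j' | k') he
  · rcases lt_trichotomy j j' with hj | rfl | hj
    · exact absurd he (hx _ _ hj)
    · rfl
    · exact absurd he.symm (hx _ _ hj)
  · exact absurd he (hxy _ _)
  · exact absurd he.symm (hxy _ _)
  · rcases lt_trichotomy k k' with hj | rfl | hj
    · exact absurd he (hy _ _ hj)
    · rfl
    · exact absurd he.symm (hy _ _ hj)

theorem analyticAt_eval {E : Type*} [NormedAddCommGroup E] [NormedSpace ℂ E] {ι : Type*}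
    (P : MvPolynomial ι ℂ) {z : E → ι → ℂ} {p : E} (hz : ∀ a, AnalyticAt ℂ (fun q => z q a) p) :
    AnalyticAt ℂ (fun q => MvPolynomial.eval (z q) P) p := by
  induction P using MvPolynomial.induction_on with
  | C c => simpa using analyticAt_const
  | add P Q hP hQ =>
    simp only [map_add]
    exact hP.add hQ
  | mul_X P b hP =>
    simp only [map_mul, MvPolynomial.eval_X]
    exact hP.mul (hz b)

theorem analyticOnNhd_correlationFormula (ν q₀ : ℝ) {N M : ℕ}
    (P : MvPolynomial (Fin N ⊕ Fin M) ℂ) :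
    AnalyticOnNhd ℂ (Function.uncurry (correlationFormula ν q₀ P)) (regularRegion N M) := by
  rintro ⟨x, y⟩ ⟨h1, h2, h3⟩
  have hx : ∀ j, AnalyticAt ℂ (fun p : (Fin N → ℂ) × (Fin M → ℂ) => p.1 j) (x, y) := fun j =>
    ((ContinuousLinearMap.proj (R := ℂ) (φ := fun _ : Fin N => ℂ) j).comp
      (ContinuousLinearMap.fst ℂ (Fin N → ℂ) (Fin M → ℂ))).analyticAt (x, y)
  have hy : ∀ k, AnalyticAt ℂ (fun p : (Fin N → ℂ) × (Fin M → ℂ) => p.2 k) (x, y) := fun k =>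
    ((ContinuousLinearMap.proj (R := ℂ) (φ := fun _ : Fin M => ℂ) k).comp
      (ContinuousLinearMap.snd ℂ (Fin N → ℂ) (Fin M → ℂ))).analyticAt (x, y)
  have hpow : ∀ (a : ℝ) {u : (Fin N → ℂ) × (Fin M → ℂ) → ℂ}, AnalyticAt ℂ u (x, y) →
      1 - Complex.exp (-Complex.I * u (x, y)) ∈ Complex.slitPlane →
      AnalyticAt ℂ (fun p => sinePower a (u p)) (x, y) := by
    intro a u hu hs
    unfold sinePower
    refine ((analyticAt_const.mul hu).div analyticAt_const two_ne_zero).cexp.mul ?_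
    exact (analyticAt_const.sub (analyticAt_const.mul hu).cexp).cpow analyticAt_const hs
  unfold Function.uncurry correlationFormula groundState
  refine (AnalyticAt.mul (AnalyticAt.cexp (analyticAt_const.mul (AnalyticAt.sub ?_ ?_)))
    (AnalyticAt.div (AnalyticAt.mul ?_ ?_) ?_ ?_)).mul ?_
  · exact Finset.analyticAt_fun_sum _ fun j _ => hx j
  · exact (Finset.analyticAt_fun_sum _ fun k _ => hy k).div_const
  · exact Finset.analyticAt_fun_prod _ fun j _ => Finset.analyticAt_fun_prod _ fun j' hj =>
      hpow _ ((hx j).sub (hx j')) (h1 j j' (Finset.mem_Ioi.mp hj))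
  · exact Finset.analyticAt_fun_prod _ fun j _ => Finset.analyticAt_fun_prod _ fun j' hj =>
      hpow _ ((hy j).sub (hy j')) (h2 j j' (Finset.mem_Ioi.mp hj))
  · exact Finset.analyticAt_fun_prod _ fun j _ => Finset.analyticAt_fun_prod _ fun k _ =>
      ((analyticAt_const.mul ((hx j).sub (hy k))).div_const).cexp.sub
        ((analyticAt_const.mul ((hy k).sub (hx j))).div_const).cexp
  · exact Finset.prod_ne_zero_iff.mpr fun j _ => Finset.prod_ne_zero_iff.mpr fun k _ =>
      sine_ne_zero (h3 j k)
  · refine analyticAt_eval P ?_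
    rintro (j | k)
    · exact (analyticAt_const.mul (hx j)).cexp
    · exact (analyticAt_const.mul (hy k)).cexp

/-! ### Eigenfunctions of the deformed Calogero-Sutherland operator -/

theorem expConfig_update_left {N M : ℕ} (x : Fin N → ℂ) (y : Fin M → ℂ) (j : Fin N) (t : ℂ) :
    expConfig (Function.update x j t) y =
      Function.update (expConfig x y) (Sum.inl j) (Complex.exp (Complex.I * t)) := by
  funext a
  rcases a with j' | k
  · by_cases h : j' = j
    · subst h
      simp [expConfig]
    · have h' : (Sum.inl j' : Fin N ⊕ Fin M) ≠ Sum.inl j := fun e => h (Sum.inl_injective e)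
      simp [expConfig, Function.update_of_ne h, Function.update_of_ne h']
  · simp [expConfig]

theorem expConfig_update_right {N M : ℕ} (x : Fin N → ℂ) (y : Fin M → ℂ) (k : Fin M) (t : ℂ) :
    expConfig x (Function.update y k t) =
      Function.update (expConfig x y) (Sum.inr k) (Complex.exp (Complex.I * t)) := by
  funext a
  rcases a with j | k'
  · simp [expConfig]
  · by_cases h : k' = k
    · subst h
      simp [expConfig]
    · have h' : (Sum.inr k' : Fin N ⊕ Fin M) ≠ Sum.inr k := fun e => h (Sum.inr_injective e)
      simp [expConfig, Function.update_of_ne h, Function.update_of_ne h']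

theorem correlationFormula_eq (ν q₀ : ℝ) {N M : ℕ} (P : MvPolynomial (Fin N ⊕ Fin M) ℂ)
    (x : Fin N → ℂ) (y : Fin M → ℂ) :
    correlationFormula ν q₀ P x y =
      gaugeFactor ν q₀ x y * MvPolynomial.eval (expConfig x y) P := rfl

section Eigenfunction

variable {ν : ℝ} {N M : ℕ} {x : Fin N → ℂ} {y : Fin M → ℂ}

open Filter Topology in
/-- The first two derivatives in an `x` variable. -/
theorem deriv_correlationFormula_left (hν : ν ≠ 0) {q₀ : ℝ} {A : ℂ} (hq : (q₀ : ℂ) = ν * A)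
    (h : (x, y) ∈ regularRegion N M) (P : MvPolynomial (Fin N ⊕ Fin M) ℂ) (j : Fin N) :
    let κ := anyonCharge ν N M
    let z := expConfig x y
    deriv (fun t => correlationFormula ν q₀ P (Function.update x j t) y) (x j) =
      Complex.I * (gaugeField κ A z (Sum.inl j) * MvPolynomial.eval z P +
        MvPolynomial.eval z (eulerDerivation (Sum.inl j) P)) * gaugeFactor ν q₀ x y ∧
    iteratedDeriv 2 (fun t => correlationFormula ν q₀ P (Function.update x j t) y) (x j) =
      -(MvPolynomial.eval z (eulerDerivation (Sum.inl j) (eulerDerivation (Sum.inl j) P)) +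
        2 * gaugeField κ A z (Sum.inl j) * MvPolynomial.eval z (eulerDerivation (Sum.inl j) P) +
        (-κ (Sum.inl j) * ∑ b, κ b * pairInvSq (z (Sum.inl j)) (z b) +
          gaugeField κ A z (Sum.inl j) ^ 2) * MvPolynomial.eval z P) * gaugeFactor ν q₀ x y := by
  intro κ z
  have hev : ∀ᶠ s in 𝓝 (x j), HasLogDeriv (fun t => gaugeFactor ν q₀ (Function.update x j t) y)
      (gaugeField κ A (Function.update z (Sum.inl j) (Complex.exp (Complex.I * s))) (Sum.inl j))
      s := by
    have hcont : ContinuousAt (fun s => ((Function.update x j s, y) :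
        (Fin N → ℂ) × (Fin M → ℂ))) (x j) := by fun_prop
    have hmem := hcont.eventually_mem ((isOpen_regularRegion N M).mem_nhds
      (by rwa [Function.update_eq_self]))
    filter_upwards [hmem] with s hs
    have := hasLogDeriv_gaugeFactor_left hν hq hs j
    simpa only [Function.update_idem, Function.update_self, expConfig_update_left] using this
  have hd := deriv_gauge_mul_eval κ A (expConfig_injective h) (a := Sum.inl j) (t := x j) rfl P hev
    (f := fun t => correlationFormula ν q₀ P (Function.update x j t) y)
    fun s => by rw [correlationFormula_eq, expConfig_update_left]
  simpa only [Function.update_eq_self] using hd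

open Filter Topology in
/-- The first two derivatives in a `y` variable. -/
theorem deriv_correlationFormula_right (hν : ν ≠ 0) {q₀ : ℝ} {A : ℂ} (hq : (q₀ : ℂ) = ν * A)
    (h : (x, y) ∈ regularRegion N M) (P : MvPolynomial (Fin N ⊕ Fin M) ℂ) (k : Fin M) :
    let κ := anyonCharge ν N M
    let z := expConfig x y
    deriv (fun t => correlationFormula ν q₀ P x (Function.update y k t)) (y k) =
      Complex.I * (gaugeField κ A z (Sum.inr k) * MvPolynomial.eval z P +
        MvPolynomial.eval z (eulerDerivation (Sum.inr k) P)) * gaugeFactor ν q₀ x y ∧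
    iteratedDeriv 2 (fun t => correlationFormula ν q₀ P x (Function.update y k t)) (y k) =
      -(MvPolynomial.eval z (eulerDerivation (Sum.inr k) (eulerDerivation (Sum.inr k) P)) +
        2 * gaugeField κ A z (Sum.inr k) * MvPolynomial.eval z (eulerDerivation (Sum.inr k) P) +
        (-κ (Sum.inr k) * ∑ b, κ b * pairInvSq (z (Sum.inr k)) (z b) +
          gaugeField κ A z (Sum.inr k) ^ 2) * MvPolynomial.eval z P) * gaugeFactor ν q₀ x y := by
  intro κ z
  have hev : ∀ᶠ s in 𝓝 (y k), HasLogDeriv (fun t => gaugeFactor ν q₀ x (Function.update y k t))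
      (gaugeField κ A (Function.update z (Sum.inr k) (Complex.exp (Complex.I * s))) (Sum.inr k))
      s := by
    have hcont : ContinuousAt (fun s => ((x, Function.update y k s) :
        (Fin N → ℂ) × (Fin M → ℂ))) (y k) := by fun_prop
    have hmem := hcont.eventually_mem ((isOpen_regularRegion N M).mem_nhds
      (by rwa [Function.update_eq_self]))
    filter_upwards [hmem] with s hs
    have := hasLogDeriv_gaugeFactor_right hν hq hs k
    simpa only [Function.update_idem, Function.update_self, expConfig_update_right] using this
  have hd := deriv_gauge_mul_eval κ A (expConfig_injective h) (a := Sum.inr k) (t := y k) rfl P hev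
    (f := fun t => correlationFormula ν q₀ P x (Function.update y k t))
    fun s => by rw [correlationFormula_eq, expConfig_update_right]
  simpa only [Function.update_eq_self] using hd

theorem sum_anyonCharge (ν : ℝ) (N M : ℕ) :
    ∑ a, anyonCharge ν N M a = N * ν - M * (ν : ℂ)⁻¹ := by
  simp [anyonCharge, sub_eq_add_neg]

/-- The momentum operator acts as `ℋ^{ν,2}` without its charge term, plus the momentum of the gauge
factor. -/
theorem dCSMomentum_correlationFormula (hν : ν ≠ 0) {q₀ : ℝ} {A : ℂ} (hq : (q₀ : ℂ) = ν * A)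
    (h : (x, y) ∈ regularRegion N M) {ν₀ : ℝ} {η : Db} {B : ℕ} (hη : η ∈ boundedStates B)
    {c E₂ : ℂ} (hc : chargeOp ν₀ η = c • η) (h₂ : H2 ν₀ η = E₂ • η) :
    dCSMomentum (correlationFormula ν q₀ (bosonPoly (anyonCharge ν N M) η)) x y =
      (E₂ - c ^ 2 / 2 + A * ∑ a, anyonCharge ν N M a) *
        correlationFormula ν q₀ (bosonPoly (anyonCharge ν N M) η) x y := by
  have hsum := sum_eval_eulerDerivation (anyonCharge ν N M) (expConfig x y) ν₀ hη hc
  have hW := sum_gaugeField (anyonCharge ν N M) A (expConfig x y)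
  rw [h₂, map_smul, MvPolynomial.smul_eval] at hsum
  simp only [Fintype.sum_sum_type] at hsum hW ⊢
  rw [dCSMomentum, Finset.sum_congr rfl fun j _ => (deriv_correlationFormula_left hν hq h _ j).1,
    Finset.sum_congr rfl fun k _ => (deriv_correlationFormula_right hν hq h _ k).1,
    correlationFormula_eq]
  simp only [← Finset.sum_mul, ← Finset.mul_sum, Finset.sum_add_distrib]
  set F := MvPolynomial.eval (expConfig x y) (bosonPoly (anyonCharge ν N M) η)
  set G := gaugeFactor ν q₀ x y
  linear_combination G * hsum + F * G * hW -
    ((∑ j, gaugeField (anyonCharge ν N M) A (expConfig x y) (Sum.inl j)) * F +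
      ∑ j, MvPolynomial.eval (expConfig x y) (eulerDerivation (Sum.inl j)
        (bosonPoly (anyonCharge ν N M) η)) +
      ((∑ k, gaugeField (anyonCharge ν N M) A (expConfig x y) (Sum.inr k)) * F +
      ∑ k, MvPolynomial.eval (expConfig x y) (eulerDerivation (Sum.inr k)
        (bosonPoly (anyonCharge ν N M) η)))) * G * Complex.I_sq

/-- The gauge transformation of the deformed Calogero-Sutherland operator: the boson operator
`ℋ^{ν,3}` without its charge terms, plus the constant left over from the three-body terms. -/
theorem dCSHamiltonian_correlationFormula (hν : ν ≠ 0) {q₀ : ℝ} {A : ℂ} (hq : (q₀ : ℂ) = ν * A)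
    (h : (x, y) ∈ regularRegion N M) {ν₀ : ℝ} {η : Db} {B : ℕ} (hη : η ∈ boundedStates B)
    {c E₃ : ℂ} (hcA : c = A + (∑ a, anyonCharge ν N M a) / 2) (hc : chargeOp ν₀ η = c • η)
    (h₃ : H3 ν₀ ν η = E₃ • η) :
    dCSHamiltonian (ν ^ 2) (correlationFormula ν q₀ (bosonPoly (anyonCharge ν N M) η)) x y =
      (E₃ - (ν / 3 * c ^ 3 - (ν : ℂ) ^ 3 / 12 * c) +
        ν * ((∑ a, anyonCharge ν N M a) * A ^ 2 + (∑ a, anyonCharge ν N M a) ^ 3 / 12 -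
          (∑ a, anyonCharge ν N M a ^ 3) / 12)) *
        correlationFormula ν q₀ (bosonPoly (anyonCharge ν N M) η) x y := by
  have hνc : (ν : ℂ) ≠ 0 := by exact_mod_cast hν
  have hκ0 : ∀ a, anyonCharge ν N M a ≠ 0 := by
    rintro (j | k) <;> simp [anyonCharge, hνc]
  have hκ : ∀ a, (ν : ℂ) * (1 - anyonCharge ν N M a ^ 2) =
      (1 - (ν : ℂ) ^ 2) * anyonCharge ν N M a := by
    rintro (j | k)
    · simp only [anyonCharge, Sum.elim_inl]
      ring
    · simp only [anyonCharge, Sum.elim_inr]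
      field_simp
      ring
  have hz := expConfig_injective h
  have hsum := sum_eval_eulerDerivation_sq hκ0 ν₀ ν hκ A hz hη hcA hc
  have hW := sum_gaugeField_sq hκ0 A hz
  have hV := two_body_terms_cancel hν x y (z := expConfig x y) (fun _ => rfl) fun _ => rfl
  rw [h₃, map_smul, MvPolynomial.smul_eval] at hsum
  set z := expConfig x y
  set κ := anyonCharge ν N M
  set F := MvPolynomial.eval z (bosonPoly κ η)
  set G := gaugeFactor ν q₀ x y
  set X : Fin N ⊕ Fin M → ℂ := fun a =>
    MvPolynomial.eval z (eulerDerivation a (eulerDerivation a (bosonPoly κ η))) +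
      2 * gaugeField κ A z a * MvPolynomial.eval z (eulerDerivation a (bosonPoly κ η)) +
      (-κ a * ∑ b, κ b * pairInvSq (z a) (z b) + gaugeField κ A z a ^ 2) * F with hX
  -- The weights `1` of `-∂²/∂x²` and `-ν²` of `-∂²/∂y²` are the values of `ν / κ`.
  have hXsum : ∑ a, ν * (κ a)⁻¹ * X a =
      ∑ j, X (Sum.inl j) - (ν : ℂ) ^ 2 * ∑ k, X (Sum.inr k) := by
    rw [Fintype.sum_sum_type, Finset.mul_sum, sub_eq_add_neg, ← Finset.sum_neg_distrib]
    congr 1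
    · refine Finset.sum_congr rfl fun j _ => ?_
      simp [κ, anyonCharge, hνc]
    · refine Finset.sum_congr rfl fun k _ => ?_
      simp only [κ, anyonCharge, Sum.elim_inr, inv_neg, inv_inv]
      ring
  have hXsum' : ∑ a, ν * (κ a)⁻¹ * X a = E₃ * F - (ν / 3 * c ^ 3 - (ν : ℂ) ^ 3 / 12 * c) * F +
      ν * ((∑ a, κ a) * A ^ 2 + (∑ a, κ a) ^ 3 / 12 - (∑ a, κ a ^ 3) / 12 +
        ∑ a, ∑ b, (κ a * κ b ^ 2 - κ b) * pairInvSq (z a) (z b)) * F := by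
    rw [← hW, ← hsum, Finset.mul_sum, Finset.sum_mul, ← Finset.sum_add_distrib]
    refine Finset.sum_congr rfl fun a _ => ?_
    simp only [hX]
    ring
  rw [dCSHamiltonian, Finset.sum_congr rfl fun j _ => (deriv_correlationFormula_left hν hq h _ j).2,
    Finset.sum_congr rfl fun k _ => (deriv_correlationFormula_right hν hq h _ k).2,
    correlationFormula_eq]
  change -(∑ j, -X (Sum.inl j) * G) + _ * (G * F) + _ * (∑ k, -X (Sum.inr k) * G) +
    _ * (G * F) + _ * (G * F) = _ * (G * F)
  rw [← Finset.sum_mul, ← Finset.sum_mul, Finset.sum_neg_distrib, Finset.sum_neg_distrib]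
  push_cast
  linear_combination G * hXsum' - G * hXsum + F * G * hV

end Eigenfunction

/-! ### The charge of an eigenstate -/

theorem chargeOp_apply (ν₀ : ℝ) (η : Db) (i : FockIndex) :
    chargeOp ν₀ η i = ν₀ * (i.1 : ℂ) * η i := by
  induction η using Finsupp.induction_linear with
  | zero => simp
  | add u v hu hv => rw [map_add, Finsupp.add_apply, Finsupp.add_apply, hu, hv, mul_add]
  | single j b =>
    have h : Finsupp.single j b = b • bosonState j := by simp [bosonState]
    rw [h, map_smul, chargeOp_boson, smul_smul, bosonState, Finsupp.smul_apply, Finsupp.smul_apply,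
      Finsupp.single_apply]
    split_ifs with hij
    · rw [hij]
      simp only [smul_eq_mul]
      ring
    · simp

/-- An eigenstate of the charge operator is a combination of boson states of a single charge. -/
theorem exists_charge {ν₀ : ℝ} (hν₀ : ν₀ ≠ 0) {c : ℂ} {η : Db} (hη : η ≠ 0)
    (hc : chargeOp ν₀ η = c • η) :
    ∃ Q : ℤ, c = ν₀ * Q ∧ ∀ i ∈ η.support, i.1 = Q := by
  have hν₀c : (ν₀ : ℂ) ≠ 0 := by exact_mod_cast hν₀
  have key : ∀ i ∈ η.support, c = ν₀ * (i.1 : ℂ) := by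
    intro i hi
    have h := chargeOp_apply ν₀ η i
    rw [hc, Finsupp.smul_apply, smul_eq_mul] at h
    exact mul_right_cancel₀ (Finsupp.mem_support_iff.mp hi) h
  obtain ⟨i, hi⟩ := Finsupp.support_nonempty_iff.mpr hη
  refine ⟨i.1, key i hi, fun j hj => ?_⟩
  exact_mod_cast mul_left_cancel₀ hν₀c ((key j hj).symm.trans (key i hi))

theorem exists_mem_boundedStates (η : Db) : ∃ B, η ∈ boundedStates B := by
  refine ⟨η.support.sup fun i => i.2.support.sup fun n => (n : ℕ), ?_⟩
  suffices h : η.sum Finsupp.single ∈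
      boundedStates (η.support.sup fun i => i.2.support.sup fun n => (n : ℕ)) by
    rwa [Finsupp.sum_single] at h
  refine Submodule.sum_mem _ fun i hi => ?_
  have h : Finsupp.single i (η i) = η i • bosonState i := by simp [bosonState]
  rw [h]
  refine Submodule.smul_mem _ _ (Submodule.subset_span ⟨i, fun n hn => ?_, rfl⟩)
  exact (Finset.le_sup (f := fun n : ℕ+ => (n : ℕ)) hn).trans
    (Finset.le_sup (f := fun i : FockIndex => i.2.support.sup fun n => (n : ℕ)) hi)

end AnyonCFT

end

theorem corollary5p1
    (ν₀ ν : ℝ) (r s : ℕ) (hν₀ : 0 < ν₀) (hr : 0 < r) (hs : 0 < s)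
    (hν : ν = r * ν₀) (hνinv : 1 / ν = s * ν₀)
    (N M : ℕ) (η : AnyonCFT.Db) (E₁ E₂ E₃ : ℂ)
    (h₁ : Module.End.HasEigenvector (AnyonCFT.H1 ν₀ ν) E₁ η)
    (h₂ : Module.End.HasEigenvector (AnyonCFT.H2 ν₀) E₂ η)
    (h₃ : Module.End.HasEigenvector (AnyonCFT.H3 ν₀ ν) E₃ η) :
    ∃ Q : ℤ,
      (Q : ℂ) = (ν / ν₀) * E₁ - (ν / ν₀) * N + 1 / (ν * ν₀) * M ∧
      (∀ x y, (x, y) ∈ AnyonCFT.orderedRegion N M →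
        AnyonCFT.ProductConverges ν₀ (AnyonCFT.anyonFactors r s x y) (Q, 0)) ∧
      ∃ f : (Fin N → ℂ) → (Fin M → ℂ) → ℂ,
        AnalyticOnNhd ℂ (Function.uncurry f) (AnyonCFT.regularRegion N M) ∧
        (∀ x y, (x, y) ∈ AnyonCFT.adjointRegion N M →
          f x y = AnyonCFT.anyonCorrelation ν₀ r s Q η x y) ∧
        (∃ P ∈ AnyonCFT.deformedSymmetric N M (ν ^ 2),
          ∀ x y, (x, y) ∈ AnyonCFT.regularRegion N M →
            f x y =
              Complex.exp (Complex.I * ((1 / 2 * (N * ν ^ 2 - M) + ν₀ * ν * Q : ℝ) : ℂ) *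
                ((∑ j, x j) - (∑ k, y k) / ((ν ^ 2 : ℝ) : ℂ))) *
              AnyonCFT.groundState (ν ^ 2) x y * AnyonCFT.evalExp P x y) ∧
        (∀ x y, (x, y) ∈ AnyonCFT.regularRegion N M →
          AnyonCFT.dCSMomentum f x y = (E₂ - 1 / 2 * (ν₀ * Q) ^ 2) * f x y ∧
          AnyonCFT.dCSHamiltonian (ν ^ 2) f x y =
            (E₃ - 1 / 12 * ((ν : ℂ) ^ 2 - ((ν : ℂ) ^ 2)⁻¹) * M - ν * (ν₀ * Q) ^ 3 / 3 +
              (ν : ℂ) ^ 3 * (ν₀ * Q) / 12) * f x y) := by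
  have hν0 : ν ≠ 0 := by
    rw [hν]
    positivity
  have hνc : (ν : ℂ) ≠ 0 := by exact_mod_cast hν0
  have hν₀c : (ν₀ : ℂ) ≠ 0 := by exact_mod_cast hν₀.ne'
  have hr' : (r : ℂ) * ν₀ = ν := by
    rw [hν]
    push_cast
    rfl
  have hs' : (s : ℂ) * ν₀ = (ν : ℂ)⁻¹ := by
    rw [← one_div]
    exact_mod_cast hνinv.symm
  have hc : AnyonCFT.chargeOp ν₀ η = (ν * E₁) • η := by
    have h := h₁.apply_eq_smul
    rw [AnyonCFT.H1, LinearMap.smul_apply, one_div, inv_smul_eq_iff₀ hνc, smul_smul] at h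
    exact h
  obtain ⟨Q₀, hQ₀, hsupp⟩ := AnyonCFT.exists_charge hν₀.ne' h₁.2 hc
  obtain ⟨B, hB⟩ := AnyonCFT.exists_mem_boundedStates η
  -- The product of the vertex operators raises the charge by `r N - s M`.
  set Q : ℤ := Q₀ - (r * N - s * M) with hQ
  set K : ℂ := ∑ a, AnyonCFT.anyonCharge ν N M a with hK
  have hKval : K = N * ν - M * (ν : ℂ)⁻¹ := AnyonCFT.sum_anyonCharge ν N M
  have hK3 : ∑ a, AnyonCFT.anyonCharge ν N M a ^ 3 = N * (ν : ℂ) ^ 3 - M * ((ν : ℂ)⁻¹) ^ 3 := by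
    simp only [Fintype.sum_sum_type, AnyonCFT.anyonCharge, Sum.elim_inl, Sum.elim_inr,
      Finset.sum_const, Finset.card_univ, Fintype.card_fin, nsmul_eq_mul]
    ring
  have hcQ : ν * E₁ = ν₀ * Q + K := by
    rw [hQ₀, hKval, hQ, ← hs', ← hr']
    push_cast
    ring
  -- The plane wave has momentum `κ_a A` in the variable `a`, with `A = ν₀ Q + K / 2` the mean of the
  -- charges of the two states.
  have hq : ((1 / 2 * (N * ν ^ 2 - M) + ν₀ * ν * Q : ℝ) : ℂ) = ν * (ν₀ * Q + K / 2) := by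
    rw [hKval]
    push_cast
    field_simp
    ring
  refine ⟨Q, ?_, fun x y h => (AnyonCFT.productElem_chargedVacuum ν₀ Q _
    (AnyonCFT.anyonFactors_pairwise r s h)).1,
    AnyonCFT.correlationFormula ν (1 / 2 * (N * ν ^ 2 - M) + ν₀ * ν * Q)
      (AnyonCFT.bosonPoly (AnyonCFT.anyonCharge ν N M) η),
    AnyonCFT.analyticOnNhd_correlationFormula _ _ _, fun x y h => ?_,
    ⟨_, AnyonCFT.bosonPoly_mem hν0 N M η, fun x y _ => rfl⟩, fun x y h => ⟨?_, ?_⟩⟩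
  · rw [hKval] at hcQ
    field_simp
    field_simp at hcQ
    linear_combination -hcQ
  · exact (AnyonCFT.anyonCorrelation_eq hν0 hν hνinv Q
      (fun i hi => by rw [hsupp i hi, hQ]; ring) h).symm
  · rw [AnyonCFT.dCSMomentum_correlationFormula hν0 hq h hB hc h₂.apply_eq_smul, hcQ]
    ring
  · rw [AnyonCFT.dCSHamiltonian_correlationFormula hν0 hq h hB (by rw [hcQ]; ring) hc
      h₃.apply_eq_smul, hK3, hcQ, ← hK, hKval]
    congr 1
    field_simp
    ring
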